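/- **Conventions.** A DGLA over $\mathbb{C}$ is a graded vector space $C=\bigoplus_{j\in\mathbb{N}}C^j$ with a differential $d$ of degree $1$ and a graded Lie bracket satisfying the graded skew-symmetry, Jacobi and Leibniz rules. A $C$-module is a complex $M=\bigoplus_{j\in\mathbb{N}}M^j$ of complex vector spaces with a bilinear multiplication $C\times M\to M$, $C^i\cdot M^j\subset M^{i+j}$, such that, for $\alpha\in C^i$ and $\beta\in C^j$, $[\alpha,\beta]\zeta=\alpha(\beta\zeta)-(-1)^{ij}\beta(\alpha\zeta)$ and $d(\alpha\xi)=(d\alpha)\xi+(-1)^i\alpha(d\xi)$. A DGLA pair $(C,M)$ is a DGLA $C$ with a $C$-module $M$ such that $M$ is bounded above and every $H^j(M)$ is finite dimensional. A morphism $g=(g_1,g_2):(C,M)\to(D,N)$ of DGLA pairs is a homomorphism $g_1:C\to D$ of DGLAs with a homomorphism $g_2:M\to N$ of $C$-modules, where $N$ is a $C$-module through $g_1$. A morphism of complexes is a $q$-equivalence if it induces isomorphisms on cohomology in degrees $\le q$ and a monomorphism in degree $q+1$. A morphism $g$ of DGLA pairs is a $q$-equivalence if $g_1$ is a $1$-equivalence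 and $g_2$ is a $q$-equivalence; two DGLA pairs have the same $q$-homotopy type if they are connected by a zig-zag of $q$-equivalences of DGLA pairs. Let $\mathsf{ART}$ be the category of Artinian local $\mathbb{C}$-algebras of finite type with local homomorphisms. For $A\in\mathsf{ART}$ with maximal ideal $m$, let $\mathcal{C}(C;A)$ be the groupoid with objects $\omega\in C^1\otimes_{\mathbb{C}} m$ such that $d\omega+\frac12[\omega,\omega]=0$, and morphisms $\omega_1\to\omega_2$ the $\lambda\in C^0\otimes_{\mathbb{C}} m$ with $$\exp(\operatorname{ad}\lambda)\,\omega_1+\frac{1-\exp(\operatorname{ad}\lambda)}{\operatorname{ad}\lambda}(d\lambda)=\omega_2 .$$ The deformation functor $\mathrm{Def}(C):\mathsf{ART}\to\mathsf{SET}$ sends $A$ to the set of isomorphism classes of $\mathcal{C}(C;A)$. For a Noetherian ring $R$ and a bounded above complex $E^\bullet$ of $R$-modules with finitely generated cohomology, choose a quasi-isomorphism $F^\bullet\to E^\bullet$ from a bounded above complex of finitely generated free $R$-modules, and let $J^i_k(E^\bullet)=I_{\operatorname{rank}(F^i)-k+1}(d^{i-1}\oplus d^i)$ be the ideal of minors of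 that size of $d^{i-1}\oplus d^i:F^{i-1}\oplus F^i\to F^i\oplus F^{i+1}$ (the unit ideal if the size is $\le 0$); it does not depend on the choice of $F^\bullet$. For integers $i,k\ge 0$ the cohomology jump functor $\mathrm{Def}^i_k(C,M)$ is the subfunctor of $\mathrm{Def}(C)$ that sends $A$ to the set of isomorphism classes of those objects $\omega$ of $\mathcal{C}(C;A)$ for which $J^i_k(M\otimes_{\mathbb{C}}A,\,d\otimes\mathrm{id}_A+\omega)=0$. **Theorem 1.2.** Let $i,k\ge 0$ be integers. (a) Let $g=(g_1,g_2):(C,M)\to(D,N)$ be a morphism of DGLA pairs such that $g_1$ is a $1$-equivalence and $g_2$ is an $i$-equivalence. Then the natural transformation $g_{1*}:\mathrm{Def}(C)\to\mathrm{Def}(D)$ restricts to a natural transformation $g_*:\mathrm{Def}^i_k(C,M)\to\mathrm{Def}^i_k(D,N)$, and $g_*$ is an isomorphism of functors. (b) The functor $\mathrm{Def}^i_k(C,M)$ depends only on the $i$-homotopy type of $(C,M)$: if two DGLA pairs $(C,M)$ and $(D,N)$ have the same $i$-homotopy type, then $\mathrm{Def}^i_k(C,M)$ and $\mathrm{Def}^i_k(D,N)$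 are isomorphic functors $\mathsf{ART}\to\mathsf{SET}$. -/

import Mathlib

open CategoryTheory TensorProduct

universe u v w

noncomputable section

/-! ### Determinantal ideals and cohomology jump ideals of complexes -/

section JumpIdeals

variable {R : Type w} [CommRing R]

/-- The determinantal ideal `I_r(f)`, written without bases: it is generated by all determinants
`det (φ_a (f x_b))` with `r` vectors `x_b` of the source and `r` linear forms `φ_a` on the target.
For finitely generated free modules it is the ideal of minors of size `r` of any matrix of `f`, see
`detIdeal_eq_span_minors`; in particular `I_0(f)` is the unit ideal. -/
def detIdeal {X Y : Type*} [AddCommGroup X] [Module R X] [AddCommGroup Y] [Module R Y]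
    (r : ℕ) (f : X →ₗ[R] Y) : Ideal R :=
  Ideal.span {z | ∃ (x : Fin r → X) (φ : Fin r → Module.Dual R Y),
    z = Matrix.det (Matrix.of fun a b => φ a (f (x b)))}

theorem det_row_expand {r : ℕ} {ι : Type*} [Fintype ι] (P : Fin r → ι → R)
    (N : ι → Fin r → R) :
    Matrix.det (Matrix.of fun a b => ∑ j, P a j * N j b) =
      ∑ s : Fin r → ι, (∏ a, P a (s a)) * Matrix.det (Matrix.of fun a b => N (s a) b) := by
  classical
  have h := (Matrix.detRowAlternating (n := Fin r) (R := R)).toMultilinearMap.map_sum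
    (fun a (j : ι) => P a j • N j)
  have h1 : (fun a => ∑ j, P a j • N j) = Matrix.of fun a b => ∑ j, P a j * N j b := by
    ext a b
    simp
  rw [h1] at h
  refine h.trans (Finset.sum_congr rfl fun s _ => ?_)
  exact (Matrix.detRowAlternating (n := Fin r) (R := R)).toMultilinearMap.map_smul_univ
    (fun a => P a (s a)) (fun a => N (s a))

theorem det_mem_of_expand {r : ℕ} {ι κ : Type*} [Fintype ι] [Fintype κ] (J : Ideal R)
    (P : Fin r → ι → R) (N : ι → κ → R) (Q : κ → Fin r → R)
    (h : ∀ (s : Fin r → ι) (t : Fin r → κ), Matrix.det (Matrix.of fun a b => N (s a) (t b)) ∈ J) :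
    Matrix.det (Matrix.of fun a b => ∑ j, P a j * ∑ l, Q l b * N j l) ∈ J := by
  rw [det_row_expand P (fun j b => ∑ l, Q l b * N j l)]
  refine J.sum_mem fun s _ => J.mul_mem_left _ ?_
  rw [← Matrix.det_transpose]
  have := det_row_expand (fun b l => Q l b) (fun l a => N (s a) l)
  change Matrix.det (Matrix.of fun b a => ∑ l, Q l b * N (s a) l) ∈ J
  rw [this]
  refine J.sum_mem fun t _ => J.mul_mem_left _ ?_
  rw [← Matrix.det_transpose]
  exact h s t

theorem detIdeal_eq_span_minors {X Y ι κ : Type*} [AddCommGroup X] [Module R X] [AddCommGroup Y]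
    [Module R Y] [Fintype ι] [Fintype κ] [DecidableEq ι] (b : Module.Basis ι R X)
    (c : Module.Basis κ R Y) (r : ℕ) (f : X →ₗ[R] Y) :
    detIdeal r f = Ideal.span {z | ∃ (s : Fin r → κ) (t : Fin r → ι),
      z = Matrix.det ((LinearMap.toMatrix b c f).submatrix s t)} := by
  apply le_antisymm
  · refine Ideal.span_le.2 ?_
    rintro _ ⟨x, φ, rfl⟩
    have h := det_mem_of_expand (Ideal.span {z | ∃ (s : Fin r → κ) (t : Fin r → ι),
      z = Matrix.det ((LinearMap.toMatrix b c f).submatrix s t)})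
      (fun a j => φ a (c j)) (fun j l => LinearMap.toMatrix b c f j l)
      (fun l m => b.repr (x m) l) (fun s t => Ideal.subset_span ⟨s, t, rfl⟩)
    refine Eq.subst (motive := fun M => Matrix.det M ∈ _) ?_ h
    ext a m
    have h1 : f (x m) = ∑ j, (∑ l, b.repr (x m) l * LinearMap.toMatrix b c f j l) • c j := by
      conv_lhs => rw [← c.sum_repr (f (x m)), ← LinearMap.toMatrix_mulVec_repr b c f (x m)]
      simp only [Matrix.mulVec, dotProduct, mul_comm]
    simp only [Matrix.of_apply]
    rw [h1, map_sum]
    exact Finset.sum_congr rfl fun j _ => by rw [map_smul, smul_eq_mul, mul_comm]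
  · refine Ideal.span_le.2 ?_
    rintro _ ⟨s, t, rfl⟩
    refine Ideal.subset_span ⟨fun m => b (t m), fun a => c.coord (s a), ?_⟩
    congr 1
    ext a m
    simp [LinearMap.toMatrix_apply]

theorem detIdeal_le_map {S : Type*} [CommRing S] [Algebra R S] {X Y X' Y' ι κ : Type*}
    [AddCommGroup X] [Module R X] [AddCommGroup Y] [Module R Y]
    [AddCommGroup X'] [Module S X'] [AddCommGroup Y'] [Module S Y'] [Fintype ι] [Fintype κ]
    [DecidableEq ι] (b : Module.Basis ι R X) (c : Module.Basis κ R Y)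
    (b' : Module.Basis ι S X') (c' : Module.Basis κ S Y') (r : ℕ) (f : X →ₗ[R] Y)
    (f' : X' →ₗ[S] Y')
    (h : LinearMap.toMatrix b' c' f' = (LinearMap.toMatrix b c f).map (algebraMap R S)) :
    detIdeal r f' ≤ (detIdeal r f).map (algebraMap R S) := by
  rw [detIdeal_eq_span_minors b' c']
  refine Ideal.span_le.2 ?_
  rintro _ ⟨s, t, rfl⟩
  rw [h, Matrix.submatrix_map]
  have : ((LinearMap.toMatrix b c f).submatrix s t).det ∈ detIdeal r f := by
    rw [detIdeal_eq_span_minors b c]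
    exact Ideal.subset_span ⟨s, t, rfl⟩
  have h := Ideal.mem_map_of_mem (algebraMap R S) this
  rwa [RingHom.map_det] at h

theorem detIdeal_prodMap_baseChange_le {S : Type*} [CommRing S] [Algebra R S]
    {X Y Z : Type*} [AddCommGroup X] [Module R X] [AddCommGroup Y] [Module R Y] [AddCommGroup Z]
    [Module R Z] [Module.Finite R X] [Module.Free R X] [Module.Finite R Y] [Module.Free R Y]
    [Module.Finite R Z] [Module.Free R Z] (r : ℕ) (f : X →ₗ[R] Y) (g : Y →ₗ[R] Z) :
    detIdeal r ((f.baseChange S).prodMap (g.baseChange S)) ≤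
      (detIdeal r (f.prodMap g)).map (algebraMap R S) := by
  classical
  let b := Module.Free.chooseBasis R X
  let c := Module.Free.chooseBasis R Y
  let e := Module.Free.chooseBasis R Z
  refine detIdeal_le_map (b.prod c) (c.prod e) ((b.baseChange S).prod (c.baseChange S))
    ((c.baseChange S).prod (e.baseChange S)) r _ _ ?_
  ext i j
  rcases i with i | i <;> rcases j with j | j <;>
    simp [LinearMap.toMatrix_apply, Algebra.smul_def]

/-- A resolution of a complex `E` of `R`-modules: a quasi-isomorphism `F ⟶ E` from a bounded above
complex of finitely generated free `R`-modules. -/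
structure FreeResolution (E : CochainComplex (ModuleCat.{v} R) ℤ) where
  F : CochainComplex (ModuleCat.{v} R) ℤ
  bounded : ∃ N : ℤ, ∀ n, N < n → Subsingleton (F.X n)
  finite : ∀ n, Module.Finite R (F.X n)
  free : ∀ n, Module.Free R (F.X n)
  φ : F ⟶ E
  quasiIso : QuasiIso φ

/-- The ideal `I_{rank(F^i) - k + 1}(d^{i-1} ⊕ d^i)` of a complex of finitely generated free
modules. Minors of size `≤ 0` generate the unit ideal, and so does `detIdeal 0`, so that the
truncated subtraction is harmless. -/
def jumpIdealOf (F : CochainComplex (ModuleCat.{v} R) ℤ) (i : ℤ) (k : ℕ) : Ideal R :=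
  detIdeal (Module.finrank R (F.X i) + 1 - k)
    (LinearMap.prodMap (F.d (i - 1) i).hom (F.d i (i + 1)).hom)

/-- `J` is the cohomology jump ideal `J^i_k(E)`: it is `I_{rank(F^i) - k + 1}(d^{i-1} ⊕ d^i)`
for a resolution `F` of `E` by finitely generated free modules. (The ideal does not depend on `F`;
resolutions exist when `R` is Noetherian and `E` is bounded above with finitely generated
cohomology.) -/
def IsJumpIdeal (E : CochainComplex (ModuleCat.{v} R) ℤ) (i : ℤ) (k : ℕ) (J : Ideal R) : Prop :=
  ∃ P : FreeResolution E, J = jumpIdealOf P.F i k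

/-- `f` is a `q`-equivalence: an isomorphism on cohomology in degrees `≤ q` and a monomorphism on
cohomology in degree `q + 1`. -/
def IsQEquivalence {K L : CochainComplex (ModuleCat.{v} R) ℤ} (f : K ⟶ L) (q : ℤ) : Prop :=
  (∀ j ≤ q, IsIso (HomologicalComplex.homologyMap f j)) ∧
    Mono (HomologicalComplex.homologyMap f (q + 1))

/-- A cochain complex of modules from its terms and its differentials. -/
def mkComplex (X : ℤ → ModuleCat.{v} R) (δ : ∀ i j, i + 1 = j → (X i ⟶ X j))
    (hδ : ∀ i j k (h : i + 1 = j) (h' : j + 1 = k), δ i j h ≫ δ j k h' = 0) :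
    CochainComplex (ModuleCat.{v} R) ℤ where
  X := X
  d i j := if h : i + 1 = j then δ i j h else 0
  shape i j h := dif_neg h
  d_comp_d' i j k h h' := by
    have h : i + 1 = j := h
    have h' : j + 1 = k := h'
    rw [dif_pos h, dif_pos h', hδ]

/-- A morphism of cochain complexes from its components. -/
def mkComplexHom {X Y : ℤ → ModuleCat.{v} R} {δ : ∀ i j, i + 1 = j → (X i ⟶ X j)}
    {hδ : ∀ i j k (h : i + 1 = j) (h' : j + 1 = k), δ i j h ≫ δ j k h' = 0}
    {ε : ∀ i j, i + 1 = j → (Y i ⟶ Y j)}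
    {hε : ∀ i j k (h : i + 1 = j) (h' : j + 1 = k), ε i j h ≫ ε j k h' = 0}
    (f : ∀ i, X i ⟶ Y i) (hf : ∀ i j (h : i + 1 = j), f i ≫ ε i j h = δ i j h ≫ f j) :
    mkComplex X δ hδ ⟶ mkComplex Y ε hε where
  f := f
  comm' i j h := by
    have h : i + 1 = j := h
    simp only [mkComplex, dif_pos h]
    exact hf i j h

end JumpIdeals

/-! ### Base change of jump ideals -/

section BaseChange

variable (A B : Type w) [CommRing A] [CommRing B] [Algebra A B]

/-- Extension of scalars along `A → B`. -/
def extFunctor : ModuleCat.{max v w} A ⥤ ModuleCat.{max v w} B where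
  obj X := ModuleCat.of B (B ⊗[A] X)
  map f := ModuleCat.ofHom (f.hom.baseChange B)
  map_id X := by
    ext1
    exact LinearMap.baseChange_id
  map_comp f g := by
    ext1
    exact LinearMap.baseChange_comp _ _

instance extFunctor_additive : (extFunctor.{v} A B).Additive where
  map_add {X Y f g} := by
    ext1
    exact LinearMap.baseChange_add _ _

theorem isKProjective_of_free (E : CochainComplex (ModuleCat.{max v w} A) ℤ)
    (hb : ∃ N : ℤ, ∀ n, N < n → Subsingleton (E.X n)) (hf : ∀ n, Module.Free A (E.X n)) :
    E.IsKProjective := by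
  obtain ⟨N, hN⟩ := hb
  have h1 : E.IsStrictlyLE N := by
    rw [CochainComplex.isStrictlyLE_iff]
    intro n hn
    have := hN n hn
    exact ModuleCat.isZero_of_subsingleton _
  have h2 : ∀ n, Projective (E.X n) := fun n => by
    have := hf n
    exact (IsProjective.iff_projective (E.X n)).1 inferInstance
  exact CochainComplex.isKProjective_of_projective E N

theorem isJumpIdeal_bot_baseChange [Nontrivial A] [Nontrivial B]
    (E : CochainComplex (ModuleCat.{max v w} A) ℤ)
    (hb : ∃ N : ℤ, ∀ n, N < n → Subsingleton (E.X n)) (hf : ∀ n, Module.Free A (E.X n))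
    (i : ℤ) (k : ℕ) (h : IsJumpIdeal E i k ⊥)
    (E' : CochainComplex (ModuleCat.{max v w} B) ℤ)
    (e : ((extFunctor.{v} A B).mapHomologicalComplex _).obj E ≅ E') :
    IsJumpIdeal E' i k ⊥ := by
  obtain ⟨P, hP⟩ := h
  have hfin := P.finite
  have hfree := P.free
  let Φ := (extFunctor.{v} A B).mapHomologicalComplex (ComplexShape.up ℤ)
  have k1 := isKProjective_of_free A P.F P.bounded P.free
  have k2 := isKProjective_of_free A E hb hf
  have hq : HomologicalComplex.homotopyEquivalences (ModuleCat.{max v w} A) (ComplexShape.up ℤ) P.φ :=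
    (CochainComplex.IsKProjective.quasiIso_iff P.φ).1 P.quasiIso
  obtain ⟨ψ, hψ⟩ := hq
  have hq' : QuasiIso (Φ.map P.φ) := by
    rw [← hψ]
    exact homotopyEquivalences_le_quasiIso _ _ _ ⟨(extFunctor.{v} A B).mapHomotopyEquiv ψ, rfl⟩
  refine ⟨⟨Φ.obj P.F, ?_, fun n => ?_, fun n => ?_, Φ.map P.φ ≫ e.hom, inferInstance⟩, ?_⟩
  · obtain ⟨N, hN⟩ := P.bounded
    refine ⟨N, fun n hn => ?_⟩
    have := hN n hn
    change Subsingleton (B ⊗[A] P.F.X n)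
    infer_instance
  · change Module.Finite B (B ⊗[A] P.F.X n)
    infer_instance
  · change Module.Free B (B ⊗[A] P.F.X n)
    infer_instance
  · symm
    rw [eq_bot_iff]
    have h1 := detIdeal_prodMap_baseChange_le (S := B) (Module.finrank A (P.F.X i) + 1 - k)
      (P.F.d (i - 1) i).hom (P.F.d i (i + 1)).hom
    have h2 : detIdeal (Module.finrank A (P.F.X i) + 1 - k)
      (LinearMap.prodMap (P.F.d (i - 1) i).hom (P.F.d i (i + 1)).hom) = ⊥ := hP.symm
    rw [h2, Ideal.map_bot, ← Module.finrank_baseChange (R := B)] at h1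
    exact h1

end BaseChange

/-! ### Extension of scalars of bilinear maps -/

section Bilinear

variable {X Y Z : Type u} [AddCommGroup X] [Module ℂ X] [AddCommGroup Y] [Module ℂ Y]
  [AddCommGroup Z] [Module ℂ Z]

/-- The restriction of a bilinear map to subspaces. -/
def bilinRestrict (f : X →ₗ[ℂ] Y →ₗ[ℂ] Z) (p : Submodule ℂ X) (q : Submodule ℂ Y)
    (r : Submodule ℂ Z) (h : ∀ x ∈ p, ∀ y ∈ q, f x y ∈ r) : p →ₗ[ℂ] q →ₗ[ℂ] r :=
  LinearMap.mk₂ ℂ (fun x y => ⟨f x y, h x x.2 y y.2⟩)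
    (fun _ _ _ => Subtype.ext (by simp)) (fun _ _ _ => Subtype.ext (by simp))
    (fun _ _ _ => Subtype.ext (by simp)) (fun _ _ _ => Subtype.ext (by simp))

variable (A : Type w) [CommRing A] [Algebra ℂ A]

/-- The `A`-bilinear extension `(a ⊗ x, b ⊗ y) ↦ ab ⊗ f x y` of a bilinear map `f`. -/
def bilinExt (f : X →ₗ[ℂ] Y →ₗ[ℂ] Z) : (A ⊗[ℂ] X) →ₗ[A] (A ⊗[ℂ] Y) →ₗ[A] (A ⊗[ℂ] Z) :=
  ((LinearMap.baseChangeHom ℂ A Y Z).comp f).liftBaseChange A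

@[simp] theorem bilinExt_tmul (f : X →ₗ[ℂ] Y →ₗ[ℂ] Z) (a b : A) (x : X) (y : Y) :
    bilinExt A f (a ⊗ₜ x) (b ⊗ₜ y) = (a * b) ⊗ₜ f x y := by
  simp [bilinExt, TensorProduct.smul_tmul']

end Bilinear

/-! ### Differential graded Lie algebras and their modules -/

/-- A complex of complex vector spaces `V = ⨁_{i ∈ ℕ} V^i`, the grading being extended by zero to
negative degrees. -/
structure GradedCx where
  carrier : Type u
  [addCommGroup : AddCommGroup carrier]
  [module : Module ℂ carrier]
  gr : ℤ → Submodule ℂ carrier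
  isInternal : DirectSum.IsInternal gr
  gr_neg : ∀ n < 0, gr n = ⊥
  d : carrier →ₗ[ℂ] carrier
  d_mem : ∀ n, ∀ x ∈ gr n, d x ∈ gr (n + 1)
  d_d : ∀ x, d (d x) = 0

attribute [instance] GradedCx.addCommGroup GradedCx.module

namespace GradedCx

/-- The differential `V^i → V^j`, where `j = i + 1`. -/
def dRes (V : GradedCx.{u}) (i j : ℤ) (h : i + 1 = j) : V.gr i →ₗ[ℂ] V.gr j :=
  V.d.restrict fun x hx => h ▸ V.d_mem i x hx

theorem dRes_dRes (V : GradedCx.{u}) (i j k : ℤ) (h : i + 1 = j) (h' : j + 1 = k) (x : V.gr i) :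
    V.dRes j k h' (V.dRes i j h x) = 0 :=
  Subtype.ext (V.d_d x)

/-- The underlying cochain complex. -/
def cx (V : GradedCx.{u}) : CochainComplex (ModuleCat.{u} ℂ) ℤ :=
  mkComplex (fun n => ModuleCat.of ℂ (V.gr n)) (fun i j h => ModuleCat.ofHom (V.dRes i j h))
    fun i j k h h' => by
      ext x : 2
      exact V.dRes_dRes i j k h h' x

/-- A linear map that preserves the grading and commutes with the differentials. -/
structure Hom (V W : GradedCx.{u}) where
  toLin : V.carrier →ₗ[ℂ] W.carrier
  map_gr : ∀ n, ∀ x ∈ V.gr n, toLin x ∈ W.gr n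
  map_d : ∀ x, toLin (V.d x) = W.d (toLin x)

variable {V W : GradedCx.{u}}

/-- The component in degree `n`. -/
def Hom.res (f : Hom V W) (n : ℤ) : V.gr n →ₗ[ℂ] W.gr n :=
  f.toLin.restrict (f.map_gr n)

theorem Hom.res_d (f : Hom V W) (i j : ℤ) (h : i + 1 = j) (x : V.gr i) :
    f.res j (V.dRes i j h x) = W.dRes i j h (f.res i x) :=
  Subtype.ext (f.map_d x)

/-- The induced map of cochain complexes. -/
def Hom.cx (f : Hom V W) : V.cx ⟶ W.cx :=
  mkComplexHom (fun n => ModuleCat.ofHom (f.res n)) fun i j h => by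
    ext x : 2
    exact (f.res_d i j h x).symm

end GradedCx

/-- A differential graded Lie algebra over `ℂ`. -/
structure DGLA extends GradedCx.{u} where
  bracket : carrier →ₗ[ℂ] carrier →ₗ[ℂ] carrier
  bracket_mem : ∀ i j, ∀ α ∈ gr i, ∀ β ∈ gr j, bracket α β ∈ gr (i + j)
  skew : ∀ i j, ∀ α ∈ gr i, ∀ β ∈ gr j,
    bracket α β + (-1 : ℂ) ^ (i * j) • bracket β α = 0
  jacobi : ∀ i j k, ∀ α ∈ gr i, ∀ β ∈ gr j, ∀ γ ∈ gr k,
    (-1 : ℂ) ^ (k * i) • bracket α (bracket β γ) + (-1 : ℂ) ^ (i * j) • bracket β (bracket γ α) +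
      (-1 : ℂ) ^ (j * k) • bracket γ (bracket α β) = 0
  leibniz : ∀ i, ∀ α ∈ gr i, ∀ β,
    d (bracket α β) = bracket (d α) β + (-1 : ℂ) ^ i • bracket α (d β)

namespace DGLA

/-- The bracket `C^i × C^j → C^k`, where `k = i + j`. -/
def br (C : DGLA.{u}) (i j k : ℤ) (h : i + j = k) : C.gr i →ₗ[ℂ] C.gr j →ₗ[ℂ] C.gr k :=
  bilinRestrict C.bracket _ _ _ fun α hα β hβ => h ▸ C.bracket_mem i j α hα β hβ

/-- A homomorphism of differential graded Lie algebras. -/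
structure Hom (C D : DGLA.{u}) extends GradedCx.Hom C.toGradedCx D.toGradedCx where
  map_bracket : ∀ α β, toLin (C.bracket α β) = D.bracket (toLin α) (toLin β)

end DGLA

/-- A differential graded module over the differential graded Lie algebra `C`. -/
structure DGModule (C : DGLA.{u}) extends GradedCx.{u} where
  act : C.carrier →ₗ[ℂ] carrier →ₗ[ℂ] carrier
  act_mem : ∀ i j, ∀ α ∈ C.gr i, ∀ ξ ∈ gr j, act α ξ ∈ gr (i + j)
  bracket_act : ∀ i j, ∀ α ∈ C.gr i, ∀ β ∈ C.gr j, ∀ ζ,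
    act (C.bracket α β) ζ = act α (act β ζ) - (-1 : ℂ) ^ (i * j) • act β (act α ζ)
  d_act : ∀ i, ∀ α ∈ C.gr i, ∀ ξ, d (act α ξ) = act (C.d α) ξ + (-1 : ℂ) ^ i • act α (d ξ)

/-- The action `C^i × M^j → M^k`, where `k = i + j`. -/
def DGModule.ac {C : DGLA.{u}} (M : DGModule C) (i j k : ℤ) (h : i + j = k) :
    C.gr i →ₗ[ℂ] M.gr j →ₗ[ℂ] M.gr k :=
  bilinRestrict M.act _ _ _ fun α hα ξ hξ => h ▸ M.act_mem i j α hα ξ hξ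

/-- A DGLA pair `(C, M)`. The complex `M` is bounded above and has finite dimensional cohomology in
every degree. -/
structure DGLAPair where
  C : DGLA.{u}
  M : DGModule C
  bounded : ∃ N : ℤ, ∀ n, N < n → M.gr n = ⊥
  finite : ∀ n, Module.Finite ℂ (M.cx.homology n)

namespace DGLAPair

/-- A homomorphism of DGLA pairs: a homomorphism `g₁ : C → D` of DGLAs and a homomorphism
`g₂ : M → N` of `C`-modules, where `N` is a `C`-module through `g₁`. -/
structure Hom (P Q : DGLAPair.{u}) where
  fst : DGLA.Hom P.C Q.C
  snd : GradedCx.Hom P.M.toGradedCx Q.M.toGradedCx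
  map_act : ∀ α ξ, snd.toLin (P.M.act α ξ) = Q.M.act (fst.toLin α) (snd.toLin ξ)

/-- `g = (g₁, g₂)` is a `q`-equivalence of DGLA pairs: `g₁` is a `1`-equivalence and `g₂` is a
`q`-equivalence. -/
def Hom.IsEquivalence {P Q : DGLAPair.{u}} (g : Hom P Q) (q : ℕ) : Prop :=
  IsQEquivalence g.fst.cx 1 ∧ IsQEquivalence g.snd.cx q

/-- Two DGLA pairs have the same `q`-homotopy type if they are connected by a zig-zag of
`q`-equivalences. -/
def SameHomotopyType (q : ℕ) : DGLAPair.{u} → DGLAPair.{u} → Prop :=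
  Relation.EqvGen fun P Q => ∃ g : Hom P Q, g.IsEquivalence q

end DGLAPair

/-! ### Artinian local algebras -/

/-- Artinian local algebras of finite type over `ℂ`. -/
structure ArtAlg where
  carrier : Type w
  [commRing : CommRing carrier]
  [algebra : Algebra ℂ carrier]
  [isLocal : IsLocalRing carrier]
  [isArtinian : IsArtinianRing carrier]
  [finiteType : Algebra.FiniteType ℂ carrier]

namespace ArtAlg

attribute [instance] commRing algebra isLocal isArtinian finiteType

instance : CoeSort ArtAlg.{w} (Type w) := ⟨carrier⟩

/-- Local homomorphisms of `ℂ`-algebras. -/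
structure Hom (A B : ArtAlg.{w}) where
  toAlgHom : A →ₐ[ℂ] B
  isLocal : IsLocalHom toAlgHom.toRingHom

theorem Hom.ext' {A B : ArtAlg.{w}} {f g : Hom A B} (h : f.toAlgHom = g.toAlgHom) : f = g := by
  cases f
  cases g
  cases h
  rfl

instance : Category ArtAlg.{w} where
  Hom := Hom
  id A := ⟨AlgHom.id ℂ A, ⟨fun _ h => h⟩⟩
  comp f g := ⟨g.toAlgHom.comp f.toAlgHom, ⟨fun a h => f.isLocal.1 a (g.isLocal.1 _ h)⟩⟩

/-- The maximal ideal. -/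
abbrev m (A : ArtAlg.{w}) : Ideal A := IsLocalRing.maximalIdeal A

end ArtAlg

/-! ### The deformation functor -/

/-- The action of a local homomorphism `A → B` on `A ⊗ V`. -/
def pushTensor {A B : ArtAlg.{w}} (f : A ⟶ B) (V : Type u) [AddCommGroup V] [Module ℂ V] :
    A ⊗[ℂ] V →ₗ[ℂ] B ⊗[ℂ] V :=
  LinearMap.rTensor V (ArtAlg.Hom.toAlgHom f).toLinearMap

section Push

variable {A B : ArtAlg.{w}} {X Y Z : Type u} [AddCommGroup X] [Module ℂ X] [AddCommGroup Y]
  [Module ℂ Y] [AddCommGroup Z] [Module ℂ Z]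

@[simp] theorem pushTensor_tmul (f : A ⟶ B) (a : A) (x : X) :
    pushTensor f X (a ⊗ₜ x) = ArtAlg.Hom.toAlgHom f a ⊗ₜ x := rfl

theorem pushTensor_baseChange (f : A ⟶ B) (g : X →ₗ[ℂ] Y) (s : A ⊗[ℂ] X) :
    pushTensor f Y (g.baseChange A s) = g.baseChange B (pushTensor f X s) := by
  induction s with
  | zero => simp
  | tmul a x => simp
  | add s t hs ht => simp only [map_add, hs, ht]

theorem pushTensor_bilinExt (f : A ⟶ B) (g : X →ₗ[ℂ] Y →ₗ[ℂ] Z) (s : A ⊗[ℂ] X)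
    (t : A ⊗[ℂ] Y) :
    pushTensor f Z (bilinExt A g s t) = bilinExt B g (pushTensor f X s) (pushTensor f Y t) := by
  induction s with
  | zero => simp
  | tmul a x =>
    induction t with
    | zero => simp
    | tmul b y => simp
    | add s t hs ht => simp only [map_add, hs, ht]
  | add s t hs ht => simp only [map_add, LinearMap.add_apply, hs, ht]

theorem pushTensor_smul (f : A ⟶ B) (a : A) (s : A ⊗[ℂ] X) :
    pushTensor f X (a • s) = ArtAlg.Hom.toAlgHom f a • pushTensor f X s := by
  induction s with
  | zero => simp
  | tmul b x => simp [TensorProduct.smul_tmul']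
  | add s t hs ht => simp only [map_add, smul_add, hs, ht]

theorem pushTensor_mem (f : A ⟶ B) {s : A ⊗[ℂ] X} (hs : s ∈ A.m • (⊤ : Submodule A (A ⊗[ℂ] X))) :
    pushTensor f X s ∈ B.m • (⊤ : Submodule B (B ⊗[ℂ] X)) := by
  refine Submodule.smul_induction_on hs (fun a ha n _ => ?_) fun x y hx hy => ?_
  · rw [pushTensor_smul]
    refine Submodule.smul_mem_smul ?_ trivial
    rw [IsLocalRing.mem_maximalIdeal] at ha ⊢
    exact fun h => ha ((ArtAlg.Hom.isLocal f).1 a h)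
  · rw [map_add]
    exact add_mem hx hy

theorem pushTensor_id (s : A ⊗[ℂ] X) : pushTensor (𝟙 A) X s = s := by
  change LinearMap.rTensor X (LinearMap.id) s = s
  rw [LinearMap.rTensor_id, LinearMap.id_apply]

theorem pushTensor_comp {B' : ArtAlg.{w}} (f : A ⟶ B) (g : B ⟶ B') (s : A ⊗[ℂ] X) :
    pushTensor (f ≫ g) X s = pushTensor g X (pushTensor f X s) :=
  LinearMap.rTensor_comp_apply X (ArtAlg.Hom.toAlgHom g).toLinearMap
    (ArtAlg.Hom.toAlgHom f).toLinearMap s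

theorem baseChange_mem (g : X →ₗ[ℂ] Y) {s : A ⊗[ℂ] X}
    (hs : s ∈ A.m • (⊤ : Submodule A (A ⊗[ℂ] X))) :
    g.baseChange A s ∈ A.m • (⊤ : Submodule A (A ⊗[ℂ] Y)) := by
  have h := Submodule.mem_map_of_mem (f := g.baseChange A) hs
  rw [Submodule.map_smul''] at h
  exact Submodule.smul_mono le_rfl le_top h

end Push

theorem baseChange_bilinExt (A : ArtAlg.{w}) {X Y Z X' Y' Z' : Type u} [AddCommGroup X] [Module ℂ X]
    [AddCommGroup Y] [Module ℂ Y] [AddCommGroup Z] [Module ℂ Z] [AddCommGroup X'] [Module ℂ X']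
    [AddCommGroup Y'] [Module ℂ Y'] [AddCommGroup Z'] [Module ℂ Z'] (p : X →ₗ[ℂ] X')
    (q : Y →ₗ[ℂ] Y') (r : Z →ₗ[ℂ] Z') (g : X →ₗ[ℂ] Y →ₗ[ℂ] Z) (g' : X' →ₗ[ℂ] Y' →ₗ[ℂ] Z')
    (h : ∀ x y, r (g x y) = g' (p x) (q y)) (s : A ⊗[ℂ] X) (t : A ⊗[ℂ] Y) :
    r.baseChange A (bilinExt A g s t) = bilinExt A g' (p.baseChange A s) (q.baseChange A t) := by
  induction s with
  | zero => simp
  | tmul a x =>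
    induction t with
    | zero => simp
    | tmul b y => simp [h]
    | add s t hs ht => simp only [map_add, hs, ht]
  | add s t hs ht => simp only [map_add, LinearMap.add_apply, hs, ht]

namespace DGLA

variable (C : DGLA.{u}) (A : ArtAlg.{w})

/-- The objects of `𝒞(C; A)`: the elements `ω ∈ C^1 ⊗ m` with `dω + ½[ω, ω] = 0`. Here `V ⊗ m` is
the subspace `m • (A ⊗ V)` of `A ⊗ V`. -/
def MC : Type (max u w) :=
  {ω : A ⊗[ℂ] C.gr 1 // ω ∈ A.m • (⊤ : Submodule A (A ⊗[ℂ] C.gr 1)) ∧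
    (C.dRes 1 2 rfl).baseChange A ω + (1 / 2 : ℂ) • bilinExt A (C.br 1 1 2 rfl) ω ω = 0}

/-- The operator `ad λ` on `C^1 ⊗ A`, for `λ ∈ C^0 ⊗ A`. -/
def adOp (l : A ⊗[ℂ] C.gr 0) : Module.End A (A ⊗[ℂ] C.gr 1) :=
  bilinExt A (C.br 0 1 1 rfl) l

/-- The gauge action `exp(ad λ) α + ((1 - exp(ad λ)) / ad λ) (dλ)`. The sums are finite for
`λ ∈ C^0 ⊗ m`. -/
def gauge (l : A ⊗[ℂ] C.gr 0) (α : A ⊗[ℂ] C.gr 1) : A ⊗[ℂ] C.gr 1 :=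
  (∑ᶠ n : ℕ, (1 / (n.factorial : ℂ)) • (C.adOp A l ^ n) α) -
    ∑ᶠ n : ℕ, (1 / ((n + 1).factorial : ℂ)) •
      (C.adOp A l ^ n) ((C.dRes 0 1 rfl).baseChange A l)

/-- `ω₁` and `ω₂` are isomorphic in `𝒞(C; A)`: there is `λ ∈ C^0 ⊗ m` which moves `ω₁` to `ω₂`.
This is the orbit relation of an action of the group `exp(C^0 ⊗ m)`. -/
def GaugeRel (ω₁ ω₂ : C.MC A) : Prop :=
  ∃ l ∈ A.m • (⊤ : Submodule A (A ⊗[ℂ] C.gr 0)), C.gauge A l ω₁.1 = ω₂.1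

variable {C A}

theorem adOp_pow_mem {l : A ⊗[ℂ] C.gr 0} (hl : l ∈ A.m • (⊤ : Submodule A (A ⊗[ℂ] C.gr 0)))
    (n : ℕ) (x : A ⊗[ℂ] C.gr 1) :
    (C.adOp A l ^ n) x ∈ A.m ^ n • (⊤ : Submodule A (A ⊗[ℂ] C.gr 1)) := by
  induction n with
  | zero => simp
  | succ n ih =>
    have key : ∀ y ∈ A.m ^ n • (⊤ : Submodule A (A ⊗[ℂ] C.gr 1)),
        C.adOp A l y ∈ A.m ^ (n + 1) • (⊤ : Submodule A (A ⊗[ℂ] C.gr 1)) := by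
      intro y hy
      unfold adOp
      refine Submodule.smul_induction_on hl (fun a ha l _ => ?_) fun x z hx hz => ?_
      · rw [map_smul, LinearMap.smul_apply, pow_succ', mul_smul]
        refine Submodule.smul_mem_smul ha ?_
        have h := Submodule.mem_map_of_mem (f := bilinExt A (C.br 0 1 1 rfl) l) hy
        rw [Submodule.map_smul''] at h
        exact Submodule.smul_mono le_rfl le_top h
      · rw [map_add, LinearMap.add_apply]
        exact add_mem hx hz
    have h := key _ ih
    rwa [← Module.End.mul_apply, ← pow_succ'] at h

theorem adOp_finite {l : A ⊗[ℂ] C.gr 0} (hl : l ∈ A.m • (⊤ : Submodule A (A ⊗[ℂ] C.gr 0)))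
    (c : ℕ → ℂ) (x : A ⊗[ℂ] C.gr 1) :
    (Function.support fun n : ℕ => c n • (C.adOp A l ^ n) x).Finite := by
  obtain ⟨N, hN⟩ : IsNilpotent A.m := by
    have := IsArtinianRing.isNilpotent_jacobson_bot (R := A)
    rwa [IsLocalRing.jacobson_eq_maximalIdeal _ bot_ne_top] at this
  refine (Set.finite_lt_nat N).subset fun n hn => ?_
  by_contra hlt
  have hle : N ≤ n := not_lt.1 hlt
  apply hn
  have h := adOp_pow_mem hl n x
  have h0 : A.m ^ n = ⊥ := by
    rw [eq_bot_iff, ← Ideal.zero_eq_bot, ← hN]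
    exact Ideal.pow_le_pow_right hle
  rw [h0, Submodule.bot_smul, Submodule.mem_bot] at h
  simp only [h, smul_zero]

/-- Compatibility of the gauge action with maps that respect brackets and differentials. -/
theorem map_gauge {D : DGLA.{u}} {B : ArtAlg.{w}}
    (Ψ₀ : A ⊗[ℂ] C.gr 0 →ₗ[ℂ] B ⊗[ℂ] D.gr 0) (Ψ₁ : A ⊗[ℂ] C.gr 1 →ₗ[ℂ] B ⊗[ℂ] D.gr 1)
    (hbr : ∀ l x, Ψ₁ (C.adOp A l x) = D.adOp B (Ψ₀ l) (Ψ₁ x))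
    (hd : ∀ l, Ψ₁ ((C.dRes 0 1 rfl).baseChange A l) = (D.dRes 0 1 rfl).baseChange B (Ψ₀ l))
    {l : A ⊗[ℂ] C.gr 0} (hl : l ∈ A.m • (⊤ : Submodule A (A ⊗[ℂ] C.gr 0)))
    (α : A ⊗[ℂ] C.gr 1) :
    Ψ₁ (C.gauge A l α) = D.gauge B (Ψ₀ l) (Ψ₁ α) := by
  have hpow : ∀ (n : ℕ) x, Ψ₁ ((C.adOp A l ^ n) x) = (D.adOp B (Ψ₀ l) ^ n) (Ψ₁ x) := by
    intro n
    induction n with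
    | zero => simp
    | succ n ih =>
      intro x
      rw [pow_succ, pow_succ, Module.End.mul_apply, Module.End.mul_apply, ih, hbr]
  have hsum : ∀ (c : ℕ → ℂ) x, Ψ₁ (∑ᶠ n : ℕ, c n • (C.adOp A l ^ n) x) =
      ∑ᶠ n : ℕ, c n • (D.adOp B (Ψ₀ l) ^ n) (Ψ₁ x) := by
    intro c x
    have h := Ψ₁.toAddMonoidHom.map_finsum (adOp_finite hl c x)
    refine h.trans (finsum_congr fun n => ?_)
    change Ψ₁ (c n • (C.adOp A l ^ n) x) = _
    rw [map_smul, hpow]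
  unfold gauge
  rw [map_sub, hsum fun n => 1 / (n.factorial : ℂ), hsum fun n => 1 / ((n + 1).factorial : ℂ), hd]

variable (C) in
/-- The map on objects `𝒞(C; A) → 𝒞(C; B)` induced by `A → B`. -/
def MC.push {A B : ArtAlg.{w}} (f : A ⟶ B) (ω : C.MC A) : C.MC B :=
  ⟨pushTensor f _ ω.1, pushTensor_mem f ω.2.1, by
    rw [← pushTensor_baseChange, ← pushTensor_bilinExt, ← map_smul, ← map_add, ω.2.2, map_zero]⟩

theorem GaugeRel.push {A B : ArtAlg.{w}} (f : A ⟶ B) {ω₁ ω₂ : C.MC A} (h : C.GaugeRel A ω₁ ω₂) :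
    C.GaugeRel B (MC.push C f ω₁) (MC.push C f ω₂) := by
  obtain ⟨l, hl, h⟩ := h
  refine ⟨pushTensor f _ l, pushTensor_mem f hl, ?_⟩
  have := map_gauge (C := C) (D := C) (pushTensor f _) (pushTensor f _)
    (fun l x => pushTensor_bilinExt f _ l x) (fun l => pushTensor_baseChange f _ l) hl ω₁.1
  rw [h] at this
  exact this.symm

variable (C) in
/-- The deformation functor `Def(C)`: it sends `A` to the set of isomorphism classes of
`𝒞(C; A)`. -/
def Def : ArtAlg.{w} ⥤ Type (max u w) where
  obj A := Quot (C.GaugeRel A)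
  map f := ↾(Quot.map (MC.push C f) fun _ _ h => h.push f)
  map_id A := by
    ext x
    induction x using Quot.ind with
    | mk ω => exact congrArg (Quot.mk _) (Subtype.ext (pushTensor_id ω.1))
  map_comp f g := by
    ext x
    induction x using Quot.ind with
    | mk ω => exact congrArg (Quot.mk _) (Subtype.ext (pushTensor_comp f g ω.1))

/-- The map on objects `𝒞(C; A) → 𝒞(D; A)` induced by `g : C → D`. -/
def Hom.mc {C D : DGLA.{u}} (g : Hom C D) (A : ArtAlg.{w}) (ω : C.MC A) : D.MC A :=
  ⟨(g.res 1).baseChange A ω.1, baseChange_mem _ ω.2.1, by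
    have h1 : (D.dRes 1 2 rfl).baseChange A ((g.res 1).baseChange A ω.1) =
        (g.res 2).baseChange A ((C.dRes 1 2 rfl).baseChange A ω.1) := by
      rw [← LinearMap.comp_apply, ← LinearMap.comp_apply, ← LinearMap.baseChange_comp,
        ← LinearMap.baseChange_comp]
      congr 2
      ext x : 1
      exact (g.res_d 1 2 rfl x).symm
    rw [h1, ← baseChange_bilinExt A (g.res 1) (g.res 1) (g.res 2) (C.br 1 1 2 rfl)
      (D.br 1 1 2 rfl) (fun x y => Subtype.ext (g.map_bracket x y)),
      ← LinearMap.map_smul_of_tower, ← map_add, ω.2.2, map_zero]⟩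

theorem GaugeRel.map {C D : DGLA.{u}} (g : Hom C D) {A : ArtAlg.{w}} {ω₁ ω₂ : C.MC A}
    (h : C.GaugeRel A ω₁ ω₂) : D.GaugeRel A (g.mc A ω₁) (g.mc A ω₂) := by
  obtain ⟨l, hl, h⟩ := h
  refine ⟨(g.res 0).baseChange A l, baseChange_mem _ hl, ?_⟩
  have := map_gauge (C := C) (D := D) (((g.res 0).baseChange A).restrictScalars ℂ)
    (((g.res 1).baseChange A).restrictScalars ℂ)
    (fun l x => baseChange_bilinExt A (g.res 0) (g.res 1) (g.res 1) (C.br 0 1 1 rfl)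
      (D.br 0 1 1 rfl)
      (fun x y => Subtype.ext (g.map_bracket x y)) l x)
    (fun l => by
      change (g.res 1).baseChange A ((C.dRes 0 1 rfl).baseChange A l) =
        (D.dRes 0 1 rfl).baseChange A ((g.res 0).baseChange A l)
      rw [← LinearMap.comp_apply, ← LinearMap.comp_apply, ← LinearMap.baseChange_comp,
        ← LinearMap.baseChange_comp]
      congr 2
      ext x : 1
      exact g.res_d 0 1 rfl x) hl ω₁.1
  have h' : ((g.res 1).baseChange A).restrictScalars ℂ (C.gauge A l ω₁.1) =
    (g.res 1).baseChange A ω₂.1 := by rw [h]; rfl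
  rw [h'] at this
  exact this.symm

/-- The natural transformation `g_* : Def(C) → Def(D)` induced by `g : C → D`. -/
def Hom.defMap {C D : DGLA.{u}} (g : Hom C D) : Def.{u, w} C ⟶ Def.{u, w} D where
  app A := ↾(Quot.map (g.mc A) fun _ _ h => h.map g)
  naturality A B f := by
    ext x
    induction x using Quot.ind with
    | mk ω =>
      exact congrArg (Quot.mk _) (Subtype.ext (pushTensor_baseChange f (g.res 1) ω.1).symm)

end DGLA

/-! ### Aomoto complexes and cohomology jump functors -/

namespace DGModule

variable {C : DGLA.{u}} (M : DGModule C)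

/-- The differential `d_ω = d ⊗ id + ω` from `M^i ⊗ A` to `M^j ⊗ A`, where `j = i + 1`. -/
def aomotoD (A : ArtAlg.{w}) (ω : C.MC A) (i j : ℤ) (h : i + 1 = j) :
    A ⊗[ℂ] M.gr i →ₗ[A] A ⊗[ℂ] M.gr j :=
  (M.dRes i j h).baseChange A + bilinExt A (M.ac 1 i j (by omega)) ω.1

theorem aomoto_aux1 (A : ArtAlg.{w}) (i j k : ℤ) (h : i + 1 = j) (h' : j + 1 = k)
    (s : A ⊗[ℂ] C.gr 1) (x : A ⊗[ℂ] M.gr i) :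
    (M.dRes j k h').baseChange A (bilinExt A (M.ac 1 i j (by omega)) s x) +
      bilinExt A (M.ac 1 j k (by omega)) s ((M.dRes i j h).baseChange A x) =
    bilinExt A (M.ac 2 i k (by omega)) ((C.dRes 1 2 rfl).baseChange A s) x := by
  induction s with
  | zero => simp
  | add s t hs ht =>
    simp only [map_add, LinearMap.add_apply, ← hs, ← ht]
    abel
  | tmul a α =>
    induction x with
    | zero => simp
    | add s t hs ht =>
      simp only [map_add, ← hs, ← ht]
      abel
    | tmul b ξ =>
      simp only [bilinExt_tmul, LinearMap.baseChange_tmul, ← TensorProduct.tmul_add]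
      congr 1
      apply Subtype.ext
      change M.d (M.act α ξ) + M.act α (M.d ξ) = M.act (C.d α) ξ
      rw [M.d_act 1 α α.2]
      simp

theorem aomoto_aux2 (A : ArtAlg.{w}) (i j k : ℤ) (h : i + 1 = j) (h' : j + 1 = k)
    (s t : A ⊗[ℂ] C.gr 1) (x : A ⊗[ℂ] M.gr i) :
    bilinExt A (M.ac 1 j k (by omega)) s (bilinExt A (M.ac 1 i j (by omega)) t x) +
      bilinExt A (M.ac 1 j k (by omega)) t (bilinExt A (M.ac 1 i j (by omega)) s x) =
    bilinExt A (M.ac 2 i k (by omega)) (bilinExt A (C.br 1 1 2 rfl) s t) x := by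
  induction s with
  | zero => simp
  | add s t hs ht =>
    simp only [map_add, LinearMap.add_apply, ← hs, ← ht]
    abel
  | tmul a α =>
    induction t with
    | zero => simp
    | add s t hs ht =>
      simp only [map_add, LinearMap.add_apply, ← hs, ← ht]
      abel
    | tmul b β =>
      induction x with
      | zero => simp
      | add s t hs ht =>
        simp only [map_add, ← hs, ← ht]
        abel
      | tmul c ξ =>
        simp only [bilinExt_tmul]
        rw [show b * (a * c) = a * (b * c) by ring, show a * b * c = a * (b * c) by ring,
          ← TensorProduct.tmul_add]
        congr 1
        apply Subtype.ext
        change M.act α (M.act β ξ) + M.act β (M.act α ξ) = M.act (C.bracket α β) ξ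
        rw [M.bracket_act 1 1 α α.2 β β.2]
        simp

theorem aomotoD_aomotoD (A : ArtAlg.{w}) (ω : C.MC A) (i j k : ℤ) (h : i + 1 = j)
    (h' : j + 1 = k) (x : A ⊗[ℂ] M.gr i) :
    M.aomotoD A ω j k h' (M.aomotoD A ω i j h x) = 0 := by
  have h0 : (M.dRes j k h').baseChange A ((M.dRes i j h).baseChange A x) = 0 := by
    rw [← LinearMap.comp_apply, ← LinearMap.baseChange_comp]
    have : (M.dRes j k h').comp (M.dRes i j h) = 0 := by
      ext1 y
      exact M.dRes_dRes i j k h h' y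
    rw [this]
    simp
  have h1 := M.aomoto_aux1 A i j k h h' ω.1 x
  have h2 := M.aomoto_aux2 A i j k h h' ω.1 ω.1 x
  have h3 : bilinExt A (M.ac 2 i k (by omega)) ((C.dRes 1 2 rfl).baseChange A ω.1) x +
      (1 / 2 : ℂ) • bilinExt A (M.ac 2 i k (by omega)) (bilinExt A (C.br 1 1 2 rfl) ω.1 ω.1) x
      = 0 := by
    have := congrArg (fun s => bilinExt A (M.ac 2 i k (by omega)) s x) ω.2.2
    simpa only [map_add, LinearMap.map_smul_of_tower, LinearMap.add_apply, LinearMap.smul_apply,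
      map_zero, LinearMap.zero_apply] using this
  rw [← h1, ← h2, ← two_smul ℂ, smul_smul] at h3
  simp only [aomotoD, LinearMap.add_apply, map_add, h0, zero_add]
  rw [← h3]
  norm_num
  abel

/-- The Aomoto complex `(M ⊗ A, d_ω)`, a complex of `A`-modules. -/
def aomoto (A : ArtAlg.{w}) (ω : C.MC A) : CochainComplex (ModuleCat.{max u w} A) ℤ :=
  mkComplex (fun n => ModuleCat.of A (A ⊗[ℂ] M.gr n))
    (fun i j h => ModuleCat.ofHom (M.aomotoD A ω i j h)) fun i j k h h' => by
      ext1
      exact LinearMap.ext fun x => M.aomotoD_aomotoD A ω i j k h h' x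

end DGModule

namespace DGLAPair

theorem jump_push (P : DGLAPair.{u}) (i : ℤ) (k : ℕ) {A B : ArtAlg.{w}} (f : A ⟶ B)
    (ω : P.C.MC A) (h : IsJumpIdeal (P.M.aomoto A ω) i k ⊥) :
    IsJumpIdeal (P.M.aomoto B (DGLA.MC.push P.C f ω)) i k ⊥ := by
  let : Algebra A B := (ArtAlg.Hom.toAlgHom f).toRingHom.toAlgebra
  have : IsScalarTower ℂ A B := IsScalarTower.of_algebraMap_eq fun z =>
    ((ArtAlg.Hom.toAlgHom f).commutes z).symm
  refine isJumpIdeal_bot_baseChange.{u} A B (P.M.aomoto A ω) ?_ (fun n => ?_) i k h _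
    (HomologicalComplex.Hom.isoOfComponents (fun n =>
      (TensorProduct.AlgebraTensorModule.cancelBaseChange ℂ A B B (P.M.gr n)).toModuleIso) ?_)
  · obtain ⟨N, hN⟩ := P.bounded
    refine ⟨N, fun n hn => ?_⟩
    change Subsingleton (A ⊗[ℂ] P.M.gr n)
    rw [hN n hn]
    infer_instance
  · change Module.Free A (A ⊗[ℂ] P.M.gr n)
    infer_instance
  · intro a b hab
    have hab : a + 1 = b := hab
    have h1 : (P.M.aomoto A ω).d a b = ModuleCat.ofHom (P.M.aomotoD A ω a b hab) := dif_pos hab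
    have h2 : (P.M.aomoto B (DGLA.MC.push P.C f ω)).d a b =
        ModuleCat.ofHom (P.M.aomotoD B (DGLA.MC.push P.C f ω) a b hab) := dif_pos hab
    rw [h2, Functor.mapHomologicalComplex_obj_d, h1]
    ext1
    refine LinearMap.ext fun (x : B ⊗[A] (A ⊗[ℂ] P.M.gr a)) => ?_
    change P.M.aomotoD B (DGLA.MC.push P.C f ω) a b hab
        (TensorProduct.AlgebraTensorModule.cancelBaseChange ℂ A B B (P.M.gr a) x) =
      TensorProduct.AlgebraTensorModule.cancelBaseChange ℂ A B B (P.M.gr b)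
        ((P.M.aomotoD A ω a b hab).baseChange B x)
    induction x with
    | zero => simp
    | add s t hs ht => simp only [map_add, hs, ht]
    | tmul c y =>
      have hc : ∀ (n : ℤ) (z : A ⊗[ℂ] P.M.gr n),
          TensorProduct.AlgebraTensorModule.cancelBaseChange ℂ A B B (P.M.gr n) (c ⊗ₜ z) =
            c • pushTensor f _ z := by
        intro n z
        induction z with
        | zero => simp
        | add s t hs ht => simp only [TensorProduct.tmul_add, map_add, smul_add, hs, ht]
        | tmul a v =>
          rw [TensorProduct.AlgebraTensorModule.cancelBaseChange_tmul, pushTensor_tmul,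
            TensorProduct.smul_tmul', Algebra.smul_def, mul_comm]
          rfl
      rw [LinearMap.baseChange_tmul, hc, hc, map_smul]
      congr 1
      simp only [DGModule.aomotoD, LinearMap.add_apply, map_add]
      rw [pushTensor_baseChange, pushTensor_bilinExt]
      rfl

/-- The cohomology jump functor `Def^i_k(C, M)`, as a subfunctor of `Def(C)`: its value at `A` is
the set of isomorphism classes of objects `ω` of `𝒞(C; A)` with `J^i_k(M ⊗ A, d_ω) = 0`. -/
def defJump (P : DGLAPair.{u}) (i k : ℕ) : Subfunctor (DGLA.Def.{u, w} P.C) where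
  obj A := {x | ∃ ω : P.C.MC A, IsJumpIdeal (P.M.aomoto A ω) i k ⊥ ∧ Quot.mk _ ω = x}
  map f := by
    rintro _ ⟨ω, h, rfl⟩
    exact ⟨DGLA.MC.push P.C f ω, P.jump_push i k f ω h, rfl⟩

end DGLAPair

end

noncomputable section

/-! ### Cohomology of complexes of modules in terms of elements -/

section Cohomology

variable {R : Type w} [CommRing R] {K L : CochainComplex (ModuleCat.{v} R) ℤ}

/-! Deformation functor. Every `A` is built from an algebra with `m = 0` by small extensions, whose
kernel is `ℂ a` with `m a = 0`. Over such an extension everything is linear in the new coefficient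
(`gauge_tmul`, `curv_add_tmul`): obstructions to lifting Maurer-Cartan elements lie in `H²`, lifts
differ by `H¹`, and `H⁰` corrects the gauges. Surjectivity of `Def(C)(A) → Def(D)(A)` follows by
induction from the epimorphism on `H¹` and the monomorphism on `H²` (`TruncDGLA.Hom.exists_conn`).

For injectivity one must lift gauges from `D`, so `g` is replaced by the end point map of its
mapping path object `C ×_D D[t, dt]`, which is surjective in degree `0`. This reduces the claim to
two Maurer-Cartan elements with equal image, and those are joined by gauges in the kernel, again by
induction, using the epimorphism on `H⁰` and the monomorphism on `H¹`
(`TruncDGLA.Hom.conn_of_map_eq`).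

Jump loci. A contraction of `M` onto its cohomology over `ℂ` is perturbed into a minimal model of
`(M ⊗ A, d_ω)`: a subcomplex with terms `A ⊗ Hⁿ(M)` and differential zero modulo `m` (`minEquiv`,
`minD_mem`, `quasiIso_minIncl`). A minimal complex is a deformation retract of every resolution and
has the smallest jump ideal, so that `J^i_k = 0` can be tested on it (`isJumpIdeal_bot_iff`). A
morphism of pairs induces a map of minimal models which modulo `m` is `H(g₂)`. If `g₂` is an
`i`-equivalence, nilpotence of `m` makes this map bijective in degrees `≤ i` and split injective in
degree `i + 1`, and then `d^{i-1} ⊕ d^i` has the same determinantal ideals on both sides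
(`jumpIdealOf_eq`).

Finally `exp λ` is an isomorphism between the Aomoto complexes of gauge equivalent elements
(`nilExp_aomotoD`), so the jump condition depends only on the class. Hence the bijection on `Def`
identifies the two subfunctors, and a zig-zag gives a chain of isomorphisms and inverses. -/

theorem exists_iCycles_eq (n k : ℤ) (hk : n + 1 = k) (x : K.X n) (hx : (K.d n k).hom x = 0) :
    ∃ z : K.cycles n, (K.iCycles n).hom z = x := by
  obtain rfl : (ComplexShape.up ℤ).next n = k := ComplexShape.next_eq' _ hk
  refine ⟨(K.sc n).moduleCatCyclesIso.inv.hom ⟨x, hx⟩, ?_⟩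
  have h := congrArg (fun f => f.hom ⟨x, hx⟩) ((K.sc n).moduleCatCyclesIso_inv_iCycles)
  exact h

theorem d_iCycles_apply (n k : ℤ) (z : K.cycles n) : (K.d n k).hom ((K.iCycles n).hom z) = 0 := by
  have h := congrArg (fun f => f.hom z) (K.iCycles_d n k)
  exact h

theorem homologyπ_eq_zero_iff (i n : ℤ) (hi : i + 1 = n) (z : K.cycles n) :
    (K.homologyπ n).hom z = 0 ↔ ∃ y : K.X i, (K.d i n).hom y = (K.iCycles n).hom z := by
  obtain rfl : (ComplexShape.up ℤ).prev n = i := ComplexShape.prev_eq' _ hi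
  have h := congrArg (fun f => f.hom z) ((K.sc n).homology_π_ι)
  have h' : ((K.sc n).homologyι).hom (((K.sc n).homologyπ).hom z) =
    ((K.sc n).pOpcycles).hom (((K.sc n).iCycles).hom z) := h
  have hinj : Function.Injective ((K.sc n).homologyι).hom :=
    (ModuleCat.mono_iff_injective _).1 inferInstance
  have h1 : ((K.sc n).homologyπ).hom z = 0 ↔
      ((K.sc n).pOpcycles).hom (((K.sc n).iCycles).hom z) = 0 := by
    rw [← h', map_eq_zero_iff _ hinj]
  exact h1.trans ((K.sc n).moduleCat_pOpcycles_eq_zero_iff _)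

theorem homologyMap_homologyπ (f : K ⟶ L) (n : ℤ) (z : K.cycles n) :
    (HomologicalComplex.homologyMap f n).hom ((K.homologyπ n).hom z) =
      (L.homologyπ n).hom ((HomologicalComplex.cyclesMap f n).hom z) :=
  congrArg (fun f => f.hom z) (HomologicalComplex.homologyπ_naturality f n)

theorem iCycles_cyclesMap (f : K ⟶ L) (n : ℤ) (z : K.cycles n) :
    (L.iCycles n).hom ((HomologicalComplex.cyclesMap f n).hom z) =
      (f.f n).hom ((K.iCycles n).hom z) :=
  congrArg (fun f => f.hom z) (HomologicalComplex.cyclesMap_i f n)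

theorem homologyπ_surjective (n : ℤ) : Function.Surjective (K.homologyπ n).hom :=
  (ModuleCat.epi_iff_surjective _).1 inferInstance

/-- Turns categorical homology into diagram chases. The neighbouring degrees are variables with
equations, which avoids casts between `n - 1 + 1` and `n`. -/
theorem mono_homologyMap_iff (f : K ⟶ L) (i n k : ℤ) (hi : i + 1 = n) (hk : n + 1 = k) :
    Mono (HomologicalComplex.homologyMap f n) ↔
      ∀ x : K.X n, (K.d n k).hom x = 0 → ∀ y : L.X i, (f.f n).hom x = (L.d i n).hom y →
        ∃ z : K.X i, x = (K.d i n).hom z := by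
  rw [ModuleCat.mono_iff_injective]
  constructor
  · intro h x hx y hy
    obtain ⟨z, rfl⟩ := exists_iCycles_eq n k hk x hx
    have h1 : (K.homologyπ n).hom z = 0 := by
      apply h
      rw [map_zero]
      refine (homologyMap_homologyπ f n z).trans ?_
      rw [homologyπ_eq_zero_iff i n hi, iCycles_cyclesMap]
      exact ⟨y, hy.symm⟩
    obtain ⟨w, hw⟩ := (homologyπ_eq_zero_iff i n hi z).1 h1
    exact ⟨w, hw.symm⟩
  · intro h
    rw [injective_iff_map_eq_zero]
    intro a ha
    obtain ⟨z, rfl⟩ := homologyπ_surjective n a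
    rw [homologyπ_eq_zero_iff i n hi]
    have h2 := (homologyMap_homologyπ f n z).symm.trans ha
    rw [homologyπ_eq_zero_iff i n hi, iCycles_cyclesMap] at h2
    obtain ⟨y, hy⟩ := h2
    obtain ⟨w, hw⟩ := h _ (d_iCycles_apply n k z) y hy.symm
    exact ⟨w, hw.symm⟩

theorem epi_homologyMap_iff (f : K ⟶ L) (i n k : ℤ) (hi : i + 1 = n) (hk : n + 1 = k) :
    Epi (HomologicalComplex.homologyMap f n) ↔
      ∀ y : L.X n, (L.d n k).hom y = 0 →
        ∃ x : K.X n, (K.d n k).hom x = 0 ∧ ∃ z : L.X i, y = (f.f n).hom x + (L.d i n).hom z := by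
  rw [ModuleCat.epi_iff_surjective]
  constructor
  · intro h y hy
    obtain ⟨z, rfl⟩ := exists_iCycles_eq n k hk y hy
    obtain ⟨a, ha⟩ := h ((L.homologyπ n).hom z)
    obtain ⟨w, rfl⟩ := homologyπ_surjective n a
    have h2 := (homologyMap_homologyπ f n w).symm.trans ha
    rw [← sub_eq_zero, ← map_sub, homologyπ_eq_zero_iff i n hi] at h2
    obtain ⟨t, ht⟩ := h2
    refine ⟨_, d_iCycles_apply n k w, -t, ?_⟩
    rw [map_neg, ht, map_sub, iCycles_cyclesMap]
    abel
  · intro h b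
    obtain ⟨z, rfl⟩ := homologyπ_surjective n b
    obtain ⟨x, hx, t, ht⟩ := h _ (d_iCycles_apply n k z)
    obtain ⟨w, rfl⟩ := exists_iCycles_eq n k hk x hx
    refine ⟨(K.homologyπ n).hom w, (homologyMap_homologyπ f n w).trans ?_⟩
    rw [← sub_eq_zero, ← map_sub, homologyπ_eq_zero_iff i n hi]
    refine ⟨-t, ?_⟩
    rw [map_neg, map_sub, ht, iCycles_cyclesMap]
    abel

theorem quasiIso_of_elements (f : K ⟶ L)
    (h₁ : ∀ i n k : ℤ, i + 1 = n → n + 1 = k → ∀ x : K.X n, (K.d n k).hom x = 0 →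
      ∀ y : L.X i, (f.f n).hom x = (L.d i n).hom y → ∃ z : K.X i, x = (K.d i n).hom z)
    (h₂ : ∀ i n k : ℤ, i + 1 = n → n + 1 = k → ∀ y : L.X n, (L.d n k).hom y = 0 →
      ∃ x : K.X n, (K.d n k).hom x = 0 ∧ ∃ z : L.X i, y = (f.f n).hom x + (L.d i n).hom z) :
    QuasiIso f := by
  rw [quasiIso_iff]
  intro n
  rw [quasiIsoAt_iff_isIso_homologyMap]
  have := (mono_homologyMap_iff f (n - 1) n (n + 1) (by omega) rfl).2 (h₁ _ _ _ (by omega) rfl)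
  have := (epi_homologyMap_iff f (n - 1) n (n + 1) (by omega) rfl).2 (h₂ _ _ _ (by omega) rfl)
  exact isIso_of_mono_of_epi _

end Cohomology

namespace GradedCx

variable {V W : GradedCx.{u}}

theorem cx_d (V : GradedCx.{u}) (i j : ℤ) (h : i + 1 = j) :
    V.cx.d i j = ModuleCat.ofHom (V.dRes i j h) := dif_pos h

theorem Hom.exact_of_mono (f : Hom V W) (i n k : ℤ) (hi : i + 1 = n) (hk : n + 1 = k)
    (h : Mono (HomologicalComplex.homologyMap f.cx n)) (x : V.gr n) (hx : V.dRes n k hk x = 0)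
    (y : W.gr i) (hy : f.res n x = W.dRes i n hi y) : ∃ z : V.gr i, x = V.dRes i n hi z := by
  have h1 := (mono_homologyMap_iff f.cx i n k hi hk).1 h
  rw [cx_d V n k hk, cx_d V i n hi, cx_d W i n hi] at h1
  exact h1 x hx y hy

theorem Hom.lift_of_epi (f : Hom V W) (i n k : ℤ) (hi : i + 1 = n) (hk : n + 1 = k)
    (h : Epi (HomologicalComplex.homologyMap f.cx n)) (y : W.gr n) (hy : W.dRes n k hk y = 0) :
    ∃ x : V.gr n, V.dRes n k hk x = 0 ∧ ∃ z : W.gr i, y = f.res n x + W.dRes i n hi z := by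
  have h1 := (epi_homologyMap_iff f.cx i n k hi hk).1 h
  rw [cx_d V n k hk, cx_d W n k hk, cx_d W i n hi] at h1
  exact h1 y hy

end GradedCx

/-! ### Artinian local algebras -/

namespace ArtAlg

variable (A : ArtAlg.{w})

instance : Module.Finite ℂ A := (Module.finite_iff_isArtinianRing ℂ A).2 inferInstance

theorem isNilpotent_m : IsNilpotent A.m := by
  have := IsArtinianRing.isNilpotent_jacobson_bot (R := A)
  rwa [IsLocalRing.jacobson_eq_maximalIdeal _ bot_ne_top] at this

/-- The residue field is a finite extension of `ℂ`, which is algebraically closed. -/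
theorem algebraMap_residue_bijective :
    Function.Bijective (algebraMap ℂ (IsLocalRing.ResidueField A)) := by
  have : Module.Finite ℂ (IsLocalRing.ResidueField A) :=
    Module.Finite.of_surjective (IsScalarTower.toAlgHom ℂ A (IsLocalRing.ResidueField A)).toLinearMap
      IsLocalRing.residue_surjective
  exact IsAlgClosed.algebraMap_bijective_of_isIntegral

/-- The augmentation `A → A/m = ℂ`. -/
def aug : A →ₐ[ℂ] ℂ :=
  ((AlgEquiv.ofBijective (Algebra.ofId ℂ (IsLocalRing.ResidueField A))
    A.algebraMap_residue_bijective).symm : IsLocalRing.ResidueField A →ₐ[ℂ] ℂ).comp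
    (IsScalarTower.toAlgHom ℂ A (IsLocalRing.ResidueField A))

variable {A}

theorem aug_eq_zero_iff {a : A} : A.aug a = 0 ↔ a ∈ A.m := by
  simp only [aug, AlgHom.comp_apply]
  rw [← IsLocalRing.residue_eq_zero_iff]
  refine map_eq_zero_iff _ ?_
  exact AlgEquiv.injective _

theorem sub_aug_mem (a : A) : a - algebraMap ℂ A (A.aug a) ∈ A.m := by
  rw [← aug_eq_zero_iff, map_sub, AlgHom.commutes]
  simp

/-- The quotient of an Artinian local algebra by a proper ideal. -/
def quot (A : ArtAlg.{w}) (I : Ideal A) (hI : I ≠ ⊤) : ArtAlg.{w} :=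
  have : Nontrivial (A ⧸ I) := Ideal.Quotient.nontrivial_iff.2 hI
  have : IsLocalRing (A ⧸ I) := IsLocalRing.of_surjective' (Ideal.Quotient.mk I)
    Ideal.Quotient.mk_surjective
  have : Algebra.FiniteType ℂ (A ⧸ I) :=
    Algebra.FiniteType.of_surjective (Ideal.Quotient.mkₐ ℂ I) (Ideal.Quotient.mkₐ_surjective ℂ I)
  { carrier := A ⧸ I }

/-- The projection to the quotient by a proper ideal. -/
def toQuot (A : ArtAlg.{w}) (I : Ideal A) (hI : I ≠ ⊤) : A ⟶ A.quot I hI where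
  toAlgHom := Ideal.Quotient.mkₐ ℂ I
  isLocal := by
    have : Nontrivial (A ⧸ I) := Ideal.Quotient.nontrivial_iff.2 hI
    exact IsLocalHom.of_surjective (Ideal.Quotient.mk I) Ideal.Quotient.mk_surjective

theorem aug_hom {A B : ArtAlg.{w}} (f : A ⟶ B) (a : A) : B.aug (f.toAlgHom a) = A.aug a := by
  have h : f.toAlgHom (a - algebraMap ℂ A (A.aug a)) ∈ B.m := by
    have ha := sub_aug_mem a
    rw [IsLocalRing.mem_maximalIdeal] at ha ⊢
    exact fun h => ha (f.isLocal.1 _ h)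
  rw [← aug_eq_zero_iff, map_sub, map_sub, AlgHom.commutes, AlgHom.commutes, sub_eq_zero] at h
  exact h

/-- `f : A → B` is a small extension, whose kernel is spanned over `ℂ` by an element `a ≠ 0` of the
maximal ideal that is annihilated by the maximal ideal. -/
structure IsSmallExtension {A B : ArtAlg.{w}} (f : A ⟶ B) (a : A) : Prop where
  surjective : Function.Surjective f.toAlgHom
  mem : a ∈ A.m
  ne_zero : a ≠ 0
  mul_eq_zero : ∀ x ∈ A.m, x * a = 0
  map_eq_zero_iff : ∀ x, f.toAlgHom x = 0 ↔ ∃ c : ℂ, c • a = x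

/-- Take `a ≠ 0` in the last nonzero power of `m`. Then `m a = 0`, and since `A = ℂ + m` the ideal
`(a)` is the line `ℂ a`. -/
theorem exists_isSmallExtension (A : ArtAlg.{w}) (h : A.m ≠ ⊥) :
    ∃ (B : ArtAlg.{w}) (f : A ⟶ B) (a : A), IsSmallExtension f a := by
  obtain ⟨n, hn, hn'⟩ : ∃ n, A.m ^ n ≠ ⊥ ∧ A.m ^ (n + 1) = ⊥ := by
    by_contra! hc
    obtain ⟨N, hN⟩ := A.isNilpotent_m
    have : ∀ n, A.m ^ n ≠ ⊥ := by
      intro n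
      induction n with
      | zero => simp
      | succ n ih => exact hc n ih
    exact this N hN
  obtain ⟨a, ha, ha0⟩ := Submodule.exists_mem_ne_zero_of_ne_bot hn
  have hn0 : n ≠ 0 := by
    rintro rfl
    exact h (by simpa using hn')
  have ham : a ∈ A.m := Ideal.pow_le_self hn0 ha
  have hmul : ∀ x ∈ A.m, x * a = 0 := fun x hx => by
    have : x * a ∈ A.m ^ (n + 1) := by
      rw [pow_succ']
      exact Ideal.mul_mem_mul hx ha
    rwa [hn'] at this
  have hI : Ideal.span {a} ≠ ⊤ := fun h => by
    rw [Ideal.span_singleton_eq_top] at h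
    exact (IsLocalRing.mem_maximalIdeal a).1 ham h
  refine ⟨A.quot _ hI, A.toQuot _ hI, a, Ideal.Quotient.mk_surjective, ham, ha0, hmul,
    fun x => ?_⟩
  change Ideal.Quotient.mk (Ideal.span {a}) x = 0 ↔ _
  rw [Ideal.Quotient.eq_zero_iff_mem, Ideal.mem_span_singleton']
  constructor
  · rintro ⟨y, rfl⟩
    refine ⟨A.aug y, ?_⟩
    have := hmul _ (sub_aug_mem y)
    rw [sub_mul, sub_eq_zero] at this
    rw [this, Algebra.smul_def]
  · rintro ⟨c, rfl⟩
    exact ⟨algebraMap ℂ A c, (Algebra.smul_def c a).symm⟩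

/-- The induction is on `dim A`, which drops because the kernel of `A → B` contains `a ≠ 0`. -/
theorem induction_smallExtension {motive : ArtAlg.{w} → Prop} (A : ArtAlg.{w})
    (base : ∀ A : ArtAlg.{w}, A.m = ⊥ → motive A)
    (step : ∀ (A B : ArtAlg.{w}) (f : A ⟶ B) (a : A), IsSmallExtension f a → motive B → motive A) :
    motive A := by
  induction hr : Module.finrank ℂ A using Nat.strong_induction_on generalizing A with
  | _ r ih =>
    by_cases h : A.m = ⊥
    · exact base A h
    · obtain ⟨B, f, a, hf⟩ := A.exists_isSmallExtension h
      refine step A B f a hf (ih _ ?_ B rfl)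
      rw [← hr, ← LinearMap.finrank_range_add_finrank_ker f.toAlgHom.toLinearMap,
        LinearMap.range_eq_top.2 hf.surjective, finrank_top]
      have : Nontrivial (LinearMap.ker f.toAlgHom.toLinearMap) := by
        rw [Submodule.nontrivial_iff_ne_bot]
        intro hb
        have : a ∈ LinearMap.ker f.toAlgHom.toLinearMap := (hf.map_eq_zero_iff a).2 ⟨1, one_smul _ _⟩
        rw [hb] at this
        exact hf.ne_zero this
      have := Module.finrank_pos (R := ℂ) (M := LinearMap.ker f.toAlgHom.toLinearMap)
      omega

end ArtAlg

/-! ### The tensor product of a vector space with an Artinian local algebra -/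

section Tensor

variable {A B : ArtAlg.{w}} {X Y Z : Type u} [AddCommGroup X] [Module ℂ X] [AddCommGroup Y]
  [Module ℂ Y] [AddCommGroup Z] [Module ℂ Z]

/-! ### Characters of the coefficient ring: reduction modulo `m` and evaluation of polynomials. -/

section Evaluation

variable {R : Type*} [CommRing R] [Algebra ℂ R] (φ : R →ₐ[ℂ] ℂ)

variable (X) in
/-- The map `R ⊗ X → X` induced by a character `φ` of `R`. -/
def evalTensor : R ⊗[ℂ] X →ₗ[ℂ] X :=
  (TensorProduct.lid ℂ X).toLinearMap ∘ₗ LinearMap.rTensor X φ.toLinearMap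

@[simp] theorem evalTensor_tmul (a : R) (x : X) : evalTensor X φ (a ⊗ₜ x) = φ a • x := by
  simp [evalTensor]

theorem evalTensor_smul (a : R) (s : R ⊗[ℂ] X) :
    evalTensor X φ (a • s) = φ a • evalTensor X φ s := by
  induction s with
  | zero => simp
  | tmul b x => simp [TensorProduct.smul_tmul', mul_smul]
  | add s t hs ht => simp only [map_add, smul_add, hs, ht]

theorem evalTensor_baseChange (g : X →ₗ[ℂ] Y) (s : R ⊗[ℂ] X) :
    evalTensor Y φ (g.baseChange R s) = g (evalTensor X φ s) := by
  induction s with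
  | zero => simp
  | tmul a x => simp
  | add s t hs ht => simp only [map_add, hs, ht]

theorem evalTensor_bilinExt (g : X →ₗ[ℂ] Y →ₗ[ℂ] Z) (s : R ⊗[ℂ] X) (t : R ⊗[ℂ] Y) :
    evalTensor Z φ (bilinExt R g s t) = g (evalTensor X φ s) (evalTensor Y φ t) := by
  induction s with
  | zero => simp
  | tmul a x =>
    induction t with
    | zero => simp
    | tmul b y => simp [mul_smul, smul_comm (φ a)]
    | add s t hs ht => simp only [map_add, hs, ht]
  | add s t hs ht => simp only [map_add, LinearMap.add_apply, hs, ht]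

end Evaluation

/-! ### Extension of scalars for bilinear identities. -/

section Identities

variable {R : Type*} [CommRing R] [Algebra ℂ R] {V V' V'' W : Type u} [AddCommGroup V]
  [Module ℂ V] [AddCommGroup V'] [Module ℂ V'] [AddCommGroup V''] [Module ℂ V'']
  [AddCommGroup W] [Module ℂ W]

theorem bilinExt_symm (c : ℂ) (b : X →ₗ[ℂ] Y →ₗ[ℂ] Z) (b' : Y →ₗ[ℂ] X →ₗ[ℂ] Z)
    (h : ∀ x y, b x y = c • b' y x) (x : R ⊗[ℂ] X) (y : R ⊗[ℂ] Y) :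
    bilinExt R b x y = c • bilinExt R b' y x := by
  induction x with
  | zero => simp
  | add s t hs ht => simp only [map_add, LinearMap.add_apply, hs, ht, smul_add]
  | tmul a x =>
    induction y with
    | zero => simp
    | add s t hs ht => simp only [map_add, LinearMap.add_apply, hs, ht, smul_add]
    | tmul e y => rw [bilinExt_tmul, bilinExt_tmul, h, mul_comm, TensorProduct.tmul_smul]

theorem bilinExt_leibniz (d : Z →ₗ[ℂ] W) (b : X →ₗ[ℂ] Y →ₗ[ℂ] Z) (d₁ : X →ₗ[ℂ] V)
    (b₁ : V →ₗ[ℂ] Y →ₗ[ℂ] W) (d₂ : Y →ₗ[ℂ] V') (b₂ : X →ₗ[ℂ] V' →ₗ[ℂ] W)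
    (h : ∀ x y, d (b x y) = b₁ (d₁ x) y + b₂ x (d₂ y)) (x : R ⊗[ℂ] X) (y : R ⊗[ℂ] Y) :
    d.baseChange R (bilinExt R b x y) =
      bilinExt R b₁ (d₁.baseChange R x) y + bilinExt R b₂ x (d₂.baseChange R y) := by
  induction x with
  | zero => simp
  | add s t hs ht =>
    simp only [map_add, LinearMap.add_apply, hs, ht]
    abel
  | tmul a x =>
    induction y with
    | zero => simp
    | add s t hs ht =>
      simp only [map_add, hs, ht]
      abel
    | tmul e y => simp only [bilinExt_tmul, LinearMap.baseChange_tmul, h, TensorProduct.tmul_add]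

/-- The six maps are independent, so that one induction serves the Jacobi identity in various
degrees, polynomial paths, and the module law. -/
theorem bilinExt_jacobi (b₁ : Y →ₗ[ℂ] Z →ₗ[ℂ] V) (b₂ : X →ₗ[ℂ] V →ₗ[ℂ] W)
    (b₃ : X →ₗ[ℂ] Y →ₗ[ℂ] V') (b₄ : V' →ₗ[ℂ] Z →ₗ[ℂ] W) (b₅ : X →ₗ[ℂ] Z →ₗ[ℂ] V'')
    (b₆ : Y →ₗ[ℂ] V'' →ₗ[ℂ] W) (h : ∀ x y z, b₂ x (b₁ y z) = b₄ (b₃ x y) z + b₆ y (b₅ x z))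
    (x : R ⊗[ℂ] X) (y : R ⊗[ℂ] Y) (z : R ⊗[ℂ] Z) :
    bilinExt R b₂ x (bilinExt R b₁ y z) =
      bilinExt R b₄ (bilinExt R b₃ x y) z + bilinExt R b₆ y (bilinExt R b₅ x z) := by
  induction x with
  | zero => simp
  | add s t hs ht =>
    simp only [map_add, LinearMap.add_apply, hs, ht]
    abel
  | tmul a x =>
    induction y with
    | zero => simp
    | add s t hs ht =>
      simp only [map_add, LinearMap.add_apply, hs, ht]
      abel
    | tmul b y =>
      induction z with
      | zero => simp
      | add s t hs ht =>
        simp only [map_add, hs, ht]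
        abel
      | tmul c z =>
        simp only [bilinExt_tmul]
        rw [show a * (b * c) = a * b * c by ring, show b * (a * c) = a * b * c by ring,
          ← TensorProduct.tmul_add, h]

theorem baseChange_comp_apply_eq_zero {f : X →ₗ[ℂ] Y} {g : Y →ₗ[ℂ] Z} (h : ∀ x, g (f x) = 0)
    (x : R ⊗[ℂ] X) : g.baseChange R (f.baseChange R x) = 0 := by
  rw [← LinearMap.comp_apply, ← LinearMap.baseChange_comp]
  have : g ∘ₗ f = 0 := LinearMap.ext h
  rw [this]
  simp

end Identities

variable (A X) in
/-- The reduction `A ⊗ X → X` modulo the maximal ideal. -/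
abbrev redm : A ⊗[ℂ] X →ₗ[ℂ] X := evalTensor X A.aug

theorem sub_redm_mem (s : A ⊗[ℂ] X) :
    s - 1 ⊗ₜ redm A X s ∈ A.m • (⊤ : Submodule A (A ⊗[ℂ] X)) := by
  induction s with
  | zero => simp
  | tmul a x =>
    have h : a ⊗ₜ[ℂ] x - 1 ⊗ₜ redm A X (a ⊗ₜ x) =
        (a - algebraMap ℂ A (A.aug a)) • (1 ⊗ₜ[ℂ] x : A ⊗[ℂ] X) := by
      rw [evalTensor_tmul, ← TensorProduct.smul_tmul, TensorProduct.smul_tmul', Algebra.smul_def,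
        mul_one, smul_eq_mul, mul_one, TensorProduct.sub_tmul]
    rw [h]
    exact Submodule.smul_mem_smul (ArtAlg.sub_aug_mem a) trivial
  | add s t hs ht =>
    convert add_mem hs ht using 1
    rw [map_add, TensorProduct.tmul_add]
    abel

theorem redm_eq_zero_iff {s : A ⊗[ℂ] X} :
    redm A X s = 0 ↔ s ∈ A.m • (⊤ : Submodule A (A ⊗[ℂ] X)) := by
  constructor
  · intro h
    have := sub_redm_mem s
    rwa [h, TensorProduct.tmul_zero, sub_zero] at this
  · intro h
    refine Submodule.smul_induction_on h (fun a ha t _ => ?_) fun x y hx hy => ?_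
    · rw [evalTensor_smul, ArtAlg.aug_eq_zero_iff.2 ha, zero_smul]
    · rw [map_add, hx, hy, add_zero]

theorem redm_pushTensor (f : A ⟶ B) (s : A ⊗[ℂ] X) :
    redm B X (pushTensor f X s) = redm A X s := by
  induction s with
  | zero => simp
  | tmul a x => simp [ArtAlg.aug_hom]
  | add s t hs ht => simp only [map_add, hs, ht]

/-- Any lift will do: pushing forward does not change the reduction modulo the maximal ideal, so a
lift of an element with zero reduction has zero reduction. -/
theorem exists_pushTensor_eq {f : A ⟶ B} (hf : Function.Surjective (ArtAlg.Hom.toAlgHom f))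
    {t : B ⊗[ℂ] X} (ht : t ∈ B.m • (⊤ : Submodule B (B ⊗[ℂ] X))) :
    ∃ s ∈ A.m • (⊤ : Submodule A (A ⊗[ℂ] X)), pushTensor f X s = t := by
  obtain ⟨s, rfl⟩ := LinearMap.rTensor_surjective X
    (g := (ArtAlg.Hom.toAlgHom f).toLinearMap) hf t
  refine ⟨s, ?_, rfl⟩
  rw [← redm_eq_zero_iff, ← redm_pushTensor f, redm_eq_zero_iff]
  exact ht

theorem exists_baseChange_eq {g : X →ₗ[ℂ] Y} (hg : Function.Surjective g)
    {t : A ⊗[ℂ] Y} (ht : t ∈ A.m • (⊤ : Submodule A (A ⊗[ℂ] Y))) :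
    ∃ s ∈ A.m • (⊤ : Submodule A (A ⊗[ℂ] X)), g.baseChange A s = t := by
  obtain ⟨q, hq⟩ := LinearMap.exists_rightInverse_of_surjective g (LinearMap.range_eq_top.2 hg)
  refine ⟨q.baseChange A t, baseChange_mem q ht, ?_⟩
  rw [← LinearMap.comp_apply, ← LinearMap.baseChange_comp, hq, LinearMap.baseChange_id,
    LinearMap.id_apply]

/-! ### Calculus with the elements `a ⊗ x` of a small extension. -/

namespace ArtAlg.IsSmallExtension

variable {f : A ⟶ B} {a : A}

/-- Right exactness of the tensor product, applied to `ℂ → A → B` with `1 ↦ a`. -/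
theorem exists_tmul (hf : IsSmallExtension f a) {s : A ⊗[ℂ] X} (hs : pushTensor f X s = 0) :
    ∃ x : X, s = a ⊗ₜ x := by
  have hex : Function.Exact (LinearMap.toSpanSingleton ℂ A a) (ArtAlg.Hom.toAlgHom f).toLinearMap :=
    hf.map_eq_zero_iff
  obtain ⟨t, rfl⟩ := (rTensor_exact X hex hf.surjective s).1 hs
  refine ⟨TensorProduct.lid ℂ X t, ?_⟩
  clear hs
  induction t with
  | zero => simp
  | tmul c x => simp [TensorProduct.smul_tmul]
  | add s t h₁ h₂ => rw [map_add, map_add, TensorProduct.tmul_add, h₁, h₂]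

theorem exists_add_tmul (hf : IsSmallExtension f a) {s t : A ⊗[ℂ] X}
    (h : pushTensor f X s = pushTensor f X t) : ∃ x : X, s = t + a ⊗ₜ x := by
  obtain ⟨x, hx⟩ := hf.exists_tmul (s := s - t) (by rw [map_sub, h, sub_self])
  exact ⟨x, by rw [← hx]; abel⟩

theorem eq_zero_of_tmul (hf : IsSmallExtension f a) {x : X} (hx : (a ⊗ₜ x : A ⊗[ℂ] X) = 0) :
    x = 0 := by
  obtain ⟨φ, hφ⟩ : ∃ φ : Module.Dual ℂ A, φ a = 1 := Module.Projective.exists_dual_eq_one ℂ hf.ne_zero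
  have h := congrArg (fun s => TensorProduct.lid ℂ X (LinearMap.rTensor X φ s)) hx
  simpa [hφ] using h

theorem pushTensor_tmul_eq_zero (hf : IsSmallExtension f a) (x : X) :
    pushTensor f X (a ⊗ₜ x) = 0 := by
  rw [pushTensor_tmul, (hf.map_eq_zero_iff a).2 ⟨1, one_smul _ _⟩, TensorProduct.zero_tmul]

theorem tmul_mem (hf : IsSmallExtension f a) (x : X) :
    (a ⊗ₜ x : A ⊗[ℂ] X) ∈ A.m • (⊤ : Submodule A (A ⊗[ℂ] X)) := by
  rw [← redm_eq_zero_iff, evalTensor_tmul, ArtAlg.aug_eq_zero_iff.2 hf.mem, zero_smul]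

theorem smul_eq_zero (hf : IsSmallExtension f a) {s : A ⊗[ℂ] X}
    (hs : s ∈ A.m • (⊤ : Submodule A (A ⊗[ℂ] X))) : a • s = 0 := by
  refine Submodule.smul_induction_on hs (fun b hb t _ => ?_) fun x y hx hy => ?_
  · rw [smul_smul, mul_comm, hf.mul_eq_zero b hb, zero_smul]
  · rw [smul_add, hx, hy, add_zero]

theorem tmul_eq_smul (x : X) : (a ⊗ₜ x : A ⊗[ℂ] X) = a • (1 ⊗ₜ x) := by
  rw [TensorProduct.smul_tmul', smul_eq_mul, mul_one]

theorem bilinExt_tmul_right (hf : IsSmallExtension f a) (g : X →ₗ[ℂ] Y →ₗ[ℂ] Z) {s : A ⊗[ℂ] X}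
    (hs : s ∈ A.m • (⊤ : Submodule A (A ⊗[ℂ] X))) (y : Y) : bilinExt A g s (a ⊗ₜ y) = 0 := by
  rw [tmul_eq_smul, map_smul, ← LinearMap.smul_apply, ← map_smul, hf.smul_eq_zero hs, map_zero,
    LinearMap.zero_apply]

theorem bilinExt_tmul_left (hf : IsSmallExtension f a) (g : X →ₗ[ℂ] Y →ₗ[ℂ] Z) {t : A ⊗[ℂ] Y}
    (ht : t ∈ A.m • (⊤ : Submodule A (A ⊗[ℂ] Y))) (x : X) : bilinExt A g (a ⊗ₜ x) t = 0 := by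
  rw [tmul_eq_smul, map_smul, LinearMap.smul_apply, ← map_smul, hf.smul_eq_zero ht, map_zero]

end ArtAlg.IsSmallExtension

theorem mem_smul_top_of_bilinExt {n : ℕ} (g : X →ₗ[ℂ] Y →ₗ[ℂ] Z) {s : A ⊗[ℂ] X}
    (hs : s ∈ A.m • (⊤ : Submodule A (A ⊗[ℂ] X))) {t : A ⊗[ℂ] Y}
    (ht : t ∈ A.m ^ n • (⊤ : Submodule A (A ⊗[ℂ] Y))) :
    bilinExt A g s t ∈ A.m ^ (n + 1) • (⊤ : Submodule A (A ⊗[ℂ] Z)) := by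
  refine Submodule.smul_induction_on hs (fun a ha l _ => ?_) fun x z hx hz => ?_
  · rw [map_smul, LinearMap.smul_apply, pow_succ', mul_smul]
    refine Submodule.smul_mem_smul ha ?_
    have h := Submodule.mem_map_of_mem (f := bilinExt A g l) ht
    rw [Submodule.map_smul''] at h
    exact Submodule.smul_mono le_rfl le_top h
  · rw [map_add, LinearMap.add_apply]
    exact add_mem hx hz

/-- Each application raises the `m`-adic filtration by one, and `m` is nilpotent. No finiteness of
`V` is needed, which matters as the terms of `C` and `M` may be infinite dimensional. -/
theorem isNilpotent_of_mem_smul_top {V : Type*} [AddCommGroup V] [Module A V]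
    (T : Module.End A V) (hT : ∀ n : ℕ, ∀ x ∈ A.m ^ n • (⊤ : Submodule A V),
      T x ∈ A.m ^ (n + 1) • (⊤ : Submodule A V)) : IsNilpotent T := by
  obtain ⟨N, hN⟩ := A.isNilpotent_m
  refine ⟨N, LinearMap.ext fun x => ?_⟩
  have h : ∀ n : ℕ, (T ^ n) x ∈ A.m ^ n • (⊤ : Submodule A V) := by
    intro n
    induction n with
    | zero => simp
    | succ n ih =>
      rw [pow_succ' T, Module.End.mul_apply]
      exact hT n _ ih
  have := h N
  rwa [hN, Ideal.zero_eq_bot, Submodule.bot_smul, Submodule.mem_bot] at this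

theorem isNilpotent_bilinExt (g : X →ₗ[ℂ] Y →ₗ[ℂ] Y) {s : A ⊗[ℂ] X}
    (hs : s ∈ A.m • (⊤ : Submodule A (A ⊗[ℂ] X))) : IsNilpotent (bilinExt A g s) :=
  isNilpotent_of_mem_smul_top _ fun _ _ hx => mem_smul_top_of_bilinExt g hs hx

end Tensor

/-! ### Exponentials of nilpotent operators -/

section Exponential

/-- The exponential of a nilpotent element of a `ℂ`-algebra. -/
def nilExp {E : Type*} [Ring E] [Algebra ℂ E] (a : E) : E :=
  letI : Module ℚ E := Module.compHom E (algebraMap ℚ ℂ)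
  IsNilpotent.exp a

theorem nilExp_eq_sum {E : Type*} [Ring E] [Algebra ℂ E] {a : E} {N : ℕ} (h : a ^ N = 0) :
    nilExp a = ∑ i ∈ Finset.range N, (1 / (i.factorial : ℂ)) • a ^ i := by
  let : Module ℚ E := Module.compHom E (algebraMap ℚ ℂ)
  refine (IsNilpotent.exp_eq_sum h).trans (Finset.sum_congr rfl fun i _ => ?_)
  change algebraMap ℚ ℂ _ • a ^ i = _
  simp

theorem nilExp_add {E : Type*} [Ring E] [Algebra ℂ E] {a b : E} (h : Commute a b)
    (ha : IsNilpotent a) (hb : IsNilpotent b) : nilExp (a + b) = nilExp a * nilExp b := by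
  let : Module ℚ E := Module.compHom E (algebraMap ℚ ℂ)
  exact IsNilpotent.exp_add_of_commute h ha hb

theorem nilExp_neg_mul {E : Type*} [Ring E] [Algebra ℂ E] {a : E} (ha : IsNilpotent a) :
    nilExp (-a) * nilExp a = 1 := by
  let : Module ℚ E := Module.compHom E (algebraMap ℚ ℂ)
  exact IsNilpotent.exp_neg_mul_exp_self ha

theorem isUnit_nilExp {E : Type*} [Ring E] [Algebra ℂ E] {a : E} (ha : IsNilpotent a) :
    IsUnit (nilExp a) := by
  let : Module ℚ E := Module.compHom E (algebraMap ℚ ℂ)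
  exact IsNilpotent.isUnit_exp ha

theorem pow_intertwine {R U V : Type*} [CommRing R] [AddCommGroup U] [Module R U]
    [AddCommGroup V] [Module R V] (f : U →ₗ[R] V) {S : Module.End R U} {T : Module.End R V}
    (h : ∀ x, f (S x) = T (f x)) (n : ℕ) (x : U) : f ((S ^ n) x) = (T ^ n) (f x) := by
  induction n generalizing x with
  | zero => simp
  | succ n ih => rw [pow_succ, pow_succ, Module.End.mul_apply, Module.End.mul_apply, ih, h]

variable {R : Type*} [CommRing R] [Algebra ℂ R] {U V W : Type*} [AddCommGroup U] [Module R U]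
  [Module ℂ U] [IsScalarTower ℂ R U] [AddCommGroup V] [Module R V] [Module ℂ V]
  [IsScalarTower ℂ R V] [AddCommGroup W] [Module R W] [Module ℂ W] [IsScalarTower ℂ R W]

theorem nilExp_apply {T : Module.End R U} {N : ℕ} (h : T ^ N = 0) (x : U) :
    nilExp T x = ∑ i ∈ Finset.range N, (1 / (i.factorial : ℂ)) • (T ^ i) x := by
  rw [nilExp_eq_sum h, LinearMap.sum_apply]
  rfl

theorem nilExp_intertwine (f : U →ₗ[R] V) {S : Module.End R U} {T : Module.End R V}
    (hS : IsNilpotent S) (hT : IsNilpotent T) (h : ∀ x, f (S x) = T (f x)) (x : U) :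
    f (nilExp S x) = nilExp T (f x) := by
  obtain ⟨N, hN⟩ := hS
  obtain ⟨M, hM⟩ := hT
  rw [nilExp_apply (pow_eq_zero_of_le (le_max_left N M) hN),
    nilExp_apply (pow_eq_zero_of_le (le_max_right N M) hM), map_sum]
  exact Finset.sum_congr rfl fun i _ => by
    rw [LinearMap.map_smul_of_tower, pow_intertwine f h]

/-- A derivation exponentiates to an automorphism. On `U ⊗ V` the operators `X ⊗ 1` and `1 ⊗ Y`
commute, so the exponential of their sum is `exp X ⊗ exp Y`, and `μ` intertwines this sum with `Z`.
-/
theorem nilExp_bilin (μ : U →ₗ[R] V →ₗ[R] W) {X : Module.End R U} {Y : Module.End R V}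
    {Z : Module.End R W} (hX : IsNilpotent X) (hY : IsNilpotent Y) (hZ : IsNilpotent Z)
    (h : ∀ x y, Z (μ x y) = μ (X x) y + μ x (Y y)) (x : U) (y : V) :
    nilExp Z (μ x y) = μ (nilExp X x) (nilExp Y y) := by
  let P : Module.End R (U ⊗[R] V) := LinearMap.rTensor V X
  let Q : Module.End R (U ⊗[R] V) := LinearMap.lTensor U Y
  have hP : IsNilpotent P := by
    obtain ⟨N, hN⟩ := hX
    exact ⟨N, by rw [LinearMap.rTensor_pow, hN, LinearMap.rTensor_zero]⟩
  have hQ : IsNilpotent Q := by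
    obtain ⟨N, hN⟩ := hY
    exact ⟨N, by rw [LinearMap.lTensor_pow, hN, LinearMap.lTensor_zero]⟩
  have hc : Commute P Q := by
    refine TensorProduct.ext' fun x y => ?_
    simp [P, Q]
  have h1 := nilExp_intertwine (TensorProduct.lift μ) (hc.isNilpotent_add hP hQ) hZ
    (fun t => by
      induction t with
      | zero => simp
      | tmul x y => simp [P, Q, h]
      | add s t hs ht => simp only [map_add, hs, ht]) (x ⊗ₜ y)
  rw [TensorProduct.lift.tmul, nilExp_add hc hP hQ, Module.End.mul_apply] at h1
  have h2 := nilExp_intertwine (TensorProduct.mk R U V x) hY hQ (fun y => by simp [Q]) y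
  have h3 := nilExp_intertwine ((TensorProduct.mk R U V).flip (nilExp Y y)) hX hP
    (fun y => by simp [P]) x
  simp only [TensorProduct.mk_apply, LinearMap.flip_apply] at h2 h3
  rw [← h1, ← h2, ← h3, TensorProduct.lift.tmul]

end Exponential

/-! ### Truncated differential graded Lie algebras -/

/-- The part of a differential graded Lie algebra in degrees `0`, `1`, `2` on which the
Maurer-Cartan equation and the gauge action depend. -/
structure TruncDGLA where
  L₀ : Type u
  L₁ : Type u
  L₂ : Type u
  [addCommGroup₀ : AddCommGroup L₀]
  [addCommGroup₁ : AddCommGroup L₁]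
  [addCommGroup₂ : AddCommGroup L₂]
  [module₀ : Module ℂ L₀]
  [module₁ : Module ℂ L₁]
  [module₂ : Module ℂ L₂]
  d₀ : L₀ →ₗ[ℂ] L₁
  d₁ : L₁ →ₗ[ℂ] L₂
  b₀₁ : L₀ →ₗ[ℂ] L₁ →ₗ[ℂ] L₁
  b₀₂ : L₀ →ₗ[ℂ] L₂ →ₗ[ℂ] L₂
  b₁₁ : L₁ →ₗ[ℂ] L₁ →ₗ[ℂ] L₂
  d₁_d₀ : ∀ l, d₁ (d₀ l) = 0
  symm : ∀ x y, b₁₁ x y = b₁₁ y x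
  leibniz : ∀ l x, d₁ (b₀₁ l x) = b₁₁ (d₀ l) x + b₀₂ l (d₁ x)
  jacobi : ∀ l x y, b₀₂ l (b₁₁ x y) = b₁₁ (b₀₁ l x) y + b₁₁ x (b₀₁ l y)

namespace TruncDGLA

attribute [instance] addCommGroup₀ addCommGroup₁ addCommGroup₂ module₀ module₁ module₂

/-- A homomorphism of truncated differential graded Lie algebras. -/
structure Hom (L M : TruncDGLA.{u}) where
  f₀ : L.L₀ →ₗ[ℂ] M.L₀
  f₁ : L.L₁ →ₗ[ℂ] M.L₁
  f₂ : L.L₂ →ₗ[ℂ] M.L₂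
  map_d₀ : ∀ l, f₁ (L.d₀ l) = M.d₀ (f₀ l)
  map_d₁ : ∀ x, f₂ (L.d₁ x) = M.d₁ (f₁ x)
  map_b₀₁ : ∀ l x, f₁ (L.b₀₁ l x) = M.b₀₁ (f₀ l) (f₁ x)
  map_b₀₂ : ∀ l x, f₂ (L.b₀₂ l x) = M.b₀₂ (f₀ l) (f₂ x)
  map_b₁₁ : ∀ x y, f₂ (L.b₁₁ x y) = M.b₁₁ (f₁ x) (f₁ y)

variable (L : TruncDGLA.{u}) (A : ArtAlg.{w})

theorem symm_ext (x y : A ⊗[ℂ] L.L₁) : bilinExt A L.b₁₁ x y = bilinExt A L.b₁₁ y x :=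
  (bilinExt_symm 1 L.b₁₁ L.b₁₁ (fun x y => by rw [L.symm, one_smul]) x y).trans (one_smul _ _)

theorem leibniz_ext (l : A ⊗[ℂ] L.L₀) (x : A ⊗[ℂ] L.L₁) :
    L.d₁.baseChange A (bilinExt A L.b₀₁ l x) =
      bilinExt A L.b₁₁ (L.d₀.baseChange A l) x + bilinExt A L.b₀₂ l (L.d₁.baseChange A x) :=
  bilinExt_leibniz _ _ _ _ _ _ L.leibniz l x

theorem jacobi_ext (l : A ⊗[ℂ] L.L₀) (x y : A ⊗[ℂ] L.L₁) :
    bilinExt A L.b₀₂ l (bilinExt A L.b₁₁ x y) =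
      bilinExt A L.b₁₁ (bilinExt A L.b₀₁ l x) y + bilinExt A L.b₁₁ x (bilinExt A L.b₀₁ l y) :=
  bilinExt_jacobi _ _ _ _ _ _ L.jacobi l x y

theorem d₁_d₀_ext (l : A ⊗[ℂ] L.L₀) : L.d₁.baseChange A (L.d₀.baseChange A l) = 0 :=
  baseChange_comp_apply_eq_zero L.d₁_d₀ l

/-- The left hand side of the Maurer-Cartan equation. -/
def curv (ω : A ⊗[ℂ] L.L₁) : A ⊗[ℂ] L.L₂ :=
  L.d₁.baseChange A ω + (1 / 2 : ℂ) • bilinExt A L.b₁₁ ω ω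

/-- Solutions of the Maurer-Cartan equation. -/
def IsMC (ω : A ⊗[ℂ] L.L₁) : Prop :=
  ω ∈ A.m • (⊤ : Submodule A (A ⊗[ℂ] L.L₁)) ∧ L.curv A ω = 0

/-- The operator `ad λ`. -/
def adOp (l : A ⊗[ℂ] L.L₀) : Module.End A (A ⊗[ℂ] L.L₁) := bilinExt A L.b₀₁ l

/-- The gauge action. -/
def gauge (l : A ⊗[ℂ] L.L₀) (α : A ⊗[ℂ] L.L₁) : A ⊗[ℂ] L.L₁ :=
  (∑ᶠ n : ℕ, (1 / (n.factorial : ℂ)) • (L.adOp A l ^ n) α) -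
    ∑ᶠ n : ℕ, (1 / ((n + 1).factorial : ℂ)) • (L.adOp A l ^ n) (L.d₀.baseChange A l)

/-- The operator `ad λ` on `C¹ ⊕ ℂ δ`, where `[λ, δ] = -dλ`. -/
def adExt (l : A ⊗[ℂ] L.L₀) : Module.End A ((A ⊗[ℂ] L.L₁) × A) :=
  LinearMap.prod (L.adOp A l ∘ₗ LinearMap.fst A _ _ -
    (LinearMap.toSpanSingleton A _ (L.d₀.baseChange A l)) ∘ₗ LinearMap.snd A _ _) 0

/-- The bracket on `C¹ ⊕ ℂ δ`. -/
def brExt : (A ⊗[ℂ] L.L₁) × A →ₗ[A] (A ⊗[ℂ] L.L₁) × A →ₗ[A] A ⊗[ℂ] L.L₂ :=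
  LinearMap.mk₂ A (fun x y => bilinExt A L.b₁₁ x.1 y.1 + x.2 • L.d₁.baseChange A y.1 +
      y.2 • L.d₁.baseChange A x.1)
    (fun x y z => by simp [add_smul]; abel) (fun a x y => by simp [mul_smul, smul_comm a])
    (fun x y z => by simp [add_smul]; abel) (fun a x y => by simp [mul_smul, smul_comm a])

variable {L A}

@[simp] theorem adExt_apply (l : A ⊗[ℂ] L.L₀) (x : A ⊗[ℂ] L.L₁) (c : A) :
    L.adExt A l (x, c) = (L.adOp A l x - c • L.d₀.baseChange A l, 0) := rfl

@[simp] theorem brExt_apply (x y : (A ⊗[ℂ] L.L₁) × A) :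
    L.brExt A x y = bilinExt A L.b₁₁ x.1 y.1 + x.2 • L.d₁.baseChange A y.1 +
      y.2 • L.d₁.baseChange A x.1 := rfl

/-- The first application turns `δ` into `-dλ`, and the other `n` act on it by `ad λ`. This shift of
exponents is the source of the series `(1 - exp(ad λ)) / ad λ`. -/
theorem adExt_pow_succ (l : A ⊗[ℂ] L.L₀) (n : ℕ) (x : A ⊗[ℂ] L.L₁) (c : A) :
    (L.adExt A l ^ (n + 1)) (x, c) =
      ((L.adOp A l ^ (n + 1)) x - c • (L.adOp A l ^ n) (L.d₀.baseChange A l), 0) := by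
  induction n with
  | zero => simp
  | succ n ih =>
    have e : ∀ (n : ℕ) y, L.adOp A l ((L.adOp A l ^ n) y) = (L.adOp A l ^ (n + 1)) y := fun n y => by
      rw [pow_succ', Module.End.mul_apply]
    rw [pow_succ', Module.End.mul_apply, ih, adExt_apply, map_sub, map_smul, zero_smul, sub_zero,
      e, e]

variable {l : A ⊗[ℂ] L.L₀}

theorem isNilpotent_adOp (hl : l ∈ A.m • (⊤ : Submodule A (A ⊗[ℂ] L.L₀))) :
    IsNilpotent (L.adOp A l) := isNilpotent_bilinExt L.b₀₁ hl

theorem isNilpotent_adExt (hl : l ∈ A.m • (⊤ : Submodule A (A ⊗[ℂ] L.L₀))) :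
    IsNilpotent (L.adExt A l) := by
  obtain ⟨N, hN⟩ := isNilpotent_adOp hl
  refine ⟨N + 1, LinearMap.ext fun x => ?_⟩
  obtain ⟨x, c⟩ := x
  rw [adExt_pow_succ, pow_succ, hN]
  simp

/-- The first range is longer than necessary, its last term being zero, so that both sums match the
exponential of `adExt` truncated at `N + 1`. -/
theorem gauge_eq_sum {N : ℕ} (hN : L.adOp A l ^ N = 0) (α : A ⊗[ℂ] L.L₁) :
    L.gauge A l α = (∑ n ∈ Finset.range (N + 1), (1 / (n.factorial : ℂ)) • (L.adOp A l ^ n) α) -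
      ∑ n ∈ Finset.range N, (1 / ((n + 1).factorial : ℂ)) •
        (L.adOp A l ^ n) (L.d₀.baseChange A l) := by
  unfold gauge
  rw [finsum_eq_sum_of_support_subset, finsum_eq_sum_of_support_subset]
  all_goals
    intro i hi
    rw [Finset.coe_range, Set.mem_Iio]
    by_contra hc
    apply hi
    change _ • (L.adOp A l ^ i) _ = 0
    rw [pow_eq_zero_of_le (by omega) hN]
    simp

/-- The affine gauge action on `C¹` is the linear action of `exp(ad λ)` on the hyperplane `C¹ + δ`.
Inverses and invariance of the Maurer-Cartan equation then follow from general facts about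
exponentials. -/
theorem nilExp_adExt (hl : l ∈ A.m • (⊤ : Submodule A (A ⊗[ℂ] L.L₀))) (α : A ⊗[ℂ] L.L₁) :
    nilExp (L.adExt A l) (α, 1) = (L.gauge A l α, 1) := by
  obtain ⟨N, hN⟩ := isNilpotent_adOp hl
  have h : L.adExt A l ^ (N + 1) = 0 := by
    refine LinearMap.ext fun x => ?_
    obtain ⟨x, c⟩ := x
    rw [adExt_pow_succ, pow_succ, hN]
    simp
  rw [nilExp_apply h, gauge_eq_sum hN, Finset.sum_range_succ', Finset.sum_range_succ']
  simp only [adExt_pow_succ, one_smul, pow_zero, Module.End.one_apply, Prod.smul_mk, smul_sub,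
    smul_zero, Nat.factorial_zero, Nat.cast_one, div_one]
  rw [Prod.ext_iff]
  simp only [Prod.fst_add, Prod.snd_add, Prod.fst_sum, Prod.snd_sum, Finset.sum_const_zero,
    zero_add, Finset.sum_sub_distrib, and_true]
  abel

theorem adExt_neg (l : A ⊗[ℂ] L.L₀) : L.adExt A (-l) = -L.adExt A l := by
  refine LinearMap.ext fun x => ?_
  obtain ⟨x, c⟩ := x
  simp [adOp]
  abel

theorem gauge_neg_gauge (hl : l ∈ A.m • (⊤ : Submodule A (A ⊗[ℂ] L.L₀))) (α : A ⊗[ℂ] L.L₁) :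
    L.gauge A (-l) (L.gauge A l α) = α := by
  have h := nilExp_adExt (neg_mem hl) (L.gauge A l α)
  rw [← nilExp_adExt hl, adExt_neg, ← Module.End.mul_apply,
    nilExp_neg_mul (isNilpotent_adExt hl)] at h
  exact (congrArg Prod.fst h).symm

/-- With `[δ, δ] = 0` and `[δ, ω] = dω`, the Maurer-Cartan equation says that `ω + δ` has square
zero. -/
theorem brExt_self (ω : A ⊗[ℂ] L.L₁) : L.brExt A (ω, 1) (ω, 1) = (2 : ℂ) • L.curv A ω := by
  simp only [brExt_apply, one_smul, curv, smul_add, smul_smul]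
  norm_num
  rw [two_smul]
  abel

/-- `ad λ` is a derivation of the extended bracket, so its exponential respects the square of `ω +
δ`; the curvature is gauge equivariant. -/
theorem nilExp_curv (hl : l ∈ A.m • (⊤ : Submodule A (A ⊗[ℂ] L.L₀))) (ω : A ⊗[ℂ] L.L₁) :
    nilExp (bilinExt A L.b₀₂ l : Module.End A (A ⊗[ℂ] L.L₂)) ((2 : ℂ) • L.curv A ω) =
      (2 : ℂ) • L.curv A (L.gauge A l ω) := by
  rw [← brExt_self, ← brExt_self, ← nilExp_adExt hl]
  refine nilExp_bilin (L.brExt A) (isNilpotent_adExt hl) (isNilpotent_adExt hl)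
    (isNilpotent_bilinExt L.b₀₂ hl) (fun x y => ?_) _ _
  obtain ⟨x, c⟩ := x
  obtain ⟨y, e⟩ := y
  simp only [brExt_apply, adExt_apply, map_add, map_sub, map_smul, LinearMap.sub_apply,
    LinearMap.smul_apply, jacobi_ext, zero_smul, d₁_d₀_ext, leibniz_ext, adOp, smul_zero,
    L.symm_ext A x (L.d₀.baseChange A l)]
  module

theorem IsMC.gauge {ω : A ⊗[ℂ] L.L₁} (h : L.IsMC A ω)
    (hl : l ∈ A.m • (⊤ : Submodule A (A ⊗[ℂ] L.L₀))) : L.IsMC A (L.gauge A l ω) := by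
  constructor
  · obtain ⟨N, hN⟩ := isNilpotent_adOp hl
    have key : ∀ n x, x ∈ A.m • (⊤ : Submodule A (A ⊗[ℂ] L.L₁)) →
        (L.adOp A l ^ n) x ∈ A.m • (⊤ : Submodule A (A ⊗[ℂ] L.L₁)) := by
      intro n x hx
      have h := Submodule.mem_map_of_mem (f := L.adOp A l ^ n) hx
      rw [Submodule.map_smul''] at h
      exact Submodule.smul_mono le_rfl le_top h
    rw [gauge_eq_sum hN]
    refine sub_mem (sum_mem fun n _ => ?_) (sum_mem fun n _ => ?_)
    · exact Submodule.smul_of_tower_mem _ _ (key n _ h.1)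
    · exact Submodule.smul_of_tower_mem _ _ (key n _ (baseChange_mem _ hl))
  · have h1 := nilExp_curv hl ω
    rw [h.2, smul_zero, map_zero] at h1
    exact (smul_eq_zero_iff_right two_ne_zero).1 h1.symm

/-- Compatibility of the gauge action with maps that respect brackets and differentials. -/
theorem map_gauge {M : TruncDGLA.{u}} {B : ArtAlg.{w}}
    (Ψ₀ : A ⊗[ℂ] L.L₀ →ₗ[ℂ] B ⊗[ℂ] M.L₀) (Ψ₁ : A ⊗[ℂ] L.L₁ →ₗ[ℂ] B ⊗[ℂ] M.L₁)
    (hbr : ∀ l x, Ψ₁ (L.adOp A l x) = M.adOp B (Ψ₀ l) (Ψ₁ x))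
    (hd : ∀ l, Ψ₁ (L.d₀.baseChange A l) = M.d₀.baseChange B (Ψ₀ l))
    (hl : l ∈ A.m • (⊤ : Submodule A (A ⊗[ℂ] L.L₀)))
    (hl' : Ψ₀ l ∈ B.m • (⊤ : Submodule B (B ⊗[ℂ] M.L₀))) (α : A ⊗[ℂ] L.L₁) :
    Ψ₁ (L.gauge A l α) = M.gauge B (Ψ₀ l) (Ψ₁ α) := by
  have hpow : ∀ (n : ℕ) x, Ψ₁ ((L.adOp A l ^ n) x) = (M.adOp B (Ψ₀ l) ^ n) (Ψ₁ x) := by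
    intro n
    induction n with
    | zero => simp
    | succ n ih =>
      intro x
      rw [pow_succ, pow_succ, Module.End.mul_apply, Module.End.mul_apply, ih, hbr]
  obtain ⟨N, hN⟩ := isNilpotent_adOp hl
  obtain ⟨N', hN'⟩ := isNilpotent_adOp hl'
  rw [gauge_eq_sum (pow_eq_zero_of_le (le_max_left N N') hN),
    gauge_eq_sum (pow_eq_zero_of_le (le_max_right N N') hN'), map_sub, map_sum, map_sum]
  simp only [map_smul, hpow, hd]

theorem pushTensor_gauge {B : ArtAlg.{w}} (f : A ⟶ B)
    (hl : l ∈ A.m • (⊤ : Submodule A (A ⊗[ℂ] L.L₀))) (α : A ⊗[ℂ] L.L₁) :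
    pushTensor f _ (L.gauge A l α) = L.gauge B (pushTensor f _ l) (pushTensor f _ α) :=
  map_gauge (pushTensor f _) (pushTensor f _) (fun l x => pushTensor_bilinExt f _ l x)
    (fun l => pushTensor_baseChange f _ l) hl (pushTensor_mem f hl) α

theorem pushTensor_curv {B : ArtAlg.{w}} (f : A ⟶ B) (ω : A ⊗[ℂ] L.L₁) :
    pushTensor f _ (L.curv A ω) = L.curv B (pushTensor f _ ω) := by
  simp only [curv, map_add, map_smul, pushTensor_bilinExt, pushTensor_baseChange]

theorem IsMC.push {B : ArtAlg.{w}} (f : A ⟶ B) {ω : A ⊗[ℂ] L.L₁} (h : L.IsMC A ω) :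
    L.IsMC B (pushTensor f _ ω) :=
  ⟨pushTensor_mem f h.1, by rw [← pushTensor_curv, h.2, map_zero]⟩

namespace Hom

variable {M : TruncDGLA.{u}} (g : Hom L M)

theorem map_d₀_ext (l : A ⊗[ℂ] L.L₀) :
    g.f₁.baseChange A (L.d₀.baseChange A l) = M.d₀.baseChange A (g.f₀.baseChange A l) := by
  rw [← LinearMap.comp_apply, ← LinearMap.comp_apply, ← LinearMap.baseChange_comp,
    ← LinearMap.baseChange_comp]
  congr 2
  exact LinearMap.ext g.map_d₀

theorem map_d₁_ext (x : A ⊗[ℂ] L.L₁) :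
    g.f₂.baseChange A (L.d₁.baseChange A x) = M.d₁.baseChange A (g.f₁.baseChange A x) := by
  rw [← LinearMap.comp_apply, ← LinearMap.comp_apply, ← LinearMap.baseChange_comp,
    ← LinearMap.baseChange_comp]
  congr 2
  exact LinearMap.ext g.map_d₁

theorem map_gauge (hl : l ∈ A.m • (⊤ : Submodule A (A ⊗[ℂ] L.L₀))) (α : A ⊗[ℂ] L.L₁) :
    g.f₁.baseChange A (L.gauge A l α) =
      M.gauge A (g.f₀.baseChange A l) (g.f₁.baseChange A α) :=
  TruncDGLA.map_gauge ((g.f₀.baseChange A).restrictScalars ℂ)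
    ((g.f₁.baseChange A).restrictScalars ℂ)
    (fun l x => baseChange_bilinExt A g.f₀ g.f₁ g.f₁ L.b₀₁ M.b₀₁ g.map_b₀₁ l x)
    (fun l => g.map_d₀_ext l) hl (baseChange_mem _ hl) α

theorem map_curv (ω : A ⊗[ℂ] L.L₁) :
    g.f₂.baseChange A (L.curv A ω) = M.curv A (g.f₁.baseChange A ω) := by
  rw [curv, map_add, LinearMap.map_smul_of_tower, map_d₁_ext,
    baseChange_bilinExt A g.f₁ g.f₁ g.f₂ L.b₁₁ M.b₁₁ g.map_b₁₁]
  rfl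

theorem map_isMC {ω : A ⊗[ℂ] L.L₁} (h : L.IsMC A ω) : M.IsMC A (g.f₁.baseChange A ω) :=
  ⟨baseChange_mem _ h.1, by rw [← map_curv, h.2, map_zero]⟩

end Hom

end TruncDGLA

/-! ### Gauge equivalence and small extensions -/

namespace TruncDGLA

open Relation

variable (L : TruncDGLA.{u}) (A : ArtAlg.{w})

/-- The equivalence relation generated by the gauge action. -/
def Conn : (A ⊗[ℂ] L.L₁) → (A ⊗[ℂ] L.L₁) → Prop :=
  ReflTransGen fun x y => ∃ l ∈ A.m • (⊤ : Submodule A (A ⊗[ℂ] L.L₀)), L.gauge A l x = y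

variable {L A}

/-- Only inverses are needed, and `-λ` provides them; working with chains of gauges makes the
Baker-Campbell-Hausdorff formula unnecessary. -/
theorem Conn.symm {x y : A ⊗[ℂ] L.L₁} (h : L.Conn A x y) : L.Conn A y x := by
  induction h with
  | refl => exact ReflTransGen.refl
  | tail _ h ih =>
    obtain ⟨l, hl, rfl⟩ := h
    exact ih.head ⟨-l, neg_mem hl, gauge_neg_gauge hl _⟩

theorem Conn.isMC {x y : A ⊗[ℂ] L.L₁} (h : L.Conn A x y) (hx : L.IsMC A x) : L.IsMC A y := by
  induction h with
  | refl => exact hx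
  | tail _ h ih =>
    obtain ⟨l, hl, rfl⟩ := h
    exact ih.gauge hl

theorem Conn.map {M : TruncDGLA.{u}} (g : Hom L M) {x y : A ⊗[ℂ] L.L₁} (h : L.Conn A x y) :
    M.Conn A (g.f₁.baseChange A x) (g.f₁.baseChange A y) := by
  refine ReflTransGen.lift _ (fun x y => ?_) _ _ h
  rintro ⟨l, hl, rfl⟩
  exact ⟨_, baseChange_mem g.f₀ hl, (g.map_gauge hl x).symm⟩

/-- A chain of gauges lifts link by link, because each `λ` lifts and the gauge action commutes with
pushing forward. -/
theorem Conn.exists_lift_push {B : ArtAlg.{w}} {f : A ⟶ B}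
    (hf : Function.Surjective (ArtAlg.Hom.toAlgHom f)) {x : A ⊗[ℂ] L.L₁} {y : B ⊗[ℂ] L.L₁}
    (h : L.Conn B (pushTensor f _ x) y) : ∃ x', L.Conn A x x' ∧ pushTensor f _ x' = y := by
  induction h with
  | refl => exact ⟨x, ReflTransGen.refl, rfl⟩
  | tail _ h ih =>
    obtain ⟨x', hx', rfl⟩ := ih
    obtain ⟨l, hl, rfl⟩ := h
    obtain ⟨l', hl', rfl⟩ := exists_pushTensor_eq hf hl
    exact ⟨_, hx'.tail ⟨l', hl', rfl⟩, pushTensor_gauge f hl' x'⟩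

theorem Conn.exists_lift_map {M : TruncDGLA.{u}} {g : Hom L M} (hg : Function.Surjective g.f₀)
    {x : A ⊗[ℂ] L.L₁} {y : A ⊗[ℂ] M.L₁} (h : M.Conn A (g.f₁.baseChange A x) y) :
    ∃ x', L.Conn A x x' ∧ g.f₁.baseChange A x' = y := by
  induction h with
  | refl => exact ⟨x, ReflTransGen.refl, rfl⟩
  | tail _ h ih =>
    obtain ⟨x', hx', rfl⟩ := ih
    obtain ⟨l, hl, rfl⟩ := h
    obtain ⟨l', hl', rfl⟩ := exists_baseChange_eq hg hl
    exact ⟨_, hx'.tail ⟨l', hl', rfl⟩, g.map_gauge hl' x'⟩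

theorem gauge_zero (x : A ⊗[ℂ] L.L₁) : L.gauge A 0 x = x := by
  rw [gauge_eq_sum (N := 1) (by simp [adOp])]
  simp [adOp, Finset.sum_range_succ]

theorem IsMC.eq_zero {x : A ⊗[ℂ] L.L₁} (h : L.IsMC A x) (hA : A.m = ⊥) : x = 0 := by
  have := h.1
  rwa [hA, Submodule.bot_smul, Submodule.mem_bot] at this

section SmallExtension

variable {B : ArtAlg.{w}} {f : A ⟶ B} {a : A}

/-- Since `m a = 0`, `ad (a ⊗ u)` kills everything with coefficients in `m`, and only the constant
term and the linear term `-dλ` remain. -/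
theorem gauge_tmul (hf : ArtAlg.IsSmallExtension f a) {x : A ⊗[ℂ] L.L₁}
    (hx : x ∈ A.m • (⊤ : Submodule A (A ⊗[ℂ] L.L₁))) (u : L.L₀) :
    L.gauge A (a ⊗ₜ u) x = x - a ⊗ₜ L.d₀ u := by
  have h1 : ∀ y ∈ A.m • (⊤ : Submodule A (A ⊗[ℂ] L.L₁)), L.adOp A (a ⊗ₜ u) y = 0 := fun y hy =>
    hf.bilinExt_tmul_left L.b₀₁ hy u
  -- The first application lands in coefficients from `m`, and the second kills those.
  have h2 : L.adOp A (a ⊗ₜ u) ^ 2 = 0 := by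
    refine LinearMap.ext fun y => ?_
    rw [pow_two, Module.End.mul_apply]
    apply h1
    have := mem_smul_top_of_bilinExt (n := 0) L.b₀₁ (hf.tmul_mem u) (t := y) (by simp)
    rwa [zero_add, pow_one] at this
  rw [gauge_eq_sum h2]
  simp [Finset.sum_range_succ, h1 x hx, h2, h1 _ (hf.tmul_mem (L.d₀ u))]

/-- The cross terms and the quadratic term vanish because `m a = 0`: the curvature is affine along
the kernel of a small extension. -/
theorem curv_add_tmul (hf : ArtAlg.IsSmallExtension f a) {x : A ⊗[ℂ] L.L₁}
    (hx : x ∈ A.m • (⊤ : Submodule A (A ⊗[ℂ] L.L₁))) (y : L.L₁) :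
    L.curv A (x + a ⊗ₜ y) = L.curv A x + a ⊗ₜ L.d₁ y := by
  simp only [curv, map_add, LinearMap.add_apply, hf.bilinExt_tmul_right L.b₁₁ hx,
    hf.bilinExt_tmul_right L.b₁₁ (hf.tmul_mem y), hf.bilinExt_tmul_left L.b₁₁ hx,
    LinearMap.baseChange_tmul]
  simp only [add_zero]
  abel

end SmallExtension

/-- The cubic identities of a differential graded Lie algebra, for a map
`c : C¹ × C² → C³`, `c x y = -[x, y]`. -/
structure IsCubic (L : TruncDGLA.{u}) {L₃ : Type u} [AddCommGroup L₃] [Module ℂ L₃]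
    (d₂ : L.L₂ →ₗ[ℂ] L₃) (c : L.L₁ →ₗ[ℂ] L.L₂ →ₗ[ℂ] L₃) : Prop where
  d₂_d₁ : ∀ x, d₂ (L.d₁ x) = 0
  leibniz : ∀ x y, d₂ (L.b₁₁ x y) = c x (L.d₁ y) + c y (L.d₁ x)
  jacobi : ∀ x y z, c x (L.b₁₁ y z) + c y (L.b₁₁ z x) + c z (L.b₁₁ x y) = 0

namespace IsCubic

variable {L₃ : Type u} [AddCommGroup L₃] [Module ℂ L₃] {d₂ : L.L₂ →ₗ[ℂ] L₃}
  {c : L.L₁ →ₗ[ℂ] L.L₂ →ₗ[ℂ] L₃}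

theorem d₂_d₁_ext (hc : L.IsCubic d₂ c) (x : A ⊗[ℂ] L.L₁) :
    d₂.baseChange A (L.d₁.baseChange A x) = 0 :=
  baseChange_comp_apply_eq_zero hc.d₂_d₁ x

theorem leibniz_ext (hc : L.IsCubic d₂ c) (x y : A ⊗[ℂ] L.L₁) :
    d₂.baseChange A (bilinExt A L.b₁₁ x y) =
      bilinExt A c x (L.d₁.baseChange A y) + bilinExt A c y (L.d₁.baseChange A x) := by
  induction x with
  | zero => simp
  | add s t hs ht =>
    simp only [map_add, LinearMap.add_apply, hs, ht]
    abel
  | tmul a x =>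
    induction y with
    | zero => simp
    | add s t hs ht =>
      simp only [map_add, LinearMap.add_apply, hs, ht]
      abel
    | tmul b y =>
      simp only [bilinExt_tmul, LinearMap.baseChange_tmul, hc.leibniz, TensorProduct.tmul_add,
        mul_comm]

theorem jacobi_ext (hc : L.IsCubic d₂ c) (x y z : A ⊗[ℂ] L.L₁) :
    bilinExt A c x (bilinExt A L.b₁₁ y z) + bilinExt A c y (bilinExt A L.b₁₁ z x) +
      bilinExt A c z (bilinExt A L.b₁₁ x y) = 0 := by
  induction x with
  | zero => simp
  | add s t hs ht =>
    simp only [map_add, LinearMap.add_apply]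
    rw [← add_zero (0 : A ⊗[ℂ] L₃)]
    nth_rw 1 [← hs]
    rw [← ht]
    abel
  | tmul a x =>
    induction y with
    | zero => simp
    | add s t hs ht =>
      simp only [map_add, LinearMap.add_apply]
      rw [← add_zero (0 : A ⊗[ℂ] L₃)]
      nth_rw 1 [← hs]
      rw [← ht]
      abel
    | tmul b y =>
      induction z with
      | zero => simp
      | add s t hs ht =>
        simp only [map_add, LinearMap.add_apply]
        rw [← add_zero (0 : A ⊗[ℂ] L₃)]
        nth_rw 1 [← hs]
        rw [← ht]
        abel
      | tmul e z =>
        simp only [bilinExt_tmul]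
        rw [show b * (e * a) = a * (b * e) by ring, show e * (a * b) = a * (b * e) by ring,
          ← TensorProduct.tmul_add, ← TensorProduct.tmul_add, hc.jacobi, TensorProduct.tmul_zero]

/-- The Bianchi identity. -/
theorem d₂_curv (hc : L.IsCubic d₂ c) (x : A ⊗[ℂ] L.L₁) :
    d₂.baseChange A (L.curv A x) = bilinExt A c x (L.curv A x) := by
  -- The Jacobi identity at `(x, x, x)` gives three times this term.
  have h3 : bilinExt A c x (bilinExt A L.b₁₁ x x) = 0 := by
    have h := hc.jacobi_ext x x x
    have h' : (3 : ℂ) • bilinExt A c x (bilinExt A L.b₁₁ x x) = 0 := by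
      rw [← h]
      module
    exact (smul_eq_zero_iff_right three_ne_zero).1 h'
  rw [curv, map_add, map_add, LinearMap.map_smul_of_tower, LinearMap.map_smul_of_tower,
    hc.leibniz_ext, hc.d₂_d₁_ext, h3, smul_zero]
  module

end IsCubic

variable {M : TruncDGLA.{u}}

/-- Induction over small extensions. The hypotheses say that `g` is an epimorphism on `H¹` and a
monomorphism on `H²`: the second removes the obstruction to lifting, and the first adjusts the lift
so that its image has the right gauge class. -/
theorem Hom.exists_conn (g : Hom L M) {L₃ : Type u} [AddCommGroup L₃] [Module ℂ L₃]
    {d₂ : L.L₂ →ₗ[ℂ] L₃} {c : L.L₁ →ₗ[ℂ] L.L₂ →ₗ[ℂ] L₃} (hc : L.IsCubic d₂ c)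
    (h₁ : ∀ y, M.d₁ y = 0 → ∃ x, L.d₁ x = 0 ∧ ∃ z, y = g.f₁ x + M.d₀ z)
    (h₂ : ∀ x, d₂ x = 0 → ∀ y, g.f₂ x = M.d₁ y → ∃ z, x = L.d₁ z) (A : ArtAlg.{w}) :
    ∀ η, M.IsMC A η → ∃ ω, L.IsMC A ω ∧ M.Conn A (g.f₁.baseChange A ω) η := by
  induction A using ArtAlg.induction_smallExtension with
  | base A hA =>
    intro η hη
    refine ⟨0, ⟨zero_mem _, by simp [curv]⟩, ?_⟩
    rw [hη.eq_zero hA, map_zero]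
    exact ReflTransGen.refl
  | step A B f a hf ih =>
    intro η hη
    obtain ⟨ω₀, hω₀, hc₀⟩ := ih _ (hη.push f)
    -- Move `η` within its class over `A` until its image over `B` is exactly the image of `ω₀`.
    obtain ⟨η', hη', he⟩ := hc₀.symm.exists_lift_push hf.surjective
    have hmc := hη'.isMC hη
    obtain ⟨ω, hω, rfl⟩ := exists_pushTensor_eq hf.surjective hω₀.1
    -- Any lift `ω` of `ω₀` fails by elements of the kernel only: `a ⊗ y` measures the distance to
    -- `η'`, and `a ⊗ φ` the curvature.
    obtain ⟨y, hy⟩ := hf.exists_add_tmul (s := g.f₁.baseChange A ω) (t := η')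
      (by rw [pushTensor_baseChange, he])
    obtain ⟨φ, hφ⟩ := hf.exists_tmul (s := L.curv A ω) (by rw [pushTensor_curv, hω₀.2])
    -- Bianchi identity: `[ω, a ⊗ φ] = 0` because `ω` has coefficients in `m`.
    have hφ0 : d₂ φ = 0 := by
      apply hf.eq_zero_of_tmul
      have := hc.d₂_curv ω
      rwa [hφ, hf.bilinExt_tmul_right c hω, LinearMap.baseChange_tmul] at this
    have hgφ : g.f₂ φ = M.d₁ y := by
      rw [← sub_eq_zero]
      apply hf.eq_zero_of_tmul
      have := g.map_curv ω
      rw [hφ, LinearMap.baseChange_tmul, hy, curv_add_tmul hf hmc.1, hmc.2, zero_add] at this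
      rw [TensorProduct.tmul_sub, this, sub_self]
    -- The obstruction `φ` becomes exact in `M`, hence is exact in `L`. Subtracting `a ⊗ x` from `ω`
    -- removes the curvature, and the remaining closed difference `y - g x` is `g x'` up to a
    -- coboundary `dz`.
    obtain ⟨x, hx⟩ := h₂ φ hφ0 y hgφ
    obtain ⟨x', hx', z, hz⟩ := h₁ (y - g.f₁ x) (by
      rw [map_sub, ← hgφ, ← g.map_d₁, hx, sub_self])
    have hω' : L.IsMC A (ω + a ⊗ₜ (-(x + x'))) := by
      refine ⟨add_mem hω (hf.tmul_mem _), ?_⟩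
      rw [curv_add_tmul hf hω, hφ, ← TensorProduct.tmul_add, map_neg, map_add, hx', hx, add_zero,
        add_neg_cancel, TensorProduct.tmul_zero]
    refine ⟨_, hω', ReflTransGen.trans (ReflTransGen.single ?_) (Conn.symm hη')⟩
    -- The image of the corrected element is `η' + a ⊗ dz`; the gauge `a ⊗ z` removes the last term.
    refine ⟨a ⊗ₜ z, hf.tmul_mem z, ?_⟩
    rw [gauge_tmul hf (g.map_isMC hω').1, map_add, hy, LinearMap.baseChange_tmul, add_assoc,
      ← TensorProduct.tmul_add, add_sub_assoc, ← TensorProduct.tmul_sub]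
    have : y + g.f₁ (-(x + x')) - M.d₀ z = 0 := by
      rw [map_neg, map_add, eq_sub_iff_add_eq'.2 hz.symm]
      abel
    rw [this, TensorProduct.tmul_zero, add_zero]

/-- The gauges are required to lie in the kernel of `p` so that the induction closes: lifting them
from `B` to `A` then leaves the image under `p` unchanged, and the final correction happens in the
kernel of `A → B`. -/
theorem Hom.conn_of_map_eq (p : Hom L M) (hp : Function.Surjective p.f₀)
    (h₀ : ∀ y, M.d₀ y = 0 → ∃ x, L.d₀ x = 0 ∧ y = p.f₀ x)
    (h₁ : ∀ x, L.d₁ x = 0 → ∀ y, p.f₁ x = M.d₀ y → ∃ z, x = L.d₀ z) (A : ArtAlg.{w}) :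
    ∀ ω₁ ω₂, L.IsMC A ω₁ → L.IsMC A ω₂ → p.f₁.baseChange A ω₁ = p.f₁.baseChange A ω₂ →
      ReflTransGen (fun x y => ∃ l ∈ A.m • (⊤ : Submodule A (A ⊗[ℂ] L.L₀)),
        p.f₀.baseChange A l = 0 ∧ L.gauge A l x = y) ω₁ ω₂ := by
  induction A using ArtAlg.induction_smallExtension with
  | base A hA =>
    intro ω₁ ω₂ hω₁ hω₂ _
    rw [hω₁.eq_zero hA, hω₂.eq_zero hA]
  | step A B f a hf ih =>
    intro ω₁ ω₂ hω₁ hω₂ he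
    have hB := ih _ _ (hω₁.push f) (hω₂.push f)
      (by rw [← pushTensor_baseChange, he, pushTensor_baseChange])
    obtain ⟨ω, hω, hω', heq⟩ : ∃ ω, ReflTransGen (fun x y =>
        ∃ l ∈ A.m • (⊤ : Submodule A (A ⊗[ℂ] L.L₀)), p.f₀.baseChange A l = 0 ∧
          L.gauge A l x = y) ω₁ ω ∧ (L.IsMC A ω ∧ p.f₁.baseChange A ω = p.f₁.baseChange A ω₁) ∧
          pushTensor f _ ω = pushTensor f _ ω₂ := by
      -- The chain over `B` is lifted link by link, keeping the Maurer-Cartan equation and the image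
      -- under `p`.
      generalize pushTensor f _ ω₂ = ξ at hB
      induction hB with
      | refl => exact ⟨ω₁, ReflTransGen.refl, ⟨hω₁, rfl⟩, rfl⟩
      | tail _ h ih =>
        obtain ⟨x, hx, ⟨hmc, hpx⟩, rfl⟩ := ih
        obtain ⟨l, hl, hl0, rfl⟩ := h
        obtain ⟨l, hlm, rfl⟩ := exists_pushTensor_eq hf.surjective hl
        rw [← pushTensor_baseChange] at hl0
        obtain ⟨y, hy⟩ := hf.exists_tmul hl0
        obtain ⟨z, rfl⟩ := hp y
        -- A lift of `λ` has image `a ⊗ p z` under `p`; subtracting `a ⊗ z` puts it back into the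
        -- kernel of `p` without changing it over `B`.
        have hl' : l - a ⊗ₜ z ∈ A.m • (⊤ : Submodule A (A ⊗[ℂ] L.L₀)) :=
          sub_mem hlm (hf.tmul_mem z)
        have h0 : p.f₀.baseChange A (l - a ⊗ₜ z) = 0 := by
          rw [map_sub, hy, LinearMap.baseChange_tmul, sub_self]
        refine ⟨_, hx.tail ⟨_, hl', h0, rfl⟩, ⟨hmc.gauge hl', ?_⟩, ?_⟩
        · rw [p.map_gauge hl', h0, gauge_zero, hpx]
        · rw [pushTensor_gauge f hl', map_sub, hf.pushTensor_tmul_eq_zero, sub_zero]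
    refine hω.tail ?_
    obtain ⟨x, rfl⟩ := hf.exists_add_tmul heq.symm
    have hpx : p.f₁ x = 0 := by
      apply hf.eq_zero_of_tmul
      rw [he, map_add, LinearMap.baseChange_tmul] at hω'
      exact left_eq_add.1 hω'.2
    have hdx : L.d₁ x = 0 := by
      apply hf.eq_zero_of_tmul
      have := hω₂.2
      rwa [curv_add_tmul hf hω'.1.1, hω'.1.2, zero_add] at this
    obtain ⟨z, rfl⟩ := h₁ x hdx 0 (by rw [hpx, map_zero])
    -- The primitive `z` of `x` need not lie in the kernel of `p`, but `p z` is closed, so a closed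
    -- `t` has the same image, and `z - t` is a primitive in the kernel.
    obtain ⟨t, ht, hpt⟩ := h₀ (p.f₀ z) (by rw [← p.map_d₀, hpx])
    refine ⟨a ⊗ₜ (t - z), hf.tmul_mem _, ?_, ?_⟩
    · rw [LinearMap.baseChange_tmul, map_sub, hpt, sub_self, TensorProduct.tmul_zero]
    · rw [gauge_tmul hf hω'.1.1, map_sub, ht, zero_sub, TensorProduct.tmul_neg, sub_neg_eq_add]

/-- Surjectivity in degree `0` lifts the chain of gauges, which reduces the claim to Maurer-Cartan
elements with the same image. -/
theorem Hom.conn_of_conn_map (p : Hom L M) (hp : Function.Surjective p.f₀)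
    (h₀ : ∀ y, M.d₀ y = 0 → ∃ x, L.d₀ x = 0 ∧ y = p.f₀ x)
    (h₁ : ∀ x, L.d₁ x = 0 → ∀ y, p.f₁ x = M.d₀ y → ∃ z, x = L.d₀ z) {A : ArtAlg.{w}}
    {ω₁ ω₂ : A ⊗[ℂ] L.L₁} (hω₁ : L.IsMC A ω₁) (hω₂ : L.IsMC A ω₂)
    (h : M.Conn A (p.f₁.baseChange A ω₁) (p.f₁.baseChange A ω₂)) : L.Conn A ω₁ ω₂ := by
  obtain ⟨ω, hω, he⟩ := h.exists_lift_map hp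
  refine ReflTransGen.trans hω (ReflTransGen.mono ?_ _ _
    (p.conn_of_map_eq hp h₀ h₁ A ω ω₂ (hω.isMC hω₁) hω₂ he))
  rintro x y ⟨l, hl, _, h⟩
  exact ⟨l, hl, h⟩

end TruncDGLA

/-! ### The truncation of a differential graded Lie algebra -/

namespace DGLA

variable (C : DGLA.{u})

theorem bracket_bracket_of_zero {j k : ℤ} {l x y : C.carrier} (hl : l ∈ C.gr 0) (hx : x ∈ C.gr j)
    (hy : y ∈ C.gr k) :
    C.bracket l (C.bracket x y) = C.bracket (C.bracket l x) y + C.bracket x (C.bracket l y) := by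
  have h1 := C.jacobi 0 j k l hl x hx y hy
  have h2 := C.skew k 0 y hy l hl
  have h3 := C.skew (0 + j) k _ (C.bracket_mem 0 j l hl x hx) y hy
  simp only [mul_zero, zero_mul, zpow_zero, one_smul, zero_add] at h1 h2 h3
  rw [eq_neg_of_add_eq_zero_left h2, map_neg] at h1
  rw [eq_neg_of_add_eq_zero_left h3, ← sub_eq_zero, ← h1]
  abel

theorem d_bracket_of_zero {l : C.carrier} (hl : l ∈ C.gr 0) (x : C.carrier) :
    C.d (C.bracket l x) = C.bracket (C.d l) x + C.bracket l (C.d x) := by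
  simpa using C.leibniz 0 l hl x

/-- The truncation of a differential graded Lie algebra. -/
def trunc : TruncDGLA.{u} where
  L₀ := C.gr 0
  L₁ := C.gr 1
  L₂ := C.gr 2
  d₀ := C.dRes 0 1 rfl
  d₁ := C.dRes 1 2 rfl
  b₀₁ := C.br 0 1 1 rfl
  b₀₂ := C.br 0 2 2 rfl
  b₁₁ := C.br 1 1 2 rfl
  d₁_d₀ := C.dRes_dRes 0 1 2 rfl rfl
  symm x y := Subtype.ext (by
    have := C.skew 1 1 x x.2 y y.2
    rw [mul_one, zpow_one, neg_one_smul, ← sub_eq_add_neg, sub_eq_zero] at this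
    exact this)
  leibniz l x := Subtype.ext (C.d_bracket_of_zero l.2 x)
  jacobi l x y := Subtype.ext (C.bracket_bracket_of_zero l.2 x.2 y.2)

theorem trunc_isCubic : C.trunc.IsCubic (C.dRes 2 3 rfl) (-C.br 1 2 3 rfl) where
  d₂_d₁ := C.dRes_dRes 1 2 3 rfl rfl
  leibniz := fun (x y : C.gr 1) => Subtype.ext (by
    change C.d (C.bracket x y) = -C.bracket x (C.d y) + -C.bracket y (C.d x)
    have h1 := C.leibniz 1 x x.2 y
    have h2 := C.skew 2 1 _ (C.d_mem 1 x x.2) y y.2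
    have h3 : (-1 : ℂ) ^ ((2 : ℤ) * 1) = 1 := by norm_num
    rw [h3, one_smul] at h2
    rw [h1, eq_neg_of_add_eq_zero_left h2, zpow_one, neg_one_smul]
    abel)
  jacobi := fun (x y z : C.gr 1) => Subtype.ext (by
    change -C.bracket x (C.bracket y z) + -C.bracket y (C.bracket z x) +
      -C.bracket z (C.bracket x y) = 0
    have h1 := C.jacobi 1 1 1 x x.2 y y.2 z z.2
    rw [← h1]
    simp)

variable {C} {D : DGLA.{u}}

/-- The truncation of a homomorphism. -/
def Hom.trunc (g : Hom C D) : TruncDGLA.Hom C.trunc D.trunc where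
  f₀ := g.res 0
  f₁ := g.res 1
  f₂ := g.res 2
  map_d₀ l := g.res_d 0 1 rfl l
  map_d₁ l := g.res_d 1 2 rfl l
  map_b₀₁ := fun (l : C.gr 0) (x : C.gr 1) => Subtype.ext (g.map_bracket l x)
  map_b₀₂ := fun (l : C.gr 0) (x : C.gr 2) => Subtype.ext (g.map_bracket l x)
  map_b₁₁ := fun (l x : C.gr 1) => Subtype.ext (g.map_bracket l x)

end DGLA

/-! ### Fibre products -/

section Bilinear

variable {X Y Z X' Y' Z' : Type u} [AddCommGroup X] [Module ℂ X] [AddCommGroup Y] [Module ℂ Y]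
  [AddCommGroup Z] [Module ℂ Z] [AddCommGroup X'] [Module ℂ X'] [AddCommGroup Y'] [Module ℂ Y']
  [AddCommGroup Z'] [Module ℂ Z']

/-- The product of two bilinear maps. -/
def bilinProd (b : X →ₗ[ℂ] Y →ₗ[ℂ] Z) (b' : X' →ₗ[ℂ] Y' →ₗ[ℂ] Z') :
    X × X' →ₗ[ℂ] Y × Y' →ₗ[ℂ] Z × Z' :=
  LinearMap.mk₂ ℂ (fun x y => (b x.1 y.1, b' x.2 y.2)) (fun _ _ _ => by simp)
    (fun _ _ _ => by simp) (fun _ _ _ => by simp) (fun _ _ _ => by simp)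

end Bilinear

namespace TruncDGLA

variable {L M N : TruncDGLA.{u}}

/-- The fibre product of truncated differential graded Lie algebras. -/
def pullback (f : Hom L N) (g : Hom M N) : TruncDGLA.{u} where
  L₀ := LinearMap.eqLocus (f.f₀ ∘ₗ LinearMap.fst ℂ L.L₀ M.L₀) (g.f₀ ∘ₗ LinearMap.snd ℂ L.L₀ M.L₀)
  L₁ := LinearMap.eqLocus (f.f₁ ∘ₗ LinearMap.fst ℂ L.L₁ M.L₁) (g.f₁ ∘ₗ LinearMap.snd ℂ L.L₁ M.L₁)
  L₂ := LinearMap.eqLocus (f.f₂ ∘ₗ LinearMap.fst ℂ L.L₂ M.L₂) (g.f₂ ∘ₗ LinearMap.snd ℂ L.L₂ M.L₂)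
  d₀ := (L.d₀.prodMap M.d₀).restrict fun x (h : f.f₀ x.1 = g.f₀ x.2) => by
    change f.f₁ (L.d₀ x.1) = g.f₁ (M.d₀ x.2)
    rw [f.map_d₀, g.map_d₀, h]
  d₁ := (L.d₁.prodMap M.d₁).restrict fun x (h : f.f₁ x.1 = g.f₁ x.2) => by
    change f.f₂ (L.d₁ x.1) = g.f₂ (M.d₁ x.2)
    rw [f.map_d₁, g.map_d₁, h]
  b₀₁ := bilinRestrict (bilinProd L.b₀₁ M.b₀₁) _ _ _
    fun x (hx : f.f₀ x.1 = g.f₀ x.2) y (hy : f.f₁ y.1 = g.f₁ y.2) => by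
      change f.f₁ (L.b₀₁ x.1 y.1) = g.f₁ (M.b₀₁ x.2 y.2)
      rw [f.map_b₀₁, g.map_b₀₁, hx, hy]
  b₀₂ := bilinRestrict (bilinProd L.b₀₂ M.b₀₂) _ _ _
    fun x (hx : f.f₀ x.1 = g.f₀ x.2) y (hy : f.f₂ y.1 = g.f₂ y.2) => by
      change f.f₂ (L.b₀₂ x.1 y.1) = g.f₂ (M.b₀₂ x.2 y.2)
      rw [f.map_b₀₂, g.map_b₀₂, hx, hy]
  b₁₁ := bilinRestrict (bilinProd L.b₁₁ M.b₁₁) _ _ _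
    fun x (hx : f.f₁ x.1 = g.f₁ x.2) y (hy : f.f₁ y.1 = g.f₁ y.2) => by
      change f.f₂ (L.b₁₁ x.1 y.1) = g.f₂ (M.b₁₁ x.2 y.2)
      rw [f.map_b₁₁, g.map_b₁₁, hx, hy]
  d₁_d₀ l := Subtype.ext (Prod.ext (L.d₁_d₀ l.1.1) (M.d₁_d₀ l.1.2))
  symm x y := Subtype.ext (Prod.ext (L.symm x.1.1 y.1.1) (M.symm x.1.2 y.1.2))
  leibniz l x := Subtype.ext (Prod.ext (L.leibniz l.1.1 x.1.1) (M.leibniz l.1.2 x.1.2))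
  jacobi l x y := Subtype.ext (Prod.ext (L.jacobi l.1.1 x.1.1 y.1.1)
    (M.jacobi l.1.2 x.1.2 y.1.2))

/-- The first projection of a fibre product. -/
def pullbackFst (f : Hom L N) (g : Hom M N) : Hom (pullback f g) L where
  f₀ := LinearMap.fst ℂ L.L₀ M.L₀ ∘ₗ Submodule.subtype _
  f₁ := LinearMap.fst ℂ L.L₁ M.L₁ ∘ₗ Submodule.subtype _
  f₂ := LinearMap.fst ℂ L.L₂ M.L₂ ∘ₗ Submodule.subtype _
  map_d₀ _ := rfl
  map_d₁ _ := rfl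
  map_b₀₁ _ _ := rfl
  map_b₀₂ _ _ := rfl
  map_b₁₁ _ _ := rfl

/-- The second projection of a fibre product. -/
def pullbackSnd (f : Hom L N) (g : Hom M N) : Hom (pullback f g) M where
  f₀ := LinearMap.snd ℂ L.L₀ M.L₀ ∘ₗ Submodule.subtype _
  f₁ := LinearMap.snd ℂ L.L₁ M.L₁ ∘ₗ Submodule.subtype _
  f₂ := LinearMap.snd ℂ L.L₂ M.L₂ ∘ₗ Submodule.subtype _
  map_d₀ _ := rfl
  map_d₁ _ := rfl
  map_b₀₁ _ _ := rfl
  map_b₀₂ _ _ := rfl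
  map_b₁₁ _ _ := rfl

end TruncDGLA

/-! ### Polynomial paths -/

section Polynomial

open Polynomial

variable {X Y Z : Type u} [AddCommGroup X] [Module ℂ X] [AddCommGroup Y]
  [Module ℂ Y] [AddCommGroup Z] [Module ℂ Z]

/-- The primitive of a polynomial that vanishes at `0`. -/
def polyPrimitive : ℂ[X] →ₗ[ℂ] ℂ[X] :=
  (Polynomial.basisMonomials ℂ).constr ℂ fun n => monomial (n + 1) ((n + 1 : ℂ)⁻¹)

theorem polyPrimitive_monomial (n : ℕ) (c : ℂ) :
    polyPrimitive (monomial n c) = monomial (n + 1) ((n + 1 : ℂ)⁻¹ * c) := by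
  have h : monomial n c = c • (Polynomial.basisMonomials ℂ n) := by
    rw [Polynomial.coe_basisMonomials, smul_monomial, smul_eq_mul, mul_one]
  rw [h, map_smul, polyPrimitive, Module.Basis.constr_basis, smul_monomial, smul_eq_mul, mul_comm]

theorem derivative_polyPrimitive (p : ℂ[X]) : derivative (polyPrimitive p) = p := by
  induction p using Polynomial.induction_on' with
  | add p q hp hq => rw [map_add, map_add, hp, hq]
  | monomial n c =>
    rw [polyPrimitive_monomial, derivative_monomial]
    congr 1
    have : (n + 1 : ℂ) ≠ 0 := Nat.cast_add_one_ne_zero n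
    push_cast
    field_simp

theorem polyPrimitive_derivative (p : ℂ[X]) :
    polyPrimitive (derivative p) = p - C (p.eval 0) := by
  induction p using Polynomial.induction_on' with
  | add p q hp hq => rw [map_add, map_add, hp, hq, eval_add, C_add]; abel
  | monomial n c =>
    rw [derivative_monomial, polyPrimitive_monomial]
    rcases n with _ | n
    · simp
    · have : (n + 1 : ℂ) ≠ 0 := Nat.cast_add_one_ne_zero n
      simp
      field_simp

theorem eval_zero_polyPrimitive (p : ℂ[X]) : (polyPrimitive p).eval 0 = 0 := by
  induction p using Polynomial.induction_on' with
  | add p q hp hq => rw [map_add, eval_add, hp, hq, add_zero]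
  | monomial n c => simp [polyPrimitive_monomial]

variable (X) in
/-- The derivative of a polynomial with coefficients in a vector space. -/
def derivT : ℂ[X] ⊗[ℂ] X →ₗ[ℂ] ℂ[X] ⊗[ℂ] X := LinearMap.rTensor X derivative

variable (X) in
/-- The primitive of a polynomial with coefficients in a vector space. -/
def primT : ℂ[X] ⊗[ℂ] X →ₗ[ℂ] ℂ[X] ⊗[ℂ] X := LinearMap.rTensor X polyPrimitive

variable (X) in
/-- The value at `c` of a polynomial with coefficients in a vector space. -/
abbrev evalT (c : ℂ) : ℂ[X] ⊗[ℂ] X →ₗ[ℂ] X := evalTensor X (Polynomial.aeval c)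

@[simp] theorem derivT_tmul (p : ℂ[X]) (x : X) : derivT X (p ⊗ₜ x) = derivative p ⊗ₜ x := rfl

@[simp] theorem primT_tmul (p : ℂ[X]) (x : X) : primT X (p ⊗ₜ x) = polyPrimitive p ⊗ₜ x := rfl

theorem derivT_primT (s : ℂ[X] ⊗[ℂ] X) : derivT X (primT X s) = s := by
  induction s with
  | zero => simp
  | tmul p x => simp [derivative_polyPrimitive]
  | add s t hs ht => simp only [map_add, hs, ht]

theorem primT_derivT (s : ℂ[X] ⊗[ℂ] X) : primT X (derivT X s) = s - 1 ⊗ₜ evalT X 0 s := by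
  induction s with
  | zero => simp
  | tmul p x =>
    rw [derivT_tmul, primT_tmul, polyPrimitive_derivative, evalTensor_tmul, TensorProduct.sub_tmul,
      ← TensorProduct.smul_tmul, ← Algebra.algebraMap_eq_smul_one]
    rfl
  | add s t hs ht =>
    simp only [map_add, hs, ht, TensorProduct.tmul_add]
    abel

theorem evalT_zero_primT (s : ℂ[X] ⊗[ℂ] X) : evalT X 0 (primT X s) = 0 := by
  induction s with
  | zero => simp
  | tmul p x =>
    rw [primT_tmul, evalTensor_tmul, Polynomial.coe_aeval_eq_eval, eval_zero_polyPrimitive, zero_smul]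
  | add s t hs ht => simp only [map_add, hs, ht, add_zero]

theorem derivT_baseChange (g : X →ₗ[ℂ] Y) (s : ℂ[X] ⊗[ℂ] X) :
    derivT Y (g.baseChange ℂ[X] s) = g.baseChange ℂ[X] (derivT X s) := by
  induction s with
  | zero => simp
  | tmul p x => simp
  | add s t hs ht => simp only [map_add, hs, ht]

theorem primT_baseChange (g : X →ₗ[ℂ] Y) (s : ℂ[X] ⊗[ℂ] X) :
    primT Y (g.baseChange ℂ[X] s) = g.baseChange ℂ[X] (primT X s) := by
  induction s with
  | zero => simp
  | tmul p x => simp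
  | add s t hs ht => simp only [map_add, hs, ht]

theorem derivT_bilinExt (g : X →ₗ[ℂ] Y →ₗ[ℂ] Z) (s : ℂ[X] ⊗[ℂ] X) (t : ℂ[X] ⊗[ℂ] Y) :
    derivT Z (bilinExt ℂ[X] g s t) =
      bilinExt ℂ[X] g (derivT X s) t + bilinExt ℂ[X] g s (derivT Y t) := by
  induction s with
  | zero => simp
  | add s t hs ht =>
    simp only [map_add, LinearMap.add_apply, hs, ht]
    abel
  | tmul p x =>
    induction t with
    | zero => simp
    | add s t hs ht =>
      simp only [map_add, hs, ht]
      abel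
    | tmul q y => simp [TensorProduct.add_tmul]

theorem derivT_one_tmul (x : X) : derivT X (1 ⊗ₜ x) = 0 := by simp

theorem evalT_one_tmul (c : ℂ) (x : X) : evalT X c (1 ⊗ₜ x) = x := by simp

end Polynomial

/-! ### The path object `D ⊗ ℂ[t, dt]`. -/

namespace DGLA

open Polynomial

variable (D : DGLA.{u})

/-- The Leibniz rule with `[dl, x]` written as `-[x, dl]`, because the truncation only contains
brackets with the degree-zero argument on the left. -/
theorem dRes_br_zero (l x : D.gr 0) : D.dRes 0 1 rfl (D.br 0 0 0 rfl l x) =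
    -D.br 0 1 1 rfl x (D.dRes 0 1 rfl l) + D.br 0 1 1 rfl l (D.dRes 0 1 rfl x) :=
  Subtype.ext (by
    change D.d (D.bracket l x) = -D.bracket x (D.d l) + D.bracket l (D.d x)
    have h := D.skew 1 0 _ (D.d_mem 0 l l.2) x x.2
    rw [mul_zero, zpow_zero, one_smul] at h
    rw [D.d_bracket_of_zero l.2, eq_neg_of_add_eq_zero_left h])

/-- The bracket `[x, y + z dt] = [x, y] + [x, z] dt`. -/
def pathBracket {i j : ℤ} (b : D.gr 0 →ₗ[ℂ] D.gr i →ₗ[ℂ] D.gr i)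
    (b' : D.gr 0 →ₗ[ℂ] D.gr j →ₗ[ℂ] D.gr j) :
    (ℂ[X] ⊗[ℂ] D.gr 0) →ₗ[ℂ] (ℂ[X] ⊗[ℂ] D.gr i) × (ℂ[X] ⊗[ℂ] D.gr j) →ₗ[ℂ]
      (ℂ[X] ⊗[ℂ] D.gr i) × (ℂ[X] ⊗[ℂ] D.gr j) :=
  LinearMap.mk₂ ℂ (fun l x => (bilinExt ℂ[X] b l x.1, bilinExt ℂ[X] b' l x.2))
    (fun _ _ _ => by simp)
    (fun c x y => by simp only [LinearMap.map_smul_of_tower, LinearMap.smul_apply, Prod.smul_mk])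
    (fun _ _ _ => by simp)
    (fun c x y => by simp only [LinearMap.map_smul_of_tower, Prod.smul_fst, Prod.smul_snd,
      Prod.smul_mk])

/-- The bracket `[y + z dt, y' + z' dt] = [y, y'] - ([z', y] + [z, y']) dt` of forms of degree
one. -/
def pathBracket₁ : (ℂ[X] ⊗[ℂ] D.gr 1) × (ℂ[X] ⊗[ℂ] D.gr 0) →ₗ[ℂ]
    (ℂ[X] ⊗[ℂ] D.gr 1) × (ℂ[X] ⊗[ℂ] D.gr 0) →ₗ[ℂ]
      (ℂ[X] ⊗[ℂ] D.gr 2) × (ℂ[X] ⊗[ℂ] D.gr 1) :=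
  LinearMap.mk₂ ℂ (fun x y => (bilinExt ℂ[X] (D.br 1 1 2 rfl) x.1 y.1,
      -(bilinExt ℂ[X] (D.br 0 1 1 rfl) y.2 x.1 + bilinExt ℂ[X] (D.br 0 1 1 rfl) x.2 y.1)))
    (fun _ _ _ => by simp; abel)
    (fun c x y => by
      simp only [LinearMap.map_smul_of_tower, LinearMap.smul_apply, Prod.smul_fst, Prod.smul_snd,
        Prod.smul_mk, smul_neg, smul_add])
    (fun _ _ _ => by simp; abel)
    (fun c x y => by
      simp only [LinearMap.map_smul_of_tower, LinearMap.smul_apply, Prod.smul_fst, Prod.smul_snd,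
        Prod.smul_mk, smul_neg, smul_add])

/-- The truncation of the differential graded Lie algebra `D ⊗ ℂ[t, dt]` of polynomial paths. -/
def path : TruncDGLA.{u} where
  L₀ := ℂ[X] ⊗[ℂ] D.gr 0
  L₁ := (ℂ[X] ⊗[ℂ] D.gr 1) × (ℂ[X] ⊗[ℂ] D.gr 0)
  L₂ := (ℂ[X] ⊗[ℂ] D.gr 2) × (ℂ[X] ⊗[ℂ] D.gr 1)
  d₀ := LinearMap.prod (((D.dRes 0 1 rfl).baseChange ℂ[X]).restrictScalars ℂ) (derivT _)
  d₁ := LinearMap.prod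
    (((D.dRes 1 2 rfl).baseChange ℂ[X]).restrictScalars ℂ ∘ₗ LinearMap.fst ℂ _ _)
    (((D.dRes 0 1 rfl).baseChange ℂ[X]).restrictScalars ℂ ∘ₗ LinearMap.snd ℂ _ _ -
      derivT _ ∘ₗ LinearMap.fst ℂ _ _)
  b₀₁ := D.pathBracket (D.br 0 1 1 rfl) (D.br 0 0 0 rfl)
  b₀₂ := D.pathBracket (D.br 0 2 2 rfl) (D.br 0 1 1 rfl)
  b₁₁ := D.pathBracket₁
  d₁_d₀ l := Prod.ext (baseChange_comp_apply_eq_zero (D.dRes_dRes 0 1 2 rfl rfl) l) (by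
    change (D.dRes 0 1 rfl).baseChange ℂ[X] (derivT _ l) -
      derivT _ ((D.dRes 0 1 rfl).baseChange ℂ[X] l) = 0
    rw [derivT_baseChange, sub_self])
  symm x y := Prod.ext
    ((bilinExt_symm 1 _ _ (fun x y => by rw [one_smul]; exact D.trunc.symm x y) x.1 y.1).trans
      (one_smul _ _))
    (congrArg Neg.neg (add_comm _ _))
  leibniz l x := Prod.ext
    (bilinExt_leibniz _ _ _ _ _ _ D.trunc.leibniz l x.1) (by
      change (D.dRes 0 1 rfl).baseChange ℂ[X] (bilinExt ℂ[X] (D.br 0 0 0 rfl) l x.2) -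
        derivT _ (bilinExt ℂ[X] (D.br 0 1 1 rfl) l x.1) =
        -(bilinExt ℂ[X] (D.br 0 1 1 rfl) x.2 ((D.dRes 0 1 rfl).baseChange ℂ[X] l) +
          bilinExt ℂ[X] (D.br 0 1 1 rfl) (derivT _ l) x.1) +
        bilinExt ℂ[X] (D.br 0 1 1 rfl) l ((D.dRes 0 1 rfl).baseChange ℂ[X] x.2 - derivT _ x.1)
      -- The `dt` component of the Leibniz rule; the flipped bracket stands for `[dl, x]`.
      rw [bilinExt_leibniz _ _ _ (-(D.br 0 1 1 rfl).flip) _ (D.br 0 1 1 rfl) D.dRes_br_zero,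
        derivT_bilinExt, map_sub,
        bilinExt_symm (-1) (-(D.br 0 1 1 rfl).flip) (D.br 0 1 1 rfl) (fun _ _ => by simp)]
      module)
  jacobi l x y := Prod.ext
    (bilinExt_jacobi _ _ _ _ _ _ D.trunc.jacobi l x.1 y.1) (by
      have h : ∀ (l z : D.gr 0) (y : D.gr 1), D.br 0 1 1 rfl l (D.br 0 1 1 rfl z y) =
          D.br 0 1 1 rfl (D.br 0 0 0 rfl l z) y + D.br 0 1 1 rfl z (D.br 0 1 1 rfl l y) :=
        fun l z y => Subtype.ext (D.bracket_bracket_of_zero l.2 z.2 y.2)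
      change bilinExt ℂ[X] (D.br 0 1 1 rfl) l (-(bilinExt ℂ[X] (D.br 0 1 1 rfl) y.2 x.1 +
          bilinExt ℂ[X] (D.br 0 1 1 rfl) x.2 y.1)) =
        -(bilinExt ℂ[X] (D.br 0 1 1 rfl) y.2 (bilinExt ℂ[X] (D.br 0 1 1 rfl) l x.1) +
          bilinExt ℂ[X] (D.br 0 1 1 rfl) (bilinExt ℂ[X] (D.br 0 0 0 rfl) l x.2) y.1) +
        -(bilinExt ℂ[X] (D.br 0 1 1 rfl) (bilinExt ℂ[X] (D.br 0 0 0 rfl) l y.2) x.1 +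
          bilinExt ℂ[X] (D.br 0 1 1 rfl) x.2 (bilinExt ℂ[X] (D.br 0 1 1 rfl) l y.1))
      rw [map_neg, map_add, bilinExt_jacobi _ _ _ _ _ _ h l y.2 x.1,
        bilinExt_jacobi _ _ _ _ _ _ h l x.2 y.1]
      abel)

/-- The value of a path at `c`. -/
def pathEval (c : ℂ) : TruncDGLA.Hom D.path D.trunc where
  f₀ := evalT (D.gr 0) c
  f₁ := evalT (D.gr 1) c ∘ₗ LinearMap.fst ℂ _ _
  f₂ := evalT (D.gr 2) c ∘ₗ LinearMap.fst ℂ _ _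
  map_d₀ l := evalTensor_baseChange _ _ l
  map_d₁ x := evalTensor_baseChange _ _ x.1
  map_b₀₁ l x := evalTensor_bilinExt _ _ l x.1
  map_b₀₂ l x := evalTensor_bilinExt _ _ l x.1
  map_b₁₁ x y := evalTensor_bilinExt _ _ x.1 y.1

/-- Constant paths. -/
def pathConst : TruncDGLA.Hom D.trunc D.path where
  f₀ := TensorProduct.mk ℂ ℂ[X] (D.gr 0) 1
  f₁ := LinearMap.prod (TensorProduct.mk ℂ ℂ[X] (D.gr 1) 1) 0
  f₂ := LinearMap.prod (TensorProduct.mk ℂ ℂ[X] (D.gr 2) 1) 0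
  map_d₀ l := Prod.ext rfl (derivT_one_tmul _).symm
  map_d₁ := fun (x : D.gr 1) => Prod.ext rfl (by
    change (0 : ℂ[X] ⊗[ℂ] D.gr 1) = (D.dRes 0 1 rfl).baseChange ℂ[X] 0 - derivT _ (1 ⊗ₜ x)
    rw [map_zero, derivT_one_tmul, sub_zero])
  map_b₀₁ l x := Prod.ext
    (by
      refine Eq.trans ?_ (bilinExt_tmul ℂ[X] (D.br 0 1 1 rfl) 1 1 l x).symm
      rw [mul_one]
      rfl)
    (map_zero (bilinExt ℂ[X] (D.br 0 0 0 rfl) (1 ⊗ₜ l))).symm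
  map_b₀₂ l x := Prod.ext
    (by
      refine Eq.trans ?_ (bilinExt_tmul ℂ[X] (D.br 0 2 2 rfl) 1 1 l x).symm
      rw [mul_one]
      rfl)
    (map_zero (bilinExt ℂ[X] (D.br 0 1 1 rfl) (1 ⊗ₜ l))).symm
  map_b₁₁ x y := Prod.ext
    (by
      refine Eq.trans ?_ (bilinExt_tmul ℂ[X] (D.br 1 1 2 rfl) 1 1 x y).symm
      rw [mul_one]
      rfl)
    (by
      change 0 = -(bilinExt ℂ[X] (D.br 0 1 1 rfl) 0 _ + bilinExt ℂ[X] (D.br 0 1 1 rfl) 0 _)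
      simp)

/-! ### The mapping path object, through which `g` factors. -/

variable {D} {C : DGLA.{u}} (g : Hom C D)

/-- The mapping path object of `g`. -/
abbrev Hom.mapPath : TruncDGLA.{u} := TruncDGLA.pullback g.trunc (D.pathEval 0)

/-- The inclusion of constant paths. -/
def Hom.mapPathConst : TruncDGLA.Hom C.trunc g.mapPath where
  f₀ := (LinearMap.id.prod (D.pathConst.f₀ ∘ₗ g.trunc.f₀)).codRestrict _
    fun x => (evalT_one_tmul 0 (g.res 0 x)).symm
  f₁ := (LinearMap.id.prod (D.pathConst.f₁ ∘ₗ g.trunc.f₁)).codRestrict _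
    fun x => (evalT_one_tmul 0 (g.res 1 x)).symm
  f₂ := (LinearMap.id.prod (D.pathConst.f₂ ∘ₗ g.trunc.f₂)).codRestrict _
    fun x => (evalT_one_tmul 0 (g.res 2 x)).symm
  map_d₀ x := Subtype.ext (Prod.ext rfl
    ((congrArg D.pathConst.f₁ (g.trunc.map_d₀ x)).trans (D.pathConst.map_d₀ _)))
  map_d₁ x := Subtype.ext (Prod.ext rfl
    ((congrArg D.pathConst.f₂ (g.trunc.map_d₁ x)).trans (D.pathConst.map_d₁ _)))
  map_b₀₁ x y := Subtype.ext (Prod.ext rfl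
    ((congrArg D.pathConst.f₁ (g.trunc.map_b₀₁ x y)).trans (D.pathConst.map_b₀₁ _ _)))
  map_b₀₂ x y := Subtype.ext (Prod.ext rfl
    ((congrArg D.pathConst.f₂ (g.trunc.map_b₀₂ x y)).trans (D.pathConst.map_b₀₂ _ _)))
  map_b₁₁ x y := Subtype.ext (Prod.ext rfl
    ((congrArg D.pathConst.f₂ (g.trunc.map_b₁₁ x y)).trans (D.pathConst.map_b₁₁ _ _)))

/-- The end point of a path. -/
def Hom.mapPathEnd : TruncDGLA.Hom g.mapPath D.trunc where
  f₀ := (D.pathEval 1).f₀ ∘ₗ (TruncDGLA.pullbackSnd _ _).f₀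
  f₁ := (D.pathEval 1).f₁ ∘ₗ (TruncDGLA.pullbackSnd _ _).f₁
  f₂ := (D.pathEval 1).f₂ ∘ₗ (TruncDGLA.pullbackSnd _ _).f₂
  map_d₀ x := (D.pathEval 1).map_d₀ x.1.2
  map_d₁ x := (D.pathEval 1).map_d₁ x.1.2
  map_b₀₁ x y := (D.pathEval 1).map_b₀₁ x.1.2 y.1.2
  map_b₀₂ x y := (D.pathEval 1).map_b₀₂ x.1.2 y.1.2
  map_b₁₁ x y := (D.pathEval 1).map_b₁₁ x.1.2 y.1.2

theorem Hom.mapPathEnd_const₀ (x : C.trunc.L₀) :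
    g.mapPathEnd.f₀ (g.mapPathConst.f₀ x) = g.trunc.f₀ x := evalT_one_tmul 1 (g.res 0 x)

theorem Hom.mapPathEnd_const₁ (x : C.trunc.L₁) :
    g.mapPathEnd.f₁ (g.mapPathConst.f₁ x) = g.trunc.f₁ x := evalT_one_tmul 1 (g.res 1 x)

/-- The path `t y` ends at `y` and starts at `0`, so it lies over `0` in `C`. -/
theorem Hom.mapPathEnd_surjective : Function.Surjective g.mapPathEnd.f₀ := fun (y : D.gr 0) => by
  refine ⟨⟨(0, (Polynomial.X : ℂ[X]) ⊗ₜ[ℂ] (y : D.gr 0)), ?_⟩, ?_⟩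
  · change g.res 0 0 = evalT (D.gr 0) 0 (Polynomial.X ⊗ₜ y)
    simp
  · change evalT (D.gr 0) 1 (Polynomial.X ⊗ₜ y) = y
    rw [evalTensor_tmul, aeval_X, one_smul]

/-- Closed elements of degree one of the mapping path object are cohomologous to constants. -/
theorem Hom.exists_eq_mapPathConst_add (ξ : g.mapPath.L₁) (hξ : g.mapPath.d₁ ξ = 0) :
    ∃ x, C.trunc.d₁ x = 0 ∧ ∃ l, ξ = g.mapPathConst.f₁ x + g.mapPath.d₀ l := by
  obtain ⟨⟨x, y, z⟩, h⟩ := ξ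
  have h : g.res 1 x = evalT (D.gr 1) 0 y := h
  have h1 : C.dRes 1 2 rfl x = 0 := congrArg (fun t => t.1.1) hξ
  have h2 : (D.dRes 0 1 rfl).baseChange ℂ[X] z - derivT (D.gr 1) y = 0 :=
    congrArg (fun t => t.1.2.2) hξ
  -- Integrate the `dt` component `z`. Closedness gives `dz = y'`, hence `d ∫ z = y - y(0)`, and
  -- `y(0) = g x`.
  refine ⟨x, h1, ⟨(0, primT (D.gr 0) z), ?_⟩, Subtype.ext (Prod.ext ?_ (Prod.ext ?_ ?_))⟩
  · change g.res 0 0 = evalT (D.gr 0) 0 (primT (D.gr 0) z)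
    rw [evalT_zero_primT, map_zero]
  · change x = x + C.trunc.d₀ 0
    rw [map_zero, add_zero]
  · change y = 1 ⊗ₜ g.res 1 x + (D.dRes 0 1 rfl).baseChange ℂ[X] (primT (D.gr 0) z)
    rw [← primT_baseChange, sub_eq_zero.1 h2, primT_derivT, h]
    abel
  · change z = 0 + derivT (D.gr 0) (primT (D.gr 0) z)
    rw [derivT_primT, zero_add]

/-- Factor `g` as constant paths followed by the end point. The end point map is surjective in
degree `0` and inherits the two cohomological hypotheses; the chain found in the mapping path object
is projected to `C`, where constant paths return the original elements. -/
theorem Hom.conn_of_conn_map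
    (h₀ : ∀ y, D.trunc.d₀ y = 0 → ∃ x, C.trunc.d₀ x = 0 ∧ y = g.trunc.f₀ x)
    (h₁ : ∀ x, C.trunc.d₁ x = 0 → ∀ y, g.trunc.f₁ x = D.trunc.d₀ y → ∃ z, x = C.trunc.d₀ z)
    {A : ArtAlg.{w}} {ω₁ ω₂ : A ⊗[ℂ] C.trunc.L₁} (hω₁ : C.trunc.IsMC A ω₁)
    (hω₂ : C.trunc.IsMC A ω₂)
    (h : D.trunc.Conn A (g.trunc.f₁.baseChange A ω₁) (g.trunc.f₁.baseChange A ω₂)) :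
    C.trunc.Conn A ω₁ ω₂ := by
  have e1 : ∀ ω : A ⊗[ℂ] C.trunc.L₁, g.mapPathEnd.f₁.baseChange A
      (g.mapPathConst.f₁.baseChange A ω) = g.trunc.f₁.baseChange A ω := fun ω => by
    rw [← LinearMap.comp_apply, ← LinearMap.baseChange_comp]
    congr 2
    exact LinearMap.ext g.mapPathEnd_const₁
  have e2 : ∀ ω : A ⊗[ℂ] C.trunc.L₁, (TruncDGLA.pullbackFst g.trunc (D.pathEval 0)).f₁.baseChange A
      (g.mapPathConst.f₁.baseChange A ω) = ω := fun ω => by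
    rw [← LinearMap.comp_apply, ← LinearMap.baseChange_comp]
    exact congrArg (fun t => t ω) (LinearMap.baseChange_id (R := ℂ) (A := A) (M := C.trunc.L₁))
  rw [← e1, ← e1] at h
  have h' := g.mapPathEnd.conn_of_conn_map g.mapPathEnd_surjective (fun y hy => ?_)
    (fun ξ hξ y hy => ?_) (g.mapPathConst.map_isMC hω₁) (g.mapPathConst.map_isMC hω₂) h
  · have := h'.map (TruncDGLA.pullbackFst g.trunc (D.pathEval 0))
    rwa [e2, e2] at this
  · obtain ⟨x, hx, rfl⟩ := h₀ y hy
    refine ⟨g.mapPathConst.f₀ x, ?_, (g.mapPathEnd_const₀ x).symm⟩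
    rw [← g.mapPathConst.map_d₀, hx, map_zero]
  -- A closed element is a constant `x` plus a coboundary, so a primitive of its end point yields
  -- one of `g x`, and the hypothesis on `g` applies.
  · obtain ⟨x, hx, l, rfl⟩ := g.exists_eq_mapPathConst_add ξ hξ
    rw [map_add, g.mapPathEnd.map_d₀, mapPathEnd_const₁] at hy
    obtain ⟨z, rfl⟩ := h₁ x hx (y - g.mapPathEnd.f₀ l)
      (by rw [map_sub]; exact eq_sub_of_add_eq hy)
    refine ⟨g.mapPathConst.f₀ z + l, ?_⟩
    rw [map_add, ← g.mapPathConst.map_d₀]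

/-! ### The deformation functor and `1`-equivalences -/

/-- Equality in the quotient is the equivalence relation generated by single gauges. Chains need no
symmetry since `-λ` undoes `λ`, and no side condition since gauges preserve the Maurer-Cartan
equation. -/
theorem gaugeRel_quot_eq_iff {A : ArtAlg.{w}} (ω₁ ω₂ : C.MC A) :
    Quot.mk (C.GaugeRel A) ω₁ = Quot.mk (C.GaugeRel A) ω₂ ↔ C.trunc.Conn A ω₁.1 ω₂.1 := by
  constructor
  · intro h
    replace h := Quot.eqvGen_exact h
    induction h with
    | rel x y h =>
      obtain ⟨l, hl, h⟩ := h
      exact Relation.ReflTransGen.single ⟨l, hl, h⟩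
    | refl x => exact Relation.ReflTransGen.refl
    | symm x y _ ih => exact TruncDGLA.Conn.symm ih
    | trans x y z _ _ ih₁ ih₂ => exact Relation.ReflTransGen.trans ih₁ ih₂
  · intro h
    obtain ⟨ω₂, h₂⟩ := ω₂
    change C.trunc.Conn A ω₁.1 ω₂ at h
    induction h with
    | refl => rfl
    | @tail x y hx h ih =>
      have hmc := TruncDGLA.Conn.isMC (L := C.trunc) hx ω₁.2
      refine (ih hmc).trans (Quot.sound ?_)
      obtain ⟨l, hl, h⟩ := h
      exact ⟨l, hl, h⟩

/-- Injectivity uses the epimorphism on `H⁰` and the monomorphism on `H¹`; surjectivity uses the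
epimorphism on `H¹` and the monomorphism on `H²`. -/
theorem Hom.defMap_bijective (h : IsQEquivalence g.cx 1) (A : ArtAlg.{w}) :
    Function.Bijective (g.defMap.app A) := by
  obtain ⟨hiso, hmono⟩ := h
  have hiso₀ := hiso 0 (by norm_num)
  have hiso₁ := hiso 1 le_rfl
  constructor
  · intro x y hxy
    induction x using Quot.ind with | mk ω₁ =>
    induction y using Quot.ind with | mk ω₂ =>
    refine (gaugeRel_quot_eq_iff ω₁ ω₂).2 ?_
    refine g.conn_of_conn_map (fun y hy => ?_) (fun x hx y hy => ?_) ω₁.2 ω₂.2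
      ((gaugeRel_quot_eq_iff (g.mc A ω₁) (g.mc A ω₂)).1 hxy)
    · obtain ⟨x, hx, z, hz⟩ := GradedCx.Hom.lift_of_epi g.toHom (-1) 0 1 rfl rfl inferInstance y hy
      -- There are no coboundaries in degree `0`, as the grading vanishes in degree `-1`.
      have : z = 0 := by
        have h : ∀ t ∈ D.gr (-1), t = 0 := fun t ht => by
          rwa [D.gr_neg (-1) (by norm_num), Submodule.mem_bot] at ht
        exact Subtype.ext (h z z.2)
      rw [this, map_zero, add_zero] at hz
      exact ⟨x, hx, hz⟩
    · exact GradedCx.Hom.exact_of_mono g.toHom 0 1 2 rfl rfl inferInstance x hx y hy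
  · intro y
    induction y using Quot.ind with | mk η =>
    obtain ⟨ω, hω, hc⟩ := g.trunc.exists_conn C.trunc_isCubic
      (fun y hy => GradedCx.Hom.lift_of_epi g.toHom 0 1 2 rfl rfl inferInstance y hy)
      (fun x hx y hy => GradedCx.Hom.exact_of_mono g.toHom 1 2 3 rfl rfl hmono x hx y hy) A η.1 η.2
    exact ⟨Quot.mk _ ⟨ω, hω⟩, (gaugeRel_quot_eq_iff (g.mc A ⟨ω, hω⟩) η).2 hc⟩

end DGLA

/-! ### Contractions of complexes of vector spaces onto their cohomology -/

theorem LinearMap.exists_pseudoInverse {K X Y : Type*} [Field K] [AddCommGroup X] [Module K X]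
    [AddCommGroup Y] [Module K Y] (f : X →ₗ[K] Y) :
    ∃ h : Y →ₗ[K] X, ∀ x, f (h (f x)) = f x := by
  obtain ⟨s, hs⟩ := f.rangeRestrict.exists_rightInverse_of_surjective f.range_rangeRestrict
  obtain ⟨h, hh⟩ := LinearMap.exists_extend s
  refine ⟨h, fun x => ?_⟩
  have h1 : h (f x) = s ⟨f x, LinearMap.mem_range_self f x⟩ :=
    congrArg (fun t => t ⟨f x, LinearMap.mem_range_self f x⟩) hh
  have h2 := congrArg (fun t => t ⟨f x, LinearMap.mem_range_self f x⟩) hs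
  rw [h1]
  exact congrArg Subtype.val h2

namespace GradedCx

/-- A contraction of a complex of vector spaces onto its cohomology. -/
structure Contraction (V : GradedCx.{u}) where
  h : ∀ i j, i + 1 = j → (V.gr j →ₗ[ℂ] V.gr i)
  d_h_d : ∀ i j e x, V.dRes i j e (h i j e (V.dRes i j e x)) = V.dRes i j e x
  h_d_h : ∀ i j e x, h i j e (V.dRes i j e (h i j e x)) = h i j e x
  h_h : ∀ i j k e e' x, h i j e (h j k e' x) = 0

theorem nonempty_contraction (V : GradedCx.{u}) : Nonempty V.Contraction := by
  choose k hk using fun i j (e : i + 1 = j) => (V.dRes i j e).exists_pseudoInverse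
  -- With `k` a pseudo-inverse of `d`, put `h = k d k (1 - k d)`. Then `h d = k d`, which gives `d h
  -- d = d` and `h d h = h`, and the factor `1 - k d` kills the image of `k d`, which gives `h h =
  -- 0`.
  let h : ∀ i j, i + 1 = j → (V.gr j →ₗ[ℂ] V.gr i) := fun i j e =>
    k i j e ∘ₗ V.dRes i j e ∘ₗ k i j e ∘ₗ
      (LinearMap.id - k j (j + 1) rfl ∘ₗ V.dRes j (j + 1) rfl)
  have hh : ∀ i j e x, h i j e x = k i j e (V.dRes i j e (k i j e
      (x - k j (j + 1) rfl (V.dRes j (j + 1) rfl x)))) := fun _ _ _ _ => rfl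
  have hd : ∀ i j e x, h i j e (V.dRes i j e x) = k i j e (V.dRes i j e x) := fun i j e x => by
    rw [hh, V.dRes_dRes, map_zero, sub_zero, hk]
  refine ⟨⟨h, fun i j e x => ?_, fun i j e x => ?_, fun i j l e e' x => ?_⟩⟩
  · rw [hd, hk]
  · rw [hd, hh, hk]
  · subst e'
    rw [hh i j e, hh j (j + 1) rfl, hk, sub_self, map_zero, map_zero, map_zero]

namespace Contraction

variable {V : GradedCx.{u}} (κ : V.Contraction)

/-- The harmonic subspace, which represents the cohomology. -/
def harm (n : ℤ) : Submodule ℂ (V.gr n) :=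
  LinearMap.ker (V.dRes n (n + 1) rfl) ⊓ LinearMap.ker (κ.h (n - 1) n (by omega))

theorem mem_harm {n i k : ℤ} (hi : i + 1 = n) (hk : n + 1 = k) {x : V.gr n} :
    x ∈ κ.harm n ↔ V.dRes n k hk x = 0 ∧ κ.h i n hi x = 0 := by
  obtain rfl : i = n - 1 := by omega
  subst hk
  exact Iff.rfl

/-- If `h (d y) = 0`, then `d y = d h d y = 0`: harmonic elements inject into cohomology. -/
theorem eq_zero_of_mem_harm {i n : ℤ} (hi : i + 1 = n) {y : V.gr i}
    (hy : V.dRes i n hi y ∈ κ.harm n) : V.dRes i n hi y = 0 := by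
  rw [← κ.d_h_d, ((κ.mem_harm hi rfl).1 hy).2, map_zero]

theorem finite_harm (n : ℤ) [Module.Finite ℂ (V.cx.homology n)] :
    Module.Finite ℂ (κ.harm n) := by
  let ι : ModuleCat.of ℂ (κ.harm n) ⟶ V.cx.X n := ModuleCat.ofHom (κ.harm n).subtype
  have hι : ι ≫ V.cx.d n (n + 1) = 0 := by
    rw [cx_d V n (n + 1) rfl]
    ext x : 2
    exact ((κ.mem_harm (i := n - 1) (by omega) rfl).1 x.2).1
  let f := (V.cx.liftCycles ι (n + 1) (ComplexShape.next_eq' _ rfl) hι ≫ V.cx.homologyπ n).hom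
  refine Module.Finite.of_injective f ?_
  rw [injective_iff_map_eq_zero]
  intro x hx
  obtain ⟨y, hy⟩ := (homologyπ_eq_zero_iff (n - 1) n (by omega) _).1 hx
  have h1 : (V.cx.iCycles n).hom
      ((V.cx.liftCycles ι (n + 1) (ComplexShape.next_eq' _ rfl) hι).hom x) = x.1 :=
    congrArg (fun t => t.hom x) (V.cx.liftCycles_i ι (n + 1) (ComplexShape.next_eq' _ rfl) hι)
  rw [cx_d V (n - 1) n (by omega)] at hy
  have h2 : V.dRes (n - 1) n (by omega) y = x.1 := hy.trans h1
  have h3 := x.2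
  rw [← h2] at h3
  exact Subtype.ext (h2.symm.trans (κ.eq_zero_of_mem_harm _ h3))

/-- The projection onto the harmonic subspace. -/
def proj (n : ℤ) : V.gr n →ₗ[ℂ] κ.harm n :=
  (LinearMap.id - V.dRes (n - 1) n (by omega) ∘ₗ κ.h (n - 1) n (by omega) -
    κ.h n (n + 1) rfl ∘ₗ V.dRes n (n + 1) rfl).codRestrict _ fun x => by
      rw [κ.mem_harm (i := n - 1) (by omega) rfl]
      simp only [LinearMap.sub_apply, LinearMap.comp_apply, LinearMap.id_apply, map_sub,
        V.dRes_dRes, κ.d_h_d, κ.h_d_h, κ.h_h, sub_self, sub_zero, and_self]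

theorem proj_apply {n i k : ℤ} (hi : i + 1 = n) (hk : n + 1 = k) (x : V.gr n) :
    (κ.proj n x : V.gr n) = x - V.dRes i n hi (κ.h i n hi x) - κ.h n k hk (V.dRes n k hk x) := by
  obtain rfl : i = n - 1 := by omega
  subst hk
  rfl

theorem proj_coe {n : ℤ} (x : κ.harm n) : κ.proj n x = x := by
  have h := (κ.mem_harm (i := n - 1) (by omega) rfl).1 x.2
  refine Subtype.ext ?_
  rw [κ.proj_apply (i := n - 1) (by omega) rfl, h.1, h.2, map_zero, map_zero, sub_zero, sub_zero]

end Contraction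

end GradedCx

/-! ### Minimal models of Aomoto complexes -/

theorem LinearMap.baseChange_comp_apply {R A X Y Z : Type*} [CommRing R] [CommRing A] [Algebra R A]
    [AddCommGroup X] [Module R X] [AddCommGroup Y] [Module R Y] [AddCommGroup Z] [Module R Z]
    (g : Y →ₗ[R] Z) (f : X →ₗ[R] Y) (x : A ⊗[R] X) :
    g.baseChange A (f.baseChange A x) = (g ∘ₗ f).baseChange A x := by
  rw [LinearMap.baseChange_comp, LinearMap.comp_apply]

namespace DGModule

variable {C : DGLA.{u}} (M : DGModule C) (κ : M.toGradedCx.Contraction) (A : ArtAlg.{w})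
  (ω : C.MC A)

/-- The operator `1 + h ω` in degree `i`. -/
def pert (i j : ℤ) (e : i + 1 = j) : Module.End A (A ⊗[ℂ] M.gr i) :=
  1 + (κ.h i j e).baseChange A ∘ₗ bilinExt A (M.ac 1 i j (by omega)) ω.1

theorem pert_apply (i j : ℤ) (e : i + 1 = j) (x : A ⊗[ℂ] M.gr i) :
    M.pert κ A ω i j e x =
      x + (κ.h i j e).baseChange A (bilinExt A (M.ac 1 i j (by omega)) ω.1 x) := rfl

/-- `h ω` raises the `m`-adic filtration, hence is nilpotent. -/
theorem pert_bijective (i j : ℤ) (e : i + 1 = j) : Function.Bijective (M.pert κ A ω i j e) := by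
  rw [← Module.End.isUnit_iff]
  refine IsNilpotent.isUnit_one_add (isNilpotent_of_mem_smul_top _ fun n x hx => ?_)
  have h := Submodule.mem_map_of_mem (f := (κ.h i j e).baseChange A)
    (mem_smul_top_of_bilinExt (M.ac 1 i j (by omega)) ω.2.1 hx)
  rw [Submodule.map_smul''] at h
  exact Submodule.smul_mono le_rfl le_top h

theorem redm_aomotoD (i j : ℤ) (e : i + 1 = j) (x : A ⊗[ℂ] M.gr i) :
    redm A _ (M.aomotoD A ω i j e x) = M.dRes i j e (redm A _ x) := by
  rw [aomotoD, LinearMap.add_apply, map_add, evalTensor_baseChange, evalTensor_bilinExt,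
    redm_eq_zero_iff.2 ω.2.1, map_zero, LinearMap.zero_apply, add_zero]

theorem redm_pert (i j : ℤ) (e : i + 1 = j) (x : A ⊗[ℂ] M.gr i) :
    redm A _ (M.pert κ A ω i j e x) = redm A _ x := by
  rw [pert_apply, map_add, evalTensor_baseChange, evalTensor_bilinExt,
    redm_eq_zero_iff.2 ω.2.1, map_zero, LinearMap.zero_apply, map_zero, add_zero]

/-- The terms of the minimal model of the Aomoto complex: the elements `x` with `h x = 0` and
`h d_ω x = 0`. -/
def minSub (n : ℤ) : Submodule A (A ⊗[ℂ] M.gr n) :=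
  LinearMap.ker ((κ.h (n - 1) n (by omega)).baseChange A) ⊓
    LinearMap.ker ((κ.h n (n + 1) rfl).baseChange A ∘ₗ M.aomotoD A ω n (n + 1) rfl)

variable {M κ A ω}

theorem mem_minSub {n i k : ℤ} (hi : i + 1 = n) (hk : n + 1 = k) {x : A ⊗[ℂ] M.gr n} :
    x ∈ M.minSub κ A ω n ↔ (κ.h i n hi).baseChange A x = 0 ∧
      (κ.h n k hk).baseChange A (M.aomotoD A ω n k hk x) = 0 := by
  obtain rfl : i = n - 1 := by omega
  subst hk
  exact Iff.rfl

theorem aomotoD_mem_minSub {n k : ℤ} (hk : n + 1 = k) {x : A ⊗[ℂ] M.gr n}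
    (hx : x ∈ M.minSub κ A ω n) : M.aomotoD A ω n k hk x ∈ M.minSub κ A ω k := by
  rw [mem_minSub hk rfl]
  refine ⟨((mem_minSub (i := n - 1) (by omega) hk).1 hx).2, ?_⟩
  rw [aomotoD_aomotoD, map_zero]

theorem h_aomotoD_h {i n : ℤ} (hi : i + 1 = n) (x : A ⊗[ℂ] M.gr n) :
    (κ.h i n hi).baseChange A (M.aomotoD A ω i n hi ((κ.h i n hi).baseChange A x)) =
      M.pert κ A ω i n hi ((κ.h i n hi).baseChange A x) := by
  rw [aomotoD, LinearMap.add_apply, map_add, pert_apply]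
  congr 1
  rw [LinearMap.baseChange_comp_apply, LinearMap.baseChange_comp_apply]
  congr 2
  exact LinearMap.ext (κ.h_d_h i n hi)

/-- Solve `(1 + h ω) w = h x`. Then `w = h (x - ω w)` lies in the image of `h`, where `h d` is the
identity, so that `h d_ω w = w + h ω w = h x`. -/
theorem exists_h_sub_eq_zero {i n : ℤ} (hi : i + 1 = n) (x : A ⊗[ℂ] M.gr n) :
    ∃ y : A ⊗[ℂ] M.gr i, (κ.h i n hi).baseChange A (x - M.aomotoD A ω i n hi y) = 0 := by
  obtain ⟨w, hw⟩ := (M.pert_bijective κ A ω i n hi).2 ((κ.h i n hi).baseChange A x)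
  have hw' : w = (κ.h i n hi).baseChange A (x - bilinExt A (M.ac 1 i n (by omega)) ω.1 w) := by
    rw [map_sub, ← hw, pert_apply, add_sub_cancel_right]
  refine ⟨w, ?_⟩
  rw [map_sub, sub_eq_zero, ← hw]
  conv_rhs => rw [hw', h_aomotoD_h, ← hw']

/-- On the minimal model `h x = 0` and `h d x = -h ω x`, so the projection `1 - d h - h d` becomes
`1 + h ω`, which is invertible. -/
theorem proj_eq_pert {n k : ℤ} (hk : n + 1 = k) {x : A ⊗[ℂ] M.gr n}
    (hx : x ∈ M.minSub κ A ω n) :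
    (κ.harm n).subtype.baseChange A ((κ.proj n).baseChange A x) = M.pert κ A ω n k hk x := by
  have hi : n - 1 + 1 = n := by omega
  obtain ⟨h1, h2⟩ := (mem_minSub hi hk).1 hx
  rw [LinearMap.baseChange_comp_apply]
  have h3 : (κ.harm n).subtype ∘ₗ κ.proj n = LinearMap.id - M.dRes (n - 1) n hi ∘ₗ κ.h (n - 1) n hi -
      κ.h n k hk ∘ₗ M.dRes n k hk := LinearMap.ext (κ.proj_apply hi hk)
  rw [aomotoD, LinearMap.add_apply, map_add, LinearMap.baseChange_comp_apply] at h2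
  rw [h3, LinearMap.baseChange_sub, LinearMap.baseChange_sub, LinearMap.sub_apply,
    LinearMap.sub_apply, LinearMap.baseChange_id, LinearMap.id_apply, LinearMap.baseChange_comp,
    LinearMap.comp_apply, h1, map_zero, sub_zero, eq_neg_of_add_eq_zero_left h2, sub_neg_eq_add,
    pert_apply]

theorem proj_subtype_baseChange (n : ℤ) (η : A ⊗[ℂ] κ.harm n) :
    (κ.proj n).baseChange A ((κ.harm n).subtype.baseChange A η) = η := by
  rw [LinearMap.baseChange_comp_apply]
  have : κ.proj n ∘ₗ (κ.harm n).subtype = LinearMap.id := LinearMap.ext κ.proj_coe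
  rw [this, LinearMap.baseChange_id, LinearMap.id_apply]

/-- Take `x` with `(1 + h ω) x = η`. Applying `h` and `h d` to this equation, with `h h = 0` and `h
d h = h`, gives the two defining conditions. -/
theorem exists_mem_minSub (n : ℤ) (η : A ⊗[ℂ] κ.harm n) :
    ∃ x ∈ M.minSub κ A ω n, (κ.proj n).baseChange A x = η := by
  have hi : n - 1 + 1 = n := by omega
  obtain ⟨x, hx⟩ := (M.pert_bijective κ A ω n (n + 1) rfl).2 ((κ.harm n).subtype.baseChange A η)
  have hmem : x ∈ M.minSub κ A ω n := by
    have hd : (M.dRes n (n + 1) rfl).baseChange A ((κ.harm n).subtype.baseChange A η) = 0 :=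
      baseChange_comp_apply_eq_zero (fun x => ((κ.mem_harm hi rfl).1 x.2).1) η
    have hh : (κ.h (n - 1) n hi).baseChange A ((κ.harm n).subtype.baseChange A η) = 0 :=
      baseChange_comp_apply_eq_zero (fun x => ((κ.mem_harm hi rfl).1 x.2).2) η
    rw [pert_apply] at hx
    rw [← hx, map_add] at hd hh
    rw [mem_minSub hi rfl]
    constructor
    · rwa [baseChange_comp_apply_eq_zero (κ.h_h _ _ _ _ _), add_zero] at hh
    · rw [aomotoD, LinearMap.add_apply, map_add, eq_neg_of_add_eq_zero_left hd, map_neg,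
        LinearMap.baseChange_comp_apply, LinearMap.baseChange_comp_apply]
      have : (κ.h n (n + 1) rfl ∘ₗ M.dRes n (n + 1) rfl) ∘ₗ κ.h n (n + 1) rfl = κ.h n (n + 1) rfl :=
        LinearMap.ext (κ.h_d_h n (n + 1) rfl)
      rw [this, neg_add_cancel]
  refine ⟨x, hmem, ?_⟩
  rw [← proj_subtype_baseChange n η, ← hx, ← proj_eq_pert rfl hmem, proj_subtype_baseChange]

variable (M κ A ω)

/-- The terms of the minimal model are isomorphic to the cohomology with coefficients in `A`. -/
def minEquiv (n : ℤ) : M.minSub κ A ω n ≃ₗ[A] A ⊗[ℂ] κ.harm n :=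
  LinearEquiv.ofBijective ((κ.proj n).baseChange A ∘ₗ (M.minSub κ A ω n).subtype) (by
    constructor
    · rw [injective_iff_map_eq_zero]
      intro x hx
      have hx : (κ.proj n).baseChange A x.1 = 0 := hx
      have h := proj_eq_pert (k := n + 1) rfl x.2
      rw [hx, map_zero] at h
      have := (M.pert_bijective κ A ω n (n + 1) rfl).1 (h.symm.trans (map_zero _).symm)
      exact Subtype.ext this
    · intro η
      obtain ⟨x, hx, h⟩ := exists_mem_minSub (ω := ω) n η
      exact ⟨⟨x, hx⟩, h⟩)

variable {M κ A ω}

theorem minEquiv_apply {n : ℤ} (x : M.minSub κ A ω n) :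
    M.minEquiv κ A ω n x = (κ.proj n).baseChange A x.1 := rfl

theorem redm_minEquiv {n : ℤ} (x : M.minSub κ A ω n) :
    (redm A (κ.harm n) (M.minEquiv κ A ω n x)).1 = redm A _ x.1 := by
  rw [minEquiv_apply, ← M.redm_pert κ A ω n (n + 1) rfl x.1, ← proj_eq_pert rfl x.2]
  exact (evalTensor_baseChange A.aug (κ.harm n).subtype _).symm

theorem redm_mem_harm {n : ℤ} (x : M.minSub κ A ω n) : redm A _ x.1 ∈ κ.harm n := by
  rw [← redm_minEquiv]
  exact SetLike.coe_mem _

theorem exists_redm_eq {n : ℤ} {y : M.gr n} (hy : y ∈ κ.harm n) :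
    ∃ x : M.minSub κ A ω n, redm A _ x.1 = y := by
  refine ⟨(M.minEquiv κ A ω n).symm (1 ⊗ₜ ⟨y, hy⟩), ?_⟩
  rw [← redm_minEquiv, LinearEquiv.apply_symm_apply]
  simp

theorem redm_minSub_eq_zero_iff {n : ℤ} (x : M.minSub κ A ω n) :
    redm A _ x.1 = 0 ↔ x ∈ A.m • (⊤ : Submodule A (M.minSub κ A ω n)) := by
  constructor
  · intro h
    rw [← redm_minEquiv, Submodule.coe_eq_zero, redm_eq_zero_iff] at h
    have h' := Submodule.mem_map_of_mem (f := (M.minEquiv κ A ω n).symm.toLinearMap) h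
    rw [Submodule.map_smul''] at h'
    have h2 : (M.minEquiv κ A ω n).symm.toLinearMap (M.minEquiv κ A ω n x) = x :=
      LinearEquiv.symm_apply_apply _ _
    rw [h2] at h'
    exact Submodule.smul_mono le_rfl le_top h'
  · intro h
    have h' := Submodule.mem_map_of_mem (f := (M.minSub κ A ω n).subtype) h
    rw [Submodule.map_smul''] at h'
    exact redm_eq_zero_iff.2 (Submodule.smul_mono le_rfl le_top h')

variable (M κ A ω)

/-- The differential of the minimal model. -/
def minD (i j : ℤ) (e : i + 1 = j) : M.minSub κ A ω i →ₗ[A] M.minSub κ A ω j :=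
  (M.aomotoD A ω i j e).restrict fun _ hx => aomotoD_mem_minSub e hx

/-- Elements of the minimal model reduce to harmonic elements, which are closed, so the differential
vanishes modulo `m`. -/
theorem minD_mem (i j : ℤ) (e : i + 1 = j) (x : M.minSub κ A ω i) :
    M.minD κ A ω i j e x ∈ A.m • (⊤ : Submodule A (M.minSub κ A ω j)) := by
  rw [← redm_minSub_eq_zero_iff]
  change redm A _ (M.aomotoD A ω i j e x.1) = 0
  rw [redm_aomotoD, ((κ.mem_harm (i := i - 1) (by omega) e).1 (redm_mem_harm x)).1]

/-- The minimal model of the Aomoto complex. -/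
def minCx : CochainComplex (ModuleCat.{max u w} A) ℤ :=
  mkComplex (fun n => ModuleCat.of A (M.minSub κ A ω n))
    (fun i j e => ModuleCat.ofHom (M.minD κ A ω i j e)) fun i j k e e' => by
      ext1
      exact LinearMap.ext fun x => Subtype.ext (M.aomotoD_aomotoD A ω i j k e e' x.1)

/-- The inclusion of the minimal model. -/
def minIncl : M.minCx κ A ω ⟶ M.aomoto A ω :=
  mkComplexHom (fun n => ModuleCat.ofHom (M.minSub κ A ω n).subtype) fun i j e => by
    ext1
    rfl

theorem minCx_d (i j : ℤ) (e : i + 1 = j) :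
    (M.minCx κ A ω).d i j = ModuleCat.ofHom (M.minD κ A ω i j e) := dif_pos e

theorem aomoto_d (i j : ℤ) (e : i + 1 = j) :
    (M.aomoto A ω).d i j = ModuleCat.ofHom (M.aomotoD A ω i j e) := dif_pos e

/-- Modulo coboundaries any element can be arranged to satisfy `h y = 0`. The second condition `h
d_ω y = 0` is automatic for a cocycle, and for a primitive of an element of the minimal model. -/
theorem quasiIso_minIncl : QuasiIso (M.minIncl κ A ω) := by
  refine quasiIso_of_elements _ (fun i n k hi hk => ?_) (fun i n k hi hk => ?_)
  · rw [minCx_d M κ A ω n k hk, minCx_d M κ A ω i n hi, aomoto_d M A ω i n hi]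
    intro x hx (y : A ⊗[ℂ] M.gr i) hy
    have hy : (x.1 : A ⊗[ℂ] M.gr n) = M.aomotoD A ω i n hi y := hy
    obtain ⟨z, hz⟩ := exists_h_sub_eq_zero (κ := κ) (ω := ω) (i := i - 1) (by omega) y
    have h1 : M.aomotoD A ω i n hi (y - M.aomotoD A ω (i - 1) i (by omega) z) = x.1 := by
      rw [map_sub, aomotoD_aomotoD, sub_zero, hy]
    refine ⟨⟨_, (mem_minSub (i := i - 1) (by omega) hi).2 ⟨hz, ?_⟩⟩, Subtype.ext h1.symm⟩
    rw [h1]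
    exact ((mem_minSub hi hk).1 x.2).1
  · rw [minCx_d M κ A ω n k hk, aomoto_d M A ω n k hk, aomoto_d M A ω i n hi]
    intro (y : A ⊗[ℂ] M.gr n) hy
    have hy : M.aomotoD A ω n k hk y = 0 := hy
    obtain ⟨z, hz⟩ := exists_h_sub_eq_zero (κ := κ) (ω := ω) hi y
    have h1 : M.aomotoD A ω n k hk (y - M.aomotoD A ω i n hi z) = 0 := by
      rw [map_sub, aomotoD_aomotoD, sub_zero, hy]
    refine ⟨⟨_, (mem_minSub hi hk).2 ⟨hz, by rw [h1, map_zero]⟩⟩, Subtype.ext h1, z, ?_⟩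
    exact (sub_add_cancel _ _).symm

end DGModule

/-! ### Comparison of determinantal ideals -/

section DetIdeal

variable {R : Type*} [CommRing R] {X Y X' Y' : Type*} [AddCommGroup X] [Module R X]
  [AddCommGroup Y] [Module R Y] [AddCommGroup X'] [Module R X'] [AddCommGroup Y'] [Module R Y']

theorem det_mem_detIdeal {ι : Type*} [Fintype ι] [DecidableEq ι] {r : ℕ}
    (hr : Fintype.card ι = r) (f : X →ₗ[R] Y) (x : ι → X) (φ : ι → Module.Dual R Y) :
    Matrix.det (Matrix.of fun a b => φ a (f (x b))) ∈ detIdeal r f := by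
  let e : Fin r ≃ ι := (Fintype.equivFinOfCardEq hr).symm
  rw [← Matrix.det_submatrix_equiv_self e]
  exact Ideal.subset_span ⟨x ∘ e, φ ∘ e, rfl⟩

theorem detIdeal_le_of_factor {f : X →ₗ[R] Y} {f' : X' →ₗ[R] Y'} (a : X →ₗ[R] X')
    (b : Y' →ₗ[R] Y) (h : ∀ x, b (f' (a x)) = f x) (r : ℕ) : detIdeal r f ≤ detIdeal r f' := by
  refine Ideal.span_le.2 ?_
  rintro _ ⟨x, φ, rfl⟩
  refine Ideal.subset_span ⟨fun j => a (x j), fun j => φ j ∘ₗ b, ?_⟩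
  simp only [LinearMap.comp_apply, h]

/-- Laplace expansion along the first row. -/
theorem detIdeal_antitone (f : X →ₗ[R] Y) : Antitone fun r => detIdeal r f := by
  refine antitone_nat_of_succ_le fun r => Ideal.span_le.2 ?_
  rintro _ ⟨x, φ, rfl⟩
  rw [Matrix.det_succ_row_zero]
  refine Ideal.sum_mem _ fun j _ => Ideal.mul_mem_left _ _ ?_
  exact Ideal.subset_span ⟨fun b => x (j.succAbove b), fun a => φ a.succ, rfl⟩

/-- A direct summand on which `f'` is an isomorphism of rank `q` shifts determinantal ideals
by `q`. -/
theorem detIdeal_le_of_summand {f : X →ₗ[R] Y} {f' : X' →ₗ[R] Y'} {K : Type*} [AddCommGroup K]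
    [Module R K] [Module.Free R K] [Module.Finite R K] [Nontrivial R] (a : X →ₗ[R] X')
    (b : Y' →ₗ[R] Y) (s : K →ₗ[R] X') (t : Y' →ₗ[R] K) (h : ∀ x, b (f' (a x)) = f x)
    (hs : ∀ z, b (f' (s z)) = 0) (ht : ∀ x, t (f' (a x)) = 0) (hst : ∀ z, t (f' (s z)) = z)
    (r : ℕ) : detIdeal r f ≤ detIdeal (r + Module.finrank R K) f' := by
  classical
  let e := Module.finBasis R K
  refine Ideal.span_le.2 ?_
  rintro _ ⟨x, φ, rfl⟩
  have h1 := det_mem_detIdeal (ι := Fin r ⊕ Fin (Module.finrank R K))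
    (r := r + Module.finrank R K) (by simp) f' (Sum.elim (fun j => a (x j)) fun j => s (e j))
    (Sum.elim (fun j => φ j ∘ₗ b) fun j => e.coord j ∘ₗ t)
  -- Bordering by a basis of `K` and its dual basis produces a block diagonal matrix with an
  -- identity block.
  have h2 : (Matrix.of fun p q => Sum.elim (fun j => φ j ∘ₗ b) (fun j => e.coord j ∘ₗ t) p
      (f' (Sum.elim (fun j => a (x j)) (fun j => s (e j)) q))) =
      Matrix.fromBlocks (Matrix.of fun p q => φ p (f (x q))) 0 0 1 := by
    ext p q
    rcases p with p | p <;> rcases q with q | q <;>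
      simp [h, hs, ht, hst, Matrix.one_apply, Finsupp.single_apply, eq_comm]
  rw [h2, Matrix.det_fromBlocks_zero₂₁, Matrix.det_one, mul_one] at h1
  exact h1

end DetIdeal

/-! ### Jump ideals of homotopy equivalent complexes -/

theorem ArtAlg.isNilpotent_of_range_le {A : ArtAlg.{w}} {V : Type*} [AddCommGroup V] [Module A V]
    (T : Module.End A V) (hT : ∀ x, T x ∈ A.m • (⊤ : Submodule A V)) : IsNilpotent T := by
  refine isNilpotent_of_mem_smul_top T fun n x hx => ?_
  refine Submodule.smul_induction_on hx (fun a ha y _ => ?_) fun y z hy hz => ?_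
  · rw [map_smul, pow_succ, mul_smul]
    exact Submodule.smul_mem_smul ha (hT y)
  · rw [map_add]
    exact add_mem hy hz

theorem LinearMap.apply_mem_smul_top {R X Y : Type*} [CommRing R] [AddCommGroup X] [Module R X]
    [AddCommGroup Y] [Module R Y] (f : X →ₗ[R] Y) {I : Ideal R} {x : X}
    (hx : x ∈ I • (⊤ : Submodule R X)) : f x ∈ I • (⊤ : Submodule R Y) := by
  have h := Submodule.mem_map_of_mem (f := f) hx
  rw [Submodule.map_smul''] at h
  exact Submodule.smul_mono le_rfl le_top h

theorem Homotopy.apply_eq {R : Type w} [CommRing R] {K L : CochainComplex (ModuleCat.{v} R) ℤ}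
    {f g : K ⟶ L} (H : Homotopy f g) {i n k : ℤ} (hi : i + 1 = n) (hk : n + 1 = k) (x : K.X n) :
    (f.f n).hom x = (H.hom k n).hom ((K.d n k).hom x) + (L.d i n).hom ((H.hom n i).hom x) +
      (g.f n).hom x := by
  have h := H.comm n
  rw [dNext_eq H.hom (show (ComplexShape.up ℤ).Rel n k from hk),
    prevD_eq H.hom (show (ComplexShape.up ℤ).Rel i n from hi)] at h
  rw [h]
  rfl

theorem HomologicalComplex.Hom.comm_apply {R : Type w} [CommRing R]
    {K L : CochainComplex (ModuleCat.{v} R) ℤ} (f : K ⟶ L) (i j : ℤ) (x : K.X i) :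
    (L.d i j).hom ((f.f i).hom x) = (f.f j).hom ((K.d i j).hom x) :=
  congrArg (fun t => t.hom x) (f.comm i j)

/-- The jump ideals of a deformation retract of a complex of free modules are contained in those of
the complex. -/
theorem jumpIdealOf_le_of_retract {R : Type w} [CommRing R] [IsLocalRing R]
    {F P : CochainComplex (ModuleCat.{v} R) ℤ}
    [∀ n, Module.Finite R (F.X n)] [∀ n, Module.Free R (F.X n)] [∀ n, Module.Finite R (P.X n)]
    [∀ n, Module.Free R (P.X n)] (α : F ⟶ P) (β : P ⟶ F) (h : α ≫ β = 𝟙 F)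
    (H : Homotopy (β ≫ α) (𝟙 P)) (i : ℤ) (k : ℕ) : jumpIdealOf F i k ≤ jumpIdealOf P i k := by
  have hβα : ∀ n (x : F.X n), (β.f n).hom ((α.f n).hom x) = x := fun n x =>
    congrArg (fun t => (t.f n).hom x) h
  -- The projection onto `ker β`, a complement of the image of `F`.
  let π : ∀ n, P.X n →ₗ[R] P.X n := fun n => LinearMap.id - (α.f n).hom ∘ₗ (β.f n).hom
  have hπ : ∀ n x, π n x = x - (α.f n).hom ((β.f n).hom x) := fun n x => rfl
  have hβπ : ∀ n x, (β.f n).hom (π n x) = 0 := fun n x => by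
    rw [hπ, map_sub, hβα, sub_self]
  have hπα : ∀ n x, π n ((α.f n).hom x) = 0 := fun n x => by rw [hπ, hβα, sub_self]
  have hππ : ∀ n x, (β.f n).hom x = 0 → π n x = x := fun n x hx => by
    rw [hπ, hx, map_zero, sub_zero]
  have hdπ : ∀ m n x, (P.d m n).hom (π m x) = π n ((P.d m n).hom x) := fun m n x => by
    rw [hπ, hπ, map_sub, α.comm_apply, β.comm_apply]
  -- The homotopy compressed to `ker β`. Since `β ≫ α` is zero there, it contracts that complex; the
  -- sign turns `-1` into `1`.
  let s : ∀ m n, P.X m →ₗ[R] P.X n := fun m n => -(π n ∘ₗ (H.hom m n).hom ∘ₗ π m)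
  have hs : ∀ m n x, s m n x = -π n ((H.hom m n).hom (π m x)) := fun m n x => rfl
  have hβs : ∀ m n x, (β.f n).hom (s m n x) = 0 := fun m n x => by
    rw [hs, map_neg, hβπ, neg_zero]
  have hsα : ∀ m n x, s m n ((α.f m).hom x) = 0 := fun m n x => by
    rw [hs, hπα, map_zero, map_zero, neg_zero]
  have hds : ∀ (m n l : ℤ), m + 1 = n → n + 1 = l → ∀ x, (β.f n).hom x = 0 →
      (P.d m n).hom (s n m x) + s l n ((P.d n l).hom x) = x := fun m n l hm hl x hx => by
    have h1 := H.apply_eq hm hl x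
    have h2 : ((β ≫ α).f n).hom x = 0 := (congrArg (α.f n).hom hx).trans (map_zero _)
    rw [h2] at h1
    have h3 := congrArg (π n) h1
    have h4 : ((𝟙 P : P ⟶ P).f n).hom x = x := rfl
    rw [h4, map_zero, map_add, map_add, hππ n x hx] at h3
    rw [hs, hs, map_neg, hdπ, ← hdπ n l x, hππ n x hx, eq_comm, ← sub_eq_zero, h3]
    abel
  let K := LinearMap.ker (β.f i).hom
  let p : P.X i →ₗ[R] K := (π i).codRestrict K (hβπ i)
  have hp : Function.Surjective p := fun z => ⟨z.1, Subtype.ext (hππ i _ z.2)⟩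
  have : Module.Finite R K := Module.Finite.of_surjective p hp
  have : Module.Projective R K := Module.Projective.of_split K.subtype p
    (LinearMap.ext fun z => Subtype.ext (hππ i _ z.2))
  have : Module.Free R K := Module.free_of_flat_of_isLocalRing
  have hrank : Module.finrank R (P.X i) = Module.finrank R (F.X i) + Module.finrank R K := by
    rw [← Module.finrank_prod]
    refine LinearEquiv.finrank_eq (LinearEquiv.ofLinearMap ((β.f i).hom.prod p)
      ((α.f i).hom.coprod K.subtype) ?_ ?_)
    · refine LinearMap.ext fun x => Prod.ext ?_ (Subtype.ext ?_)
      · change (β.f i).hom ((α.f i).hom x.1 + x.2.1) = x.1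
        rw [map_add, hβα, show (β.f i).hom x.2.1 = 0 from x.2.2, add_zero]
      · change π i ((α.f i).hom x.1 + x.2.1) = x.2.1
        rw [map_add, hπα, zero_add, hππ i _ x.2.2]
    · refine LinearMap.ext fun x => ?_
      change (α.f i).hom ((β.f i).hom x) + π i x = x
      rw [hπ, add_sub_cancel]
  -- The contractible part contributes rank `rk K` to `d^{i-1} ⊕ d^i`: `z ↦ (s z, z)` and `(u, v) ↦
  -- u + s v`, projected to `K`, compose around the differentials to `d s + s d = 1`.
  refine (detIdeal_le_of_summand (K := K)
    (f' := LinearMap.prodMap (P.d (i - 1) i).hom (P.d i (i + 1)).hom)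
    (LinearMap.prodMap (α.f (i - 1)).hom (α.f i).hom)
    (LinearMap.prodMap (β.f i).hom (β.f (i + 1)).hom)
    ((s i (i - 1) ∘ₗ K.subtype).prod K.subtype)
    (p ∘ₗ LinearMap.fst _ _ _ + p ∘ₗ s (i + 1) i ∘ₗ LinearMap.snd _ _ _)
    (fun x => ?_) (fun z => ?_) (fun x => ?_) (fun z => Subtype.ext ?_) _).trans
    (detIdeal_antitone _ ?_)
  · refine Prod.ext ?_ ?_
    · change (β.f i).hom ((P.d (i - 1) i).hom ((α.f (i - 1)).hom x.1)) = (F.d (i - 1) i).hom x.1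
      rw [α.comm_apply, hβα]
    · change (β.f (i + 1)).hom ((P.d i (i + 1)).hom ((α.f i).hom x.2)) = (F.d i (i + 1)).hom x.2
      rw [α.comm_apply, hβα]
  · refine Prod.ext ?_ ?_
    · change (β.f i).hom ((P.d (i - 1) i).hom (s i (i - 1) z.1)) = 0
      rw [← β.comm_apply, hβs, map_zero]
    · change (β.f (i + 1)).hom ((P.d i (i + 1)).hom z.1) = 0
      rw [← β.comm_apply, show (β.f i).hom z.1 = 0 from z.2, map_zero]
  · refine Subtype.ext ?_
    change π i ((P.d (i - 1) i).hom ((α.f (i - 1)).hom x.1)) +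
      π i (s (i + 1) i ((P.d i (i + 1)).hom ((α.f i).hom x.2))) = 0
    rw [α.comm_apply, α.comm_apply, hπα, hsα, map_zero, add_zero]
  · change π i ((P.d (i - 1) i).hom (s i (i - 1) z.1)) +
      π i (s (i + 1) i ((P.d i (i + 1)).hom z.1)) = z.1
    rw [← map_add, hds (i - 1) i (i + 1) (by omega) rfl _ z.2, hππ i _ z.2]
  -- With truncated subtraction the size for `P` is at most the size for `F` plus `rk K`, whence
  -- antitonicity.
  · omega

/-- Minimal complexes have the smallest jump ideals within their homotopy class. -/
theorem jumpIdealOf_le_of_minimal {A : ArtAlg.{w}} {F P : CochainComplex (ModuleCat.{v} A) ℤ}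
    [∀ n, Module.Finite A (F.X n)] [∀ n, Module.Free A (F.X n)] [∀ n, Module.Finite A (P.X n)]
    [∀ n, Module.Free A (P.X n)]
    (hF : ∀ n k, n + 1 = k → ∀ x, (F.d n k).hom x ∈ A.m • (⊤ : Submodule A (F.X k)))
    (e : HomotopyEquiv F P) (i : ℤ) (k : ℕ) : jumpIdealOf F i k ≤ jumpIdealOf P i k := by
  let θ : F ⟶ F := e.hom ≫ e.inv
  have hθ : ∀ n, IsIso (θ.f n) := fun n => by
    have h1 : IsUnit (θ.f n).hom := by
      -- `θ - 1` is null-homotopic, and `d` has values in `m`, hence so does `d H + H d`.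
      have : IsNilpotent ((θ.f n).hom - 1 : Module.End A (F.X n)) := by
        refine ArtAlg.isNilpotent_of_range_le _ fun x => ?_
        have h2 := e.homotopyHomInvId.apply_eq (i := n - 1) (by omega) rfl x
        have h3 : ((θ.f n).hom - 1 : Module.End A (F.X n)) x =
            (e.homotopyHomInvId.hom (n + 1) n).hom ((F.d n (n + 1)).hom x) +
            (F.d (n - 1) n).hom ((e.homotopyHomInvId.hom n (n - 1)).hom x) :=
          sub_eq_iff_eq_add.2 h2
        rw [h3]
        exact add_mem (LinearMap.apply_mem_smul_top _ (hF _ _ rfl _)) (hF _ _ (by omega) _)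
      have := this.isUnit_one_add
      rwa [add_sub_cancel] at this
    rw [ConcreteCategory.isIso_iff_bijective]
    exact (Module.End.isUnit_iff _).1 h1
  have : IsIso θ := HomologicalComplex.Hom.isIso_of_components θ
  -- Since `θ` is invertible, `e.inv` can be corrected to a strict left inverse of `e.hom`.
  refine jumpIdealOf_le_of_retract e.hom (e.inv ≫ inv θ) ?_ ?_ i k
  · rw [← Category.assoc]
    exact IsIso.hom_inv_id θ
  · have h1 : Homotopy (inv θ) (𝟙 F) := by
      have h := e.homotopyHomInvId.symm.compLeft (inv θ)
      exact (Homotopy.ofEq (Category.comp_id _).symm).trans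
        (h.trans (Homotopy.ofEq (IsIso.inv_hom_id θ)))
    have h2 := (h1.compLeft e.inv).compRight e.hom
    exact h2.trans ((Homotopy.ofEq (by rw [Category.comp_id])).trans e.homotopyInvHomId)

/-! ### Injectivity and surjectivity modulo the maximal ideal -/

/-- Extend a left inverse over `ℂ` of the reduction of `Φ`; composed with `Φ` it is the identity
modulo `m`, hence invertible. -/
theorem exists_leftInverse_of_redm {A : ArtAlg.{w}} {X Y : Type u} [AddCommGroup X] [Module ℂ X]
    [AddCommGroup Y] [Module ℂ Y] (Φ : A ⊗[ℂ] X →ₗ[A] A ⊗[ℂ] Y)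
    (h : ∀ s, redm A Y (Φ s) = 0 → redm A X s = 0) :
    ∃ Ψ : A ⊗[ℂ] Y →ₗ[A] A ⊗[ℂ] X, ∀ s, Ψ (Φ s) = s := by
  let f : X →ₗ[ℂ] Y := redm A Y ∘ₗ Φ.restrictScalars ℂ ∘ₗ TensorProduct.mk ℂ A X 1
  have hf : ∀ s, redm A Y (Φ s) = f (redm A X s) := fun s => by
    rw [← sub_eq_zero]
    change redm A Y (Φ s) - redm A Y (Φ (1 ⊗ₜ redm A X s)) = 0
    rw [← map_sub, ← map_sub, redm_eq_zero_iff]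
    exact LinearMap.apply_mem_smul_top Φ (sub_redm_mem s)
  obtain ⟨ρ, hρ⟩ := f.exists_leftInverse_of_injective (LinearMap.ker_eq_bot'.2 fun x hx => by
    have h1 := h (1 ⊗ₜ x) hx
    simpa using h1)
  let θ : Module.End A (A ⊗[ℂ] X) := ρ.baseChange A ∘ₗ Φ
  have hθ : IsUnit θ := by
    have := (ArtAlg.isNilpotent_of_range_le (θ - 1) fun s => by
      rw [← redm_eq_zero_iff]
      change redm A X (ρ.baseChange A (Φ s) - s) = 0
      rw [map_sub, evalTensor_baseChange, hf, sub_eq_zero]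
      exact congrArg (fun t => t (redm A X s)) hρ).isUnit_one_add
    exact (add_sub_cancel (1 : Module.End A (A ⊗[ℂ] X)) θ) ▸ this
  obtain ⟨η, hη⟩ := hθ.exists_left_inv
  exact ⟨η ∘ₗ ρ.baseChange A, fun s => congrArg (fun t => t s) hη⟩

/-- Nakayama's lemma for a nilpotent ideal, by successive approximation and without finiteness. -/
theorem surjective_of_redm {A : ArtAlg.{w}} {X Y : Type u} [AddCommGroup X] [Module ℂ X]
    [AddCommGroup Y] [Module ℂ Y] (Φ : A ⊗[ℂ] X →ₗ[A] A ⊗[ℂ] Y)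
    (h : ∀ y, ∃ s, redm A Y (Φ s) = y) : Function.Surjective Φ := by
  have h1 : ∀ t, ∃ s, t - Φ s ∈ A.m • (⊤ : Submodule A (A ⊗[ℂ] Y)) := fun t => by
    obtain ⟨s, hs⟩ := h (redm A Y t)
    exact ⟨s, redm_eq_zero_iff.1 (by rw [map_sub, hs, sub_self])⟩
  have h2 : ∀ n : ℕ, ∀ t ∈ A.m ^ n • (⊤ : Submodule A (A ⊗[ℂ] Y)),
      ∃ s, t - Φ s ∈ A.m ^ (n + 1) • (⊤ : Submodule A (A ⊗[ℂ] Y)) := fun n t ht => by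
    refine Submodule.smul_induction_on ht (fun a ha y _ => ?_) fun y z hy hz => ?_
    · obtain ⟨s, hs⟩ := h1 y
      refine ⟨a • s, ?_⟩
      rw [map_smul, ← smul_sub, pow_succ, mul_smul]
      exact Submodule.smul_mem_smul ha hs
    · obtain ⟨s, hs⟩ := hy
      obtain ⟨s', hs'⟩ := hz
      exact ⟨s + s', by rw [map_add, add_sub_add_comm]; exact add_mem hs hs'⟩
  intro t
  have h3 : ∀ n : ℕ, ∃ s, t - Φ s ∈ A.m ^ n • (⊤ : Submodule A (A ⊗[ℂ] Y)) := fun n => by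
    induction n with
    | zero => exact ⟨0, by simp⟩
    | succ n ih =>
      obtain ⟨s, hs⟩ := ih
      obtain ⟨s', hs'⟩ := h2 n _ hs
      exact ⟨s + s', by rwa [map_add, ← sub_sub]⟩
  obtain ⟨N, hN⟩ := A.isNilpotent_m
  obtain ⟨s, hs⟩ := h3 N
  rw [hN, Ideal.zero_eq_bot, Submodule.bot_smul, Submodule.mem_bot, sub_eq_zero] at hs
  exact ⟨s, hs.symm⟩

/-! ### Jump ideals of minimal models -/

namespace DGLAPair

variable (P : DGLAPair.{u}) (κ : P.M.toGradedCx.Contraction) (A : ArtAlg.{w}) (ω : P.C.MC A)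

theorem isKProjective_aomoto : (P.M.aomoto A ω).IsKProjective := by
  refine isKProjective_of_free.{u} A _ ?_ fun n => ?_
  · obtain ⟨N, hN⟩ := P.bounded
    refine ⟨N, fun n hn => ?_⟩
    change Subsingleton (A ⊗[ℂ] P.M.gr n)
    rw [hN n hn]
    infer_instance
  · change Module.Free A (A ⊗[ℂ] P.M.gr n)
    infer_instance

instance finite_minCx (n : ℤ) : Module.Finite A ((P.M.minCx κ A ω).X n) := by
  have := P.finite n
  have := κ.finite_harm n
  exact Module.Finite.equiv (P.M.minEquiv κ A ω n).symm

instance free_minCx (n : ℤ) : Module.Free A ((P.M.minCx κ A ω).X n) :=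
  Module.Free.of_equiv (P.M.minEquiv κ A ω n).symm

/-- The minimal model is a resolution of the Aomoto complex. -/
def minResolution : FreeResolution (P.M.aomoto A ω) where
  F := P.M.minCx κ A ω
  bounded := by
    obtain ⟨N, hN⟩ := P.bounded
    refine ⟨N, fun n hn => ?_⟩
    have : Subsingleton (A ⊗[ℂ] P.M.gr n) := by
      rw [hN n hn]
      infer_instance
    change Subsingleton (P.M.minSub κ A ω n)
    infer_instance
  finite := P.finite_minCx κ A ω
  free := P.free_minCx κ A ω
  φ := P.M.minIncl κ A ω
  quasiIso := P.M.quasiIso_minIncl κ A ω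

theorem exists_homotopyEquiv (F : FreeResolution (P.M.aomoto A ω)) :
    ∃ e : HomotopyEquiv F.F (P.M.aomoto A ω), e.hom = F.φ := by
  have := isKProjective_of_free.{u} A F.F F.bounded F.free
  have := P.isKProjective_aomoto A ω
  exact (CochainComplex.IsKProjective.quasiIso_iff F.φ).1 F.quasiIso

/-- All resolutions are homotopy equivalent, and the minimal one has the smallest jump ideal. For
the zero ideal this one inclusion suffices, so full independence of the resolution is not needed. -/
theorem isJumpIdeal_bot_iff (i : ℤ) (k : ℕ) :
    IsJumpIdeal (P.M.aomoto A ω) i k ⊥ ↔ jumpIdealOf (P.M.minCx κ A ω) i k = ⊥ := by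
  constructor
  · rintro ⟨F, hF⟩
    obtain ⟨e, -⟩ := P.exists_homotopyEquiv A ω F
    obtain ⟨e', -⟩ := P.exists_homotopyEquiv A ω (P.minResolution κ A ω)
    have := F.finite
    have := F.free
    rw [eq_bot_iff, hF]
    refine jumpIdealOf_le_of_minimal (F := P.M.minCx κ A ω) (fun n k hk x => ?_)
      (e'.trans e.symm) i k
    rw [P.M.minCx_d κ A ω n k hk]
    exact P.M.minD_mem κ A ω n k hk x
  · intro h
    exact ⟨P.minResolution κ A ω, h.symm⟩

namespace Hom

variable {P} {Q : DGLAPair.{u}} (g : Hom P Q)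

theorem res_ac (i j k : ℤ) (h : i + j = k) (x : P.C.gr i) (y : P.M.gr j) :
    g.snd.res k (P.M.ac i j k h x y) = Q.M.ac i j k h (g.fst.res i x) (g.snd.res j y) :=
  Subtype.ext (g.map_act x y)

/-- The induced map of Aomoto complexes. -/
def aomoto : P.M.aomoto A ω ⟶ Q.M.aomoto A (g.fst.mc A ω) :=
  mkComplexHom (fun n => ModuleCat.ofHom ((g.snd.res n).baseChange A)) fun i j e => by
    ext1
    refine LinearMap.ext fun (x : A ⊗[ℂ] P.M.gr i) => ?_
    change Q.M.aomotoD A (g.fst.mc A ω) i j e ((g.snd.res i).baseChange A x) =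
      (g.snd.res j).baseChange A (P.M.aomotoD A ω i j e x)
    simp only [DGModule.aomotoD, LinearMap.add_apply, map_add]
    rw [baseChange_bilinExt A (g.fst.res 1) (g.snd.res i) (g.snd.res j) (P.M.ac 1 i j (by omega))
      (Q.M.ac 1 i j (by omega)) (g.res_ac 1 i j _), LinearMap.baseChange_comp_apply,
      LinearMap.baseChange_comp_apply]
    congr 3
    exact LinearMap.ext fun x => (g.snd.res_d i j e x).symm

variable (κ' : Q.M.toGradedCx.Contraction)

/-- A map of minimal models which reduces to the map `g` on cohomology. -/
def IsMinimalLift (Φ : P.M.minCx κ A ω ⟶ Q.M.minCx κ' A (g.fst.mc A ω)) : Prop :=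
  ∀ (i n : ℤ) (e : i + 1 = n) (x : P.M.minSub κ A ω n), ∃ z,
    redm A _ ((Φ.f n).hom x : Q.M.minSub κ' A (g.fst.mc A ω) n).1 =
      g.snd.res n (redm A _ x.1) + Q.M.dRes i n e z

/-- Compose with a homotopy inverse of the inclusion of the target. Of the homotopy terms `H d` and
`d_ω H`, the first vanishes modulo `m` by minimality and the second reduces to a coboundary. -/
theorem exists_isMinimalLift : ∃ Φ, g.IsMinimalLift κ A ω κ' Φ := by
  obtain ⟨e, he⟩ : ∃ e : HomotopyEquiv (Q.M.minCx κ' A (g.fst.mc A ω))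
      (Q.M.aomoto A (g.fst.mc A ω)), e.hom = Q.M.minIncl κ' A (g.fst.mc A ω) :=
    Q.exists_homotopyEquiv A (g.fst.mc A ω) (Q.minResolution κ' A (g.fst.mc A ω))
  let Φ : P.M.minCx κ A ω ⟶ Q.M.minCx κ' A (g.fst.mc A ω) :=
    P.M.minIncl κ A ω ≫ g.aomoto A ω ≫ e.inv
  have H : Homotopy (Φ ≫ Q.M.minIncl κ' A (g.fst.mc A ω)) (P.M.minIncl κ A ω ≫ g.aomoto A ω) := by
    have h := e.homotopyInvHomId.compLeft (P.M.minIncl κ A ω ≫ g.aomoto A ω)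
    rw [he] at h
    exact (Homotopy.ofEq (by simp only [Φ, Category.assoc])).trans (h.trans (Homotopy.ofEq (Category.comp_id _)))
  refine ⟨Φ, fun i n hi x => ⟨redm A _ ((H.hom n i).hom x : A ⊗[ℂ] Q.M.gr i), ?_⟩⟩
  have h := H.apply_eq hi rfl x
  rw [P.M.minCx_d κ A ω n (n + 1) rfl, Q.M.aomoto_d A _ i n hi] at h
  have h1 : redm A (Q.M.gr n) ((H.hom (n + 1) n).hom (P.M.minD κ A ω n (n + 1) rfl x)) = 0 :=
    redm_eq_zero_iff.2 (LinearMap.apply_mem_smul_top _ (P.M.minD_mem κ A ω n (n + 1) rfl x))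
  have h2 := congrArg (redm A (Q.M.gr n)) h
  refine h2.trans ?_
  refine (map_add (redm A (Q.M.gr n)) _ _).trans ?_
  rw [add_comm]
  congr 1
  · exact evalTensor_baseChange A.aug (g.snd.res n) x.1
  · refine (map_add (redm A (Q.M.gr n)) _ _).trans ?_
    refine (congrArg₂ (· + ·) h1 (Q.M.redm_aomotoD A _ i n hi _)).trans (zero_add _)

variable {A ω κ κ' g} {i : ℤ} {Φ : P.M.minCx κ A ω ⟶ Q.M.minCx κ' A (g.fst.mc A ω)}

namespace IsMinimalLift

/-- If the image vanishes modulo `m`, the class of the reduction of `x` is killed by `H(g₂)`. Hence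
the reduction is exact, and a harmonic exact element is zero. -/
theorem redm_injective (hΦ : g.IsMinimalLift κ A ω κ' Φ)
    (hg : IsQEquivalence g.snd.cx i) {n : ℤ} (hn : n ≤ i + 1) (x : P.M.minSub κ A ω n)
    (hx : redm A _ ((Φ.f n).hom x : Q.M.minSub κ' A (g.fst.mc A ω) n).1 = 0) :
    redm A _ x.1 = 0 := by
  have hmono : Mono (HomologicalComplex.homologyMap g.snd.cx n) := by
    rcases hn.lt_or_eq with h | rfl
    · have := hg.1 n (by omega)
      infer_instance
    · exact hg.2
  have e : n - 1 + 1 = n := by omega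
  obtain ⟨z, hz⟩ := hΦ (n - 1) n e x
  rw [hx, eq_comm, add_eq_zero_iff_eq_neg, ← map_neg] at hz
  have hh := DGModule.redm_mem_harm x
  obtain ⟨w, hw⟩ := g.snd.exact_of_mono (n - 1) n (n + 1) e rfl hmono _
    ((κ.mem_harm e rfl).1 hh).1 _ hz
  rw [hw] at hh ⊢
  exact κ.eq_zero_of_mem_harm e hh

/-- Lift the class of `y` to the harmonic representative of a class of `M`. The discrepancy is then
both exact and harmonic. -/
theorem redm_surjective (hΦ : g.IsMinimalLift κ A ω κ' Φ)
    (hg : IsQEquivalence g.snd.cx i) {n : ℤ} (hn : n ≤ i) {y : Q.M.gr n} (hy : y ∈ κ'.harm n) :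
    ∃ x : P.M.minSub κ A ω n,
      redm A _ ((Φ.f n).hom x : Q.M.minSub κ' A (g.fst.mc A ω) n).1 = y := by
  have hepi : Epi (HomologicalComplex.homologyMap g.snd.cx n) := by
    have := hg.1 n hn
    infer_instance
  have e : n - 1 + 1 = n := by omega
  obtain ⟨x, hx, z, hz⟩ := g.snd.lift_of_epi (n - 1) n (n + 1) e rfl hepi y
    ((κ'.mem_harm e rfl).1 hy).1
  obtain ⟨X, hX⟩ := DGModule.exists_redm_eq (ω := ω) (κ.proj n x).2
  refine ⟨X, ?_⟩
  obtain ⟨w, hw⟩ := hΦ (n - 1) n e X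
  have h1 : redm A _ ((Φ.f n).hom X : Q.M.minSub κ' A (g.fst.mc A ω) n).1 - y =
      Q.M.dRes (n - 1) n e (w - g.snd.res (n - 1) (κ.h (n - 1) n e x) - z) := by
    rw [hw, hX, κ.proj_apply e rfl, hx, map_zero, sub_zero, map_sub, g.snd.res_d, map_sub, map_sub,
      hz]
    abel
  have h2 := sub_mem (DGModule.redm_mem_harm
    ((Φ.f n).hom X : Q.M.minSub κ' A (g.fst.mc A ω) n)) hy
  rw [h1] at h2
  rw [← sub_eq_zero, h1, κ'.eq_zero_of_mem_harm e h2]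

theorem exists_leftInverse (hΦ : g.IsMinimalLift κ A ω κ' Φ)
    (hg : IsQEquivalence g.snd.cx i) {n : ℤ} (hn : n ≤ i + 1) :
    ∃ Ψ : Q.M.minSub κ' A (g.fst.mc A ω) n →ₗ[A] P.M.minSub κ A ω n,
      ∀ x, Ψ ((Φ.f n).hom x) = x := by
  let a := P.M.minEquiv κ A ω n
  let b := Q.M.minEquiv κ' A (g.fst.mc A ω) n
  let φ : P.M.minSub κ A ω n →ₗ[A] Q.M.minSub κ' A (g.fst.mc A ω) n := (Φ.f n).hom
  obtain ⟨Ψ, hΨ⟩ := exists_leftInverse_of_redm (b.toLinearMap ∘ₗ φ ∘ₗ a.symm.toLinearMap)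
    fun s hs => by
      have h := hΦ.redm_injective hg hn (a.symm s)
        ((DGModule.redm_minEquiv (φ (a.symm s))).symm.trans (congrArg Subtype.val hs))
      rw [← DGModule.redm_minEquiv, Submodule.coe_eq_zero] at h
      rwa [LinearEquiv.apply_symm_apply] at h
  refine ⟨a.symm.toLinearMap ∘ₗ Ψ ∘ₗ b.toLinearMap, fun (x : P.M.minSub κ A ω n) => ?_⟩
  have hx : a.symm (a x) = x := a.symm_apply_apply x
  have h : Ψ (b (φ (a.symm (a x)))) = a x := hΨ (a x)
  rw [hx] at h
  exact (congrArg a.symm h).trans hx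

theorem bijective (hΦ : g.IsMinimalLift κ A ω κ' Φ)
    (hg : IsQEquivalence g.snd.cx i) {n : ℤ} (hn : n ≤ i) : Function.Bijective (Φ.f n).hom := by
  constructor
  · obtain ⟨Ψ, hΨ⟩ := hΦ.exists_leftInverse hg (show n ≤ i + 1 by omega)
    exact Function.LeftInverse.injective hΨ
  · let a := P.M.minEquiv κ A ω n
    let b := Q.M.minEquiv κ' A (g.fst.mc A ω) n
    let φ : P.M.minSub κ A ω n →ₗ[A] Q.M.minSub κ' A (g.fst.mc A ω) n := (Φ.f n).hom
    have h := surjective_of_redm (b.toLinearMap ∘ₗ φ ∘ₗ a.symm.toLinearMap) fun y => by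
      obtain ⟨x, hx⟩ := hΦ.redm_surjective hg hn y.2
      refine ⟨a x, Subtype.ext ?_⟩
      have h1 := DGModule.redm_minEquiv (φ x)
      simp only [LinearMap.comp_apply, LinearEquiv.coe_coe, LinearEquiv.symm_apply_apply]
      exact h1.trans hx
    intro y
    obtain ⟨s, hs⟩ := h (b y)
    exact ⟨a.symm s, b.injective hs⟩

/-- The source of `d^{i-1} ⊕ d^i` involves degrees `i - 1` and `i`, where `Φ` is bijective; its
target also involves degree `i + 1`, where a left inverse of `Φ` is enough for each map to factor
through the other. -/
theorem jumpIdealOf_eq (hΦ : g.IsMinimalLift κ A ω κ' Φ)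
    (hg : IsQEquivalence g.snd.cx i) (k : ℕ) : jumpIdealOf (P.M.minCx κ A ω) i k =
    jumpIdealOf (Q.M.minCx κ' A (g.fst.mc A ω)) i k := by
  let e : ∀ n, n ≤ i → ((P.M.minCx κ A ω).X n ≃ₗ[A] (Q.M.minCx κ' A (g.fst.mc A ω)).X n) :=
    fun n hn => LinearEquiv.ofBijective (Φ.f n).hom (hΦ.bijective hg hn)
  have he' : ∀ n hn x, (Φ.f n).hom ((e n hn).symm x) = x := fun n hn x =>
    (e n hn).apply_symm_apply x
  obtain ⟨Ψ, hΨ⟩ := hΦ.exists_leftInverse hg le_rfl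
  have hi : i - 1 ≤ i := by omega
  rw [jumpIdealOf, jumpIdealOf, ← (e i le_rfl).finrank_eq]
  apply le_antisymm
  · refine detIdeal_le_of_factor (LinearMap.prodMap (e (i - 1) hi).toLinearMap
      (e i le_rfl).toLinearMap) (LinearMap.prodMap (e i le_rfl).symm.toLinearMap Ψ)
      (fun x => Prod.ext ?_ ?_) _
    · refine (LinearEquiv.symm_apply_eq _).2 ?_
      exact Φ.comm_apply _ _ _
    · refine (congrArg Ψ (Φ.comm_apply _ _ _)).trans ?_
      exact hΨ _
  · refine detIdeal_le_of_factor (LinearMap.prodMap (e (i - 1) hi).symm.toLinearMap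
      (e i le_rfl).symm.toLinearMap) (LinearMap.prodMap (e i le_rfl).toLinearMap (Φ.f (i + 1)).hom)
      (fun x => Prod.ext ?_ ?_) _
    · refine (Φ.comm_apply _ _ _).symm.trans ?_
      exact congrArg _ (he' _ hi _)
    · refine (Φ.comm_apply _ _ _).symm.trans ?_
      exact congrArg _ (he' _ le_rfl _)

end IsMinimalLift

theorem isJumpIdeal_mc_iff (hg : IsQEquivalence g.snd.cx i) (k : ℕ) : IsJumpIdeal (Q.M.aomoto A (g.fst.mc A ω)) i k ⊥ ↔
    IsJumpIdeal (P.M.aomoto A ω) i k ⊥ := by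
  obtain ⟨κ⟩ := P.M.nonempty_contraction
  obtain ⟨κ'⟩ := Q.M.nonempty_contraction
  obtain ⟨Φ, hΦ⟩ := exists_isMinimalLift κ A ω g κ'
  rw [Q.isJumpIdeal_bot_iff κ', P.isJumpIdeal_bot_iff κ, hΦ.jumpIdealOf_eq hg k]

end Hom

end DGLAPair

/-! ### Gauge invariance of jump ideals -/

theorem IsJumpIdeal.of_iso {R : Type w} [CommRing R] {E E' : CochainComplex (ModuleCat.{v} R) ℤ}
    (f : E ⟶ E') [IsIso f] {i : ℤ} {k : ℕ} {J : Ideal R} (h : IsJumpIdeal E i k J) :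
    IsJumpIdeal E' i k J := by
  obtain ⟨P, hP⟩ := h
  have := P.quasiIso
  exact ⟨⟨P.F, P.bounded, P.finite, P.free, P.φ ≫ f, inferInstance⟩, hP⟩

namespace DGModule

variable {C : DGLA.{u}} (M : DGModule C) (A : ArtAlg.{w})

theorem d_act_ext (i j : ℤ) (e : i + 1 = j) (l : A ⊗[ℂ] C.gr 0) (x : A ⊗[ℂ] M.gr i) :
    (M.dRes i j e).baseChange A (bilinExt A (M.ac 0 i i (by omega)) l x) =
      bilinExt A (M.ac 1 i j (by omega)) ((C.dRes 0 1 rfl).baseChange A l) x +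
        bilinExt A (M.ac 0 j j (by omega)) l ((M.dRes i j e).baseChange A x) :=
  bilinExt_leibniz (M.dRes i j e) (M.ac 0 i i (by omega)) (C.dRes 0 1 rfl)
    (M.ac 1 i j (by omega)) (M.dRes i j e) (M.ac 0 j j (by omega))
    (fun l x => Subtype.ext (by
      change M.d (M.act l x) = M.act (C.d l) x + M.act l (M.d x)
      rw [M.d_act 0 l l.2, zpow_zero, one_smul])) l x

theorem act_act_ext (i j : ℤ) (e : i + 1 = j) (l : A ⊗[ℂ] C.gr 0) (s : A ⊗[ℂ] C.gr 1)
    (x : A ⊗[ℂ] M.gr i) :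
    bilinExt A (M.ac 0 j j (by omega)) l (bilinExt A (M.ac 1 i j (by omega)) s x) =
      bilinExt A (M.ac 1 i j (by omega)) (bilinExt A (C.br 0 1 1 rfl) l s) x +
        bilinExt A (M.ac 1 i j (by omega)) s (bilinExt A (M.ac 0 i i (by omega)) l x) :=
  bilinExt_jacobi (M.ac 1 i j (by omega)) (M.ac 0 j j (by omega)) (C.br 0 1 1 rfl)
    (M.ac 1 i j (by omega)) (M.ac 0 i i (by omega)) (M.ac 1 i j (by omega))
    (fun l s x => Subtype.ext (by
      change M.act l (M.act s x) = M.act (C.bracket l s) x + M.act s (M.act l x)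
      rw [M.bracket_act 0 1 l l.2 s s.2, zero_mul, zpow_zero, one_smul, sub_add_cancel])) l s x

/-- The action of `C¹ ⊕ ℂ δ` on `M`, where `δ` acts as the differential. -/
def acExt (i j : ℤ) (e : i + 1 = j) :
    (A ⊗[ℂ] C.gr 1) × A →ₗ[A] A ⊗[ℂ] M.gr i →ₗ[A] A ⊗[ℂ] M.gr j :=
  (bilinExt A (M.ac 1 i j (by omega))).coprod
    (LinearMap.toSpanSingleton A _ ((M.dRes i j e).baseChange A))

theorem acExt_apply (i j : ℤ) (e : i + 1 = j) (s : A ⊗[ℂ] C.gr 1) (c : A) (x : A ⊗[ℂ] M.gr i) :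
    M.acExt A i j e (s, c) x =
      bilinExt A (M.ac 1 i j (by omega)) s x + c • (M.dRes i j e).baseChange A x := rfl

variable {A}

/-- `d_ω` is the action of `ω + δ` on `M`, where `δ` acts as `d`. The action is compatible with `λ`,
hence with `exp λ`, which carries `ω₁ + δ` to `ω₂ + δ`. -/
theorem nilExp_aomotoD {l : A ⊗[ℂ] C.gr 0} (hl : l ∈ A.m • (⊤ : Submodule A (A ⊗[ℂ] C.gr 0)))
    {ω₁ ω₂ : C.MC A} (h : C.gauge A l ω₁.1 = ω₂.1) (i j : ℤ) (e : i + 1 = j) (x : A ⊗[ℂ] M.gr i) :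
    nilExp (bilinExt A (M.ac 0 j j (by omega)) l) (M.aomotoD A ω₁ i j e x) =
      M.aomotoD A ω₂ i j e (nilExp (bilinExt A (M.ac 0 i i (by omega)) l) x) := by
  have hD : ∀ (ω : C.MC A) x, M.aomotoD A ω i j e x = M.acExt A i j e (ω.1, 1) x := fun ω x => by
    rw [acExt_apply, one_smul, aomotoD, LinearMap.add_apply, add_comm]
  rw [hD, hD, ← h]
  have h1 : nilExp (C.trunc.adExt A l) (ω₁.1, 1) = (C.gauge A l ω₁.1, 1) :=
    TruncDGLA.nilExp_adExt (L := C.trunc) hl ω₁.1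
  rw [← h1]
  refine nilExp_bilin (M.acExt A i j e) (TruncDGLA.isNilpotent_adExt (L := C.trunc) hl)
    (isNilpotent_bilinExt _ hl) (isNilpotent_bilinExt _ hl) (fun y x => ?_) _ _
  obtain ⟨s, c⟩ := y
  have h2 : C.trunc.adExt A l (s, c) = (bilinExt A (C.br 0 1 1 rfl) l s -
    c • (C.dRes 0 1 rfl).baseChange A l, 0) := rfl
  refine Eq.trans ?_ (congrArg (fun t => M.acExt A i j e t x +
    M.acExt A i j e (s, c) (bilinExt A (M.ac 0 i i (by omega)) l x)) h2.symm)
  simp only [acExt_apply, map_add, map_sub, map_smul, LinearMap.sub_apply, LinearMap.smul_apply,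
    M.act_act_ext A i j e, d_act_ext]
  module

theorem exists_iso_of_gaugeRel {ω₁ ω₂ : C.MC A} (h : C.GaugeRel A ω₁ ω₂) :
    ∃ f : M.aomoto A ω₁ ⟶ M.aomoto A ω₂, IsIso f := by
  obtain ⟨l, hl, h⟩ := h
  refine ⟨mkComplexHom (fun n => ModuleCat.ofHom (nilExp (bilinExt A (M.ac 0 n n (by omega)) l)))
    fun i j e => ?_, ?_⟩
  · ext1
    exact LinearMap.ext fun x => (M.nilExp_aomotoD hl h i j e x).symm
  · have : ∀ n : ℤ, IsIso (ModuleCat.ofHom (nilExp (bilinExt A (M.ac 0 n n (by omega)) l))) :=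
      fun n => by
        rw [ConcreteCategory.isIso_iff_bijective]
        refine (Module.End.isUnit_iff _).1 (isUnit_nilExp (isNilpotent_bilinExt _ hl))
    exact @HomologicalComplex.Hom.isIso_of_components _ _ _ _ _ _ _ _ this

end DGModule

namespace DGLAPair

variable (P : DGLAPair.{u}) {A : ArtAlg.{w}}

/-- A class lies in the jump functor as soon as one representative satisfies the condition; this
shows that all of them do. -/
theorem isJumpIdeal_of_quot_eq {ω₁ ω₂ : P.C.MC A}
    (h : Quot.mk (P.C.GaugeRel A) ω₁ = Quot.mk (P.C.GaugeRel A) ω₂) {i : ℤ} {k : ℕ} {J : Ideal A} :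
    IsJumpIdeal (P.M.aomoto A ω₁) i k J ↔ IsJumpIdeal (P.M.aomoto A ω₂) i k J := by
  have key : ∀ {ω₁ ω₂ : P.C.MC A}, P.C.trunc.Conn A ω₁.1 ω₂.1 →
      IsJumpIdeal (P.M.aomoto A ω₁) i k J → IsJumpIdeal (P.M.aomoto A ω₂) i k J := by
    intro ω₁ ω₂ h h1
    obtain ⟨ω₂, h₂⟩ := ω₂
    change P.C.trunc.Conn A ω₁.1 ω₂ at h
    induction h with
    | refl => exact h1
    | @tail x y hx h ih =>
      have hmc := TruncDGLA.Conn.isMC (L := P.C.trunc) hx ω₁.2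
      obtain ⟨l, hl, h⟩ := h
      obtain ⟨f, hf⟩ := P.M.exists_iso_of_gaugeRel (ω₁ := ⟨x, hmc⟩) (ω₂ := ⟨y, h₂⟩) ⟨l, hl, h⟩
      exact (ih hmc).of_iso f
  exact ⟨key ((DGLA.gaugeRel_quot_eq_iff _ _).1 h),
    key ((DGLA.gaugeRel_quot_eq_iff _ _).1 h.symm)⟩

namespace Hom

variable {P} {Q : DGLAPair.{u}} (g : Hom P Q)

theorem defMap_mem_defJump {i : ℕ} (hg : IsQEquivalence g.snd.cx i) (k : ℕ)
    {x : (DGLA.Def.{u, w} P.C).obj A} (hx : x ∈ (P.defJump i k).obj A) :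
    g.fst.defMap.app A x ∈ (Q.defJump i k).obj A := by
  obtain ⟨ω, hω, rfl⟩ := hx
  exact ⟨g.fst.mc A ω, (isJumpIdeal_mc_iff hg k).2 hω, rfl⟩

/-- The given representative `η` is only gauge equivalent to the image of `ω`, so gauge invariance
is applied in the target before the comparison of minimal models. -/
theorem mem_defJump_of_defMap {i : ℕ} (hg : IsQEquivalence g.snd.cx i) (k : ℕ)
    {x : (DGLA.Def.{u, w} P.C).obj A} (hx : g.fst.defMap.app A x ∈ (Q.defJump i k).obj A) :
    x ∈ (P.defJump i k).obj A := by
  induction x using Quot.ind with | mk ω =>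
  obtain ⟨η, hη, h⟩ := hx
  exact ⟨ω, (isJumpIdeal_mc_iff hg k).1 ((Q.isJumpIdeal_of_quot_eq h).1 hη), rfl⟩

/-- The natural transformation of cohomology jump functors induced by `g`. -/
def defJumpMap (i k : ℕ) (hg : IsQEquivalence g.snd.cx i) :
    (defJump.{u, w} P i k).toFunctor ⟶ (defJump.{u, w} Q i k).toFunctor :=
  Subfunctor.lift ((defJump P i k).ι ≫ g.fst.defMap) (by
    rintro A _ ⟨x, rfl⟩
    exact g.defMap_mem_defJump hg k x.2)

theorem isIso_defJumpMap (i k : ℕ) (h : IsQEquivalence g.fst.cx 1)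
    (hg : IsQEquivalence g.snd.cx i) : IsIso (g.defJumpMap.{u, w} i k hg) := by
  have : ∀ A, IsIso ((g.defJumpMap.{u, w} i k hg).app A) := fun A => by
    rw [isIso_iff_bijective]
    constructor
    · intro x y hxy
      exact Subtype.ext ((g.fst.defMap_bijective h A).1 (congrArg Subtype.val hxy))
    · rintro ⟨y, hy⟩
      obtain ⟨x, rfl⟩ := (g.fst.defMap_bijective h A).2 y
      exact ⟨⟨x, g.mem_defJump_of_defMap hg k hy⟩, rfl⟩
  exact NatIso.isIso_of_isIso_app _

end Hom

theorem nonempty_iso_of_sameHomotopyType {i : ℕ} {P Q : DGLAPair.{u}} (k : ℕ)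
    (h : SameHomotopyType i P Q) :
    Nonempty ((defJump.{u, w} P i k).toFunctor ≅ (defJump.{u, w} Q i k).toFunctor) := by
  induction h with
  | rel P Q h =>
    obtain ⟨g, h1, h2⟩ := h
    have := g.isIso_defJumpMap i k h1 h2
    exact ⟨asIso (g.defJumpMap i k h2)⟩
  | refl P => exact ⟨Iso.refl _⟩
  | symm P Q _ ih => exact ih.map Iso.symm
  | trans P Q S _ _ ih₁ ih₂ =>
    obtain ⟨e⟩ := ih₁
    obtain ⟨e'⟩ := ih₂
    exact ⟨e ≪≫ e'⟩

end DGLAPair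

end

theorem theorem1p2 (i k : ℕ) :
    (∀ (P Q : DGLAPair.{u}) (g : DGLAPair.Hom P Q),
      IsQEquivalence g.fst.cx 1 → IsQEquivalence g.snd.cx i →
        ∃ τ : (DGLAPair.defJump.{u, w} P i k).toFunctor ⟶ (DGLAPair.defJump.{u, w} Q i k).toFunctor,
          τ ≫ (DGLAPair.defJump Q i k).ι = (DGLAPair.defJump P i k).ι ≫ DGLA.Hom.defMap g.fst ∧
            IsIso τ) ∧
    (∀ P Q : DGLAPair.{u}, DGLAPair.SameHomotopyType i P Q →
      Nonempty ((DGLAPair.defJump.{u, w} P i k).toFunctor ≅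
        (DGLAPair.defJump.{u, w} Q i k).toFunctor)) :=
  ⟨fun _ _ g h hg => ⟨g.defJumpMap i k hg, rfl, g.isIso_defJumpMap i k h hg⟩,
    fun _ _ h => DGLAPair.nonempty_iso_of_sameHomotopyType k h⟩
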